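/- Let $d,k\in\mathbb N$, let $\mathcal S_1,\dots,\mathcal S_n\subset\mathbb R^d$ be finitely many (possibly no) affine subspaces of dimension $d-3$, and put $\mathcal Q=\mathbb R^d\setminus\bigcup_{\ell}\mathcal S_\ell$. Let $\mathfrak m=\mathrm{diag}(m_1,\dots,m_d)$ with $m_j>0$, let $A\in H^1_{\rm loc}(\mathbb R^d,\mathbb R^d)$ and $V\in L^2_{\rm loc}(\mathcal Q,\mathrm{Herm}(\mathbb C^k))$, and let $$H_0=-\tfrac12\bigl(\mathfrak m^{-1/2}(\nabla-iA)\bigr)^2+V=-\tfrac12\sum_{j=1}^d\tfrac1{m_j}(\partial_j-iA_j)^2+V,\qquad D(H_0)=C_0^\infty(\mathcal Q,\mathbb C^k),$$ where it is understood that $H_0$ maps into $L^2(\mathbb R^d,\mathbb C^k)$. Let $H$ be a self-adjoint extension of $H_0$ in $L^2(\mathbb R^d,\mathbb C^k)$, let $\psi(0)\in D(H)$ with $\|\psi(0)\|=1$, and let $\psi(t)=e^{-itH}\psi(0)$. Assume: (i) $\psi\in C^2(\mathbb R\times\mathcal Q,\mathbb C^k)$ (that is, $\psi(t)$ has for every $t$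 a representative $\psi(t,\cdot)$ such that $(t,q)\mapsto\psi(t,q)$ is $C^2$ on $\mathbb R\times\mathcal Q$), and $A$ is $C^1$ on the open set $\{q\in\mathcal Q:\psi(t,q)\neq0\text{ for some }t\in\mathbb R\}$; (ii) for every $T>0$, $$\int_{-T}^{T}dt\,\Bigl(\bigl\|\,|\nabla\psi(t)|\,\bigr\|^2+\bigl\|\,|A|\,|\psi(t)|\,\bigr\|^2+\bigl\|A\cdot\nabla\psi(t)\bigr\|^2\Bigr)<\infty .$$ Let $\mu_t$ be the measure $\mu_t(dq)=|\psi(t,q)|^2\,dq$ on $\mathcal Q$. Then: (a) for $\mu_0$-almost every $q\in\mathbb R^d$ there is a unique $Q_q:\mathbb R\to\mathcal Q$ with $Q_q(0)=q$ such that, for all $t\in\mathbb R$, $\psi(t,Q_q(t))\neq0$ and $$\frac{dQ_q}{dt}(t)=\mathfrak m^{-1}\,\mathrm{Im}\,\frac{\psi^*(\nabla-iA)\psi}{\psi^*\psi}\bigl(t,Q_q(t)\bigr);$$ (b) the $|\psi(t)|^2$ distributions are equivariant on $\mathbb R$: if $\varphi_t(q)=Q_q(t)$ denotes the flow map of this equation,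 where $Q_q$ is the maximal solution in $\mathcal Q$ away from the nodes of $\psi$ and $\varphi_t(q)$ is set to a cemetery state $\dagger$ at times $t\ne0$ at which it does not exist, then $\mu_0\circ\varphi_t^{-1}=\mu_t$ for all $t\in\mathbb R$. -/

import Mathlib

namespace Bohm

noncomputable section

open MeasureTheory
open scoped ContDiff

/-- The space `ℝ^d` with its Euclidean norm. -/
abbrev Cfg (d : ℕ) : Type := EuclideanSpace ℝ (Fin d)

/-- The value space `ℂ^k` of the wave function, with its Hermitian norm. -/
abbrev Spin (k : ℕ) : Type := EuclideanSpace ℂ (Fin k)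

/-- The Hilbert space `L²(ℝ^d, ℂ^k)`. -/
abbrev L2 (d k : ℕ) : Type := Lp (Spin k) 2 (volume : Measure (Cfg d))

/-- The configuration space: `ℝ^d` minus the given finitely many affine subspaces. -/
def conf {d n : ℕ} (S : Fin n → AffineSubspace ℝ (Cfg d)) : Set (Cfg d) :=
  (⋃ l, (S l : Set (Cfg d)))ᶜ

/-- The classical partial derivative `∂_j f (q)`. -/
def pd {d : ℕ} {F : Type*} [NormedAddCommGroup F] [NormedSpace ℝ F]
    (j : Fin d) (f : Cfg d → F) (q : Cfg d) : F :=
  fderiv ℝ f q (EuclideanSpace.single j 1)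

/-- `f ∈ L²_loc(Ω)`: square integrable on every compact subset of `Ω`. -/
def MemL2loc {d : ℕ} {F : Type*} [NormedAddCommGroup F] (Ω : Set (Cfg d)) (f : Cfg d → F) : Prop :=
  ∀ K ⊆ Ω, IsCompact K → MemLp f 2 (volume.restrict K)

/-- `g` is the weak (distributional) partial derivative `∂_j f` on all of `ℝ^d`. -/
structure HasWeakPartial {d : ℕ} (j : Fin d) (f g : Cfg d → ℝ) : Prop where
  locallyIntegrable : LocallyIntegrable f volume
  locallyIntegrable_deriv : LocallyIntegrable g volume
  integral_eq : ∀ χ : Cfg d → ℝ, ContDiff ℝ ∞ χ → HasCompactSupport χ →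
    ∫ q, f q * pd j χ q = -∫ q, g q * χ q

open Classical in
/-- The weak partial derivative `∂_j f` (unique up to null sets), zero if there is none. -/
def weakPartial {d : ℕ} (j : Fin d) (f : Cfg d → ℝ) : Cfg d → ℝ :=
  if h : ∃ g, HasWeakPartial j f g then h.choose else 0

/-- `A ∈ H¹_loc(ℝ^d, ℝ^d)`. -/
def MemH1loc {d : ℕ} (A : Cfg d → Cfg d) : Prop :=
  ∀ j, MemL2loc Set.univ (fun q => A q j) ∧
    ∀ i, ∃ g, HasWeakPartial i (fun q => A q j) g ∧ MemL2loc Set.univ g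

/-- `(∂_j - i A_j)² φ = ∂_j² φ - 2 i A_j ∂_j φ - i (∂_j A_j) φ - A_j² φ` for smooth `φ`,
with the weak derivative of `A_j`. -/
def magneticSq {d k : ℕ} (A : Cfg d → Cfg d) (j : Fin d) (φ : Cfg d → Spin k) (q : Cfg d) :
    Spin k :=
  pd j (pd j φ) q - (2 * Complex.I * (A q j : ℂ)) • pd j φ q
    - (Complex.I * (weakPartial j (fun x => A x j) q : ℂ)) • φ q - ((A q j : ℂ) ^ 2) • φ q

/-- The magnetic Schrödinger expression
`H₀ φ = -½ (𝔪^{-1/2} (∇ - i A))² φ + V φ`, where `𝔪 = diag(m₁, …, m_d)`. -/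
def schrodingerExpr {d k : ℕ} (m : Fin d → ℝ) (A : Cfg d → Cfg d)
    (V : Cfg d → Matrix (Fin k) (Fin k) ℂ) (φ : Cfg d → Spin k) (q : Cfg d) : Spin k :=
  -((1 / 2 : ℂ) • ∑ j, (((m j)⁻¹ : ℝ) : ℂ) • magneticSq A j φ q)
    + Matrix.toEuclideanLin (V q) (φ q)

/-- `H` extends `H₀` with domain `C₀^∞(Ω, ℂ^k)`; in particular `H₀ φ` is square integrable
for all `φ ∈ C₀^∞(Ω, ℂ^k)`. -/
def ExtendsSchrodinger {d k : ℕ} (m : Fin d → ℝ) (A : Cfg d → Cfg d)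
    (V : Cfg d → Matrix (Fin k) (Fin k) ℂ) (Ω : Set (Cfg d)) (H : L2 d k →ₗ.[ℂ] L2 d k) : Prop :=
  ∀ φ : Cfg d → Spin k, ContDiff ℝ ∞ φ → HasCompactSupport φ → tsupport φ ⊆ Ω →
    ∃ u v : L2 d k, (u, v) ∈ H.graph ∧ u =ᵐ[volume] φ ∧ v =ᵐ[volume] schrodingerExpr m A V φ

/-- `U t = e^{-itH}`: `U` is the strongly continuous one-parameter unitary group whose generator
is exactly `-iH`, i.e. `f ∈ D(H)` and `H f = g` if and only if `t ↦ U t f` is differentiable at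
`0` with derivative `-i g`. -/
structure IsUnitaryGroupOf {𝓗 : Type*} [NormedAddCommGroup 𝓗] [InnerProductSpace ℂ 𝓗]
    [NormedSpace ℝ 𝓗] (H : 𝓗 →ₗ.[ℂ] 𝓗) (U : ℝ → 𝓗 ≃ₗᵢ[ℂ] 𝓗) : Prop where
  map_add : ∀ s t f, U (s + t) f = U s (U t f)
  continuous : ∀ f, Continuous fun t => U t f
  generator : ∀ f g, (f, g) ∈ H.graph ↔ HasDerivAt (fun t : ℝ => U t f) (-(Complex.I • g)) 0

/-- The Bohmian velocity field `𝔪⁻¹ Im (ψ* (∇ - i A) ψ) / (ψ* ψ)` at `(t, q)`. -/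
def velocity {d k : ℕ} (m : Fin d → ℝ) (A : Cfg d → Cfg d) (ψ : ℝ → Cfg d → Spin k)
    (t : ℝ) (q : Cfg d) : Cfg d :=
  WithLp.toLp 2 fun j => (m j)⁻¹ *
    (inner ℂ (ψ t q) (pd j (ψ t) q - (Complex.I * (A q j : ℂ)) • ψ t q)
      / inner ℂ (ψ t q) (ψ t q)).im

/-- `Q` solves the Bohmian equation of motion on the time set `I`: it stays in `Ω` and away from
the nodes of `ψ`, and `dQ/dt` is the Bohmian velocity. -/
def IsTrajectoryOn {d k : ℕ} (m : Fin d → ℝ) (A : Cfg d → Cfg d) (ψ : ℝ → Cfg d → Spin k)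
    (Ω : Set (Cfg d)) (I : Set ℝ) (Q : ℝ → Cfg d) : Prop :=
  ∀ t ∈ I, Q t ∈ Ω ∧ ψ t (Q t) ≠ 0 ∧ HasDerivAt Q (velocity m A ψ t (Q t)) t

/-- The trajectory starting in `q` at time `0` exists on an open interval containing `0` and `t`,
and is in `x` at time `t`. -/
def Reaches {d k : ℕ} (m : Fin d → ℝ) (A : Cfg d → Cfg d) (ψ : ℝ → Cfg d → Spin k)
    (Ω : Set (Cfg d)) (t : ℝ) (q x : Cfg d) : Prop :=
  ∃ (I : Set ℝ) (Q : ℝ → Cfg d), IsOpen I ∧ I.OrdConnected ∧ 0 ∈ I ∧ t ∈ I ∧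
    IsTrajectoryOn m A ψ Ω I Q ∧ Q 0 = q ∧ Q t = x

open Classical in
/-- The flow map `φ_t(q) = Q_q(t)`, where `Q_q` is the maximal solution with `Q_q(0) = q`. The
cemetery configuration `none` is the value at times at which the maximal solution does not exist
(any `t ≠ 0` if it does not exist at all). -/
def flow {d k : ℕ} (m : Fin d → ℝ) (A : Cfg d → Cfg d) (ψ : ℝ → Cfg d → Spin k)
    (Ω : Set (Cfg d)) (t : ℝ) (q : Cfg d) : Option (Cfg d) :=
  if t = 0 then some q
  else if h : ∃ x, Reaches m A ψ Ω t q x then some h.choose else none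

/-- The measure `μ_t(dq) = |ψ(t, q)|² dq` on `Ω`. -/
def densityMeasure {d k : ℕ} (ψ : ℝ → Cfg d → Spin k) (Ω : Set (Cfg d)) (t : ℝ) :
    Measure (Cfg d) :=
  (volume.restrict Ω).withDensity fun q => ‖ψ t q‖ₑ ^ 2

/-- Equivariance on the time set `I`: for `t ∈ I` the distribution `ρ_t = μ_0 ∘ φ_t⁻¹` of the
flow equals `μ_t`, as measures on configurations together with the cemetery (which has
`μ_t`-measure zero). -/
def IsEquivariantOn {d k : ℕ} (m : Fin d → ℝ) (A : Cfg d → Cfg d) (ψ : ℝ → Cfg d → Spin k)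
    (Ω : Set (Cfg d)) (I : Set ℝ) : Prop :=
  ∀ t ∈ I, ∀ B : Set (Option (Cfg d)), MeasurableSet (some ⁻¹' B) →
    NullMeasurableSet (flow m A ψ Ω t ⁻¹' B) (densityMeasure ψ Ω 0) ∧
    densityMeasure ψ Ω 0 (flow m A ψ Ω t ⁻¹' B) = densityMeasure ψ Ω t (some ⁻¹' B)

end

end Bohm

/-! A Bohmian trajectory can break down only by running into a node of `ψ`, into one of the
subspaces, or off to infinity. On the open space-time region `nonNodal` the velocity is C¹, so
solutions are locally unique, and |ψ|² satisfies the continuity equation with this velocity. Hence,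
as long as it exists, the flow carries μ_0 to a measure that is at most μ_t
(`map_restrict_withDensity_le`).

Breakdown is detected by the functions log |ψ|², log(1 + |q|²) and log dist(q, S_l)² (`confiner`):
while they and the time stay bounded, the trajectory stays in a compact subset of the region. By the
transport inequality, the expected variation of such a function h along trajectories is at most the
integral of |ψ|² |∂_t h + v·∇h| over space-time. When this is finite, Chebyshev's inequality makes
it unlikely that h reaches a high level, so almost every trajectory is global
(`exists_isOpen_solutionJoins`, `ConfinedFlow.ae_existsUnique`). Equivariance follows because the
transport inequality compares two measures of total mass one (`ConfinedFlow.equivariant`).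

Finiteness rests on |ψ||v| ≤ C(|∇ψ| + |A||ψ|) and on ∂_tψ = -iHψ, whose L² norm is constant in time.
The distance functions also require |ψ|²/dist² to be integrable, which is Hardy's inequality in
codimension three (`lintegral_div_distSq_le`).

For the continuity equation, `ψ(t)` solves the Schrödinger equation weakly because `H` is a
self-adjoint extension of H_0. As `ψ` is C², integration by parts yields the classical equation
almost everywhere (`schrodinger_eq_ae`). Pairing with `ψ` and taking imaginary parts removes the
Hermitian potential; what remains is an identity between continuous functions, hence true everywhere
(`continuityEqAt_velocityField`). -/

open MeasureTheory Set Filter Topology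
open scoped ContDiff NNReal ENNReal


/-! ### Integration along lines and the du Bois-Reymond lemma -/

section LineDerivatives

open Measure Module

variable {E F : Type*} [NormedAddCommGroup E] [NormedSpace ℝ E] [MeasurableSpace E]
  [NormedAddCommGroup F] [NormedSpace ℝ F]

/-- Fubini reduces the claim to single lines, where an integrable function with integrable
derivative has derivative of integral zero. -/
lemma integral_prod_hasLineDerivAt_eq_zero {μ : Measure E} [SigmaFinite μ]
    {f f' : E × ℝ → F} {N : Set (E × ℝ)}
    (hN : ∀ᵐ p ∂(μ.prod volume), ∀ s : ℝ, p + s • ((0 : E), (1 : ℝ)) ∉ N)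
    (hf : ∀ p ∉ N, HasLineDerivAt ℝ f (f' p) p (0, 1))
    (hfi : Integrable f (μ.prod volume)) (hfi' : Integrable f' (μ.prod volume)) :
    ∫ p, f' p ∂(μ.prod volume) = 0 := by
  rw [integral_prod _ hfi']
  refine integral_eq_zero_of_ae ?_
  filter_upwards [hfi'.prod_right_ae, hfi.prod_right_ae, ae_ae_of_ae_prod hN] with x h' h hx
  -- Avoiding `N` is a property of the whole line, so one good point on it suffices.
  obtain ⟨t₀, ht₀⟩ := hx.exists
  refine integral_eq_zero_of_hasDerivAt_of_integrable (f := fun t => f (x, t)) (fun t => ?_) h' h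
  have hm : (x, t) ∉ N := by
    have := ht₀ (t - t₀)
    simpa using this
  have h1 := hf _ hm
  convert! h1.scomp_of_eq t ((hasDerivAt_id t).add (hasDerivAt_const t (-t))) (by simp) <;> simp

/-- The integral of a directional derivative vanishes for an integrable function with integrable
directional derivative, even if it is differentiable only along almost every line. -/
theorem integral_hasLineDerivAt_eq_zero [CompleteSpace F] [BorelSpace E] [FiniteDimensional ℝ E]
    {μ : Measure E} [IsAddHaarMeasure μ] {f f' : E → F} {v : E} {N : Set E}
    (hN : ∀ᵐ x ∂μ, ∀ s : ℝ, x + s • v ∉ N)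
    (hf : ∀ x ∉ N, HasLineDerivAt ℝ f (f' x) x v)
    (hfi : Integrable f μ) (hfi' : Integrable f' μ) :
    ∫ x, f' x ∂μ = 0 := by
  rcases eq_or_ne v 0 with rfl | hv
  · refine integral_eq_zero_of_ae ?_
    filter_upwards [hN] with x hx
    have hx0 := hx 0
    simp only [smul_zero, add_zero] at hx0
    have := (hf x hx0).lineDeriv
    rw [(hasLineDerivAt_zero (f := f) (x := x)).lineDeriv] at this
    simp [← this]
  have : Nontrivial E := nontrivial_iff.2 ⟨v, 0, hv⟩
  let n := finrank ℝ E
  let E' := Fin (n - 1) → ℝ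
  -- Linear coordinates in which `v` is the last basis vector; the Haar measures then differ only by
  -- a constant.
  obtain ⟨L, hL⟩ : ∃ L : E ≃L[ℝ] (E' × ℝ), L v = (0, 1) := by
    have : finrank ℝ (E' × ℝ) = n := by simpa [this, E'] using Nat.sub_add_cancel finrank_pos
    have L₀ : E ≃L[ℝ] (E' × ℝ) := (ContinuousLinearEquiv.ofFinrankEq this).symm
    obtain ⟨M, hM⟩ : ∃ M : (E' × ℝ) ≃L[ℝ] (E' × ℝ), M (L₀ v) = (0, 1) := by
      apply SeparatingDual.exists_continuousLinearEquiv_apply_eq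
      · simpa using hv
      · simp
    exact ⟨L₀.trans M, by simp [hM]⟩
  have hLs : L.symm (0, 1) = v := by rw [← hL]; simp
  have L_emb : MeasurableEmbedding L := L.toHomeomorph.measurableEmbedding
  have Ls_emb : MeasurableEmbedding L.symm := L.symm.toHomeomorph.measurableEmbedding
  let ν₀ : Measure E' := addHaar
  let ν := Measure.map L μ
  have hν : ν = (addHaarScalarFactor ν (ν₀.prod volume)) • (ν₀.prod volume) :=
    isAddLeftInvariant_eq_smul _ _
  have hν' : ν₀.prod volume = (addHaarScalarFactor (ν₀.prod volume) ν) • ν :=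
    isAddLeftInvariant_eq_smul _ _
  have hμ : μ = Measure.map L.symm ν := by
    simp [ν, Measure.map_map L.symm.continuous.measurable L.continuous.measurable]
  have key : ∫ p, f' (L.symm p) ∂(ν₀.prod volume) = 0 := by
    refine integral_prod_hasLineDerivAt_eq_zero (f := f ∘ L.symm) (N := L.symm ⁻¹' N) ?_ ?_ ?_ ?_
    · have h1 : ∀ᵐ p ∂ν, ∀ s : ℝ, p + s • ((0 : E'), (1 : ℝ)) ∉ L.symm ⁻¹' N := by
        rw [L_emb.ae_map_iff]
        filter_upwards [hN] with x hx s
        rw [mem_preimage, map_add, map_smul, hLs]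
        simpa using hx s
      rw [hν']
      exact Measure.ae_smul_measure h1 _
    · intro p hp
      have h1 := hf (L.symm p) hp
      rw [← hLs] at h1
      unfold HasLineDerivAt at h1 ⊢
      simpa only [Function.comp_def, map_add, map_smul] using h1
    · rw [hν']
      refine Integrable.smul_measure_nnreal ?_
      simpa [ν, L_emb.integrable_map_iff, Function.comp_def] using hfi
    · rw [hν']
      refine Integrable.smul_measure_nnreal ?_
      simpa [ν, L_emb.integrable_map_iff, Function.comp_def] using hfi'
  rw [hμ, Ls_emb.integral_map, hν, integral_smul_nnreal_measure, key, smul_zero]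

end LineDerivatives

/-- **du Bois-Reymond lemma** for continuous functions. -/
theorem eq_of_integral_deriv_mul_eq_zero {f : ℝ → ℝ} (hf : Continuous f) {a b : ℝ}
    (h : ∀ η : ℝ → ℝ, ContDiff ℝ ∞ η → HasCompactSupport η → tsupport η ⊆ Ioo a b →
      ∫ s, deriv η s * f s = 0) {s t : ℝ} (hs : s ∈ Icc a b) (ht : t ∈ Icc a b) : f s = f t := by
  rcases eq_or_ne a b with rfl | hab
  · have := le_antisymm hs.1 hs.2; have := le_antisymm ht.1 ht.2; subst_vars; rfl
  have hab' : a < b := lt_of_le_of_ne (hs.1.trans hs.2) hab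
  suffices H : ∀ s ∈ Ioo a b, ∀ t ∈ Ioo a b, f s = f t by
    have hmid : (a + b) / 2 ∈ Ioo a b := ⟨by linarith, by linarith⟩
    have h2 : EqOn f (fun _ => f ((a + b) / 2)) (closure (Ioo a b)) :=
      EqOn.closure (fun x hx => H x hx _ hmid) hf continuous_const
    rw [closure_Ioo hab] at h2
    rw [h2 hs, h2 ht]
  intro s hs t ht
  rcases eq_or_ne s t with rfl | hst
  · rfl
  have hc : ∀ᶠ n : ℕ in atTop, ∀ x ∈ uIcc s t, x - 1 / ((n : ℝ) + 1) > a ∧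
      x + 1 / ((n : ℝ) + 1) < b := by
    have h1 : 0 < min (min s t - a) (b - max s t) := by
      simp only [lt_min_iff, sub_pos, max_lt_iff]
      exact ⟨⟨hs.1, ht.1⟩, hs.2, ht.2⟩
    have h2 := (tendsto_one_div_add_atTop_nhds_zero_nat (𝕜 := ℝ)).eventually (gt_mem_nhds h1)
    filter_upwards [h2] with n hn x hx
    rw [lt_min_iff] at hn
    rw [uIcc, mem_Icc] at hx
    constructor <;> [linarith [hx.1]; linarith [hx.2]]
  let φ : ℕ → ContDiffBump (0 : ℝ) := fun n =>
    ⟨1 / ((n : ℝ) + 1) / 2, 1 / ((n : ℝ) + 1), by positivity, half_lt_self (by positivity)⟩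
  have hφ : Tendsto (fun n => (φ n).rOut) atTop (𝓝 0) :=
    tendsto_one_div_add_atTop_nhds_zero_nat
  have hlim : ∀ x, Tendsto (fun n => ∫ y, (φ n).normed volume (x - y) * f y) atTop (𝓝 (f x)) := by
    intro x
    have h1 := ContDiffBump.convolution_tendsto_right_of_continuous (μ := volume) hφ hf x
    refine h1.congr fun n => ?_
    rw [convolution_eq_swap]
    simp
  refine tendsto_nhds_unique (hlim s) ((hlim t).congr' ?_)
  filter_upwards [hc] with n hn
  have hd : ∀ x, HasDerivAt (fun x => ∫ y, (φ n).normed volume (x - y) * f y)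
      (∫ y, deriv ((φ n).normed volume) (x - y) * f y) x := by
    intro x
    have h1 := (φ n).hasCompactSupport_normed (μ := volume)
    have h2 := HasCompactSupport.hasDerivAt_convolution_right (𝕜 := ℝ) (μ := volume)
      (ContinuousLinearMap.mul ℝ ℝ) (f₀ := f) (g₀ := (φ n).normed volume) hf.locallyIntegrable h1
      ((φ n).contDiff_normed (n := 1)) x
    have e1 : (fun x => ∫ y, (φ n).normed volume (x - y) * f y) =
        convolution f ((φ n).normed volume) (ContinuousLinearMap.mul ℝ ℝ) volume := by
      ext x; simp [convolution_def, mul_comm]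
    rw [e1]
    convert! h2 using 1
    simp [convolution_def, mul_comm]
  have hz : ∀ x ∈ uIcc s t, ∫ y, deriv ((φ n).normed volume) (x - y) * f y = 0 := by
    intro x hx
    have hsm : ContDiff ℝ ∞ ((φ n).normed volume) := (φ n).contDiff_normed
    -- The derivative of the mollification at `x` is, up to sign, the hypothesis tested with the
    -- bump reflected and moved to `x`.
    have h1 := h (fun y => (φ n).normed volume (x - y)) (by fun_prop) ?_ ?_
    · have e : ∀ y, deriv (fun y => (φ n).normed volume (x - y)) y =
          - deriv ((φ n).normed volume) (x - y) := fun y => deriv_comp_const_sub _ _ _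
      simp only [e, neg_mul, integral_neg, neg_eq_zero] at h1
      exact h1
    · exact (φ n).hasCompactSupport_normed.comp_homeomorph (Homeomorph.subLeft x)
    · have := tsupport_comp_subset_preimage ((φ n).normed volume) (f := fun y => x - y)
        (by fun_prop)
      refine this.trans fun y hy => ?_
      rw [mem_preimage, (φ n).tsupport_normed_eq, Metric.mem_closedBall, Real.dist_eq,
        sub_zero, abs_le] at hy
      have := hn x hx
      change -(1 / ((n : ℝ) + 1)) ≤ x - y ∧ x - y ≤ (1 / ((n : ℝ) + 1)) at hy
      constructor <;> linarith [hy.1, hy.2, this.1, this.2]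
  refine (Convex.is_const_of_fderivWithin_eq_zero (𝕜 := ℝ) (convex_uIcc s t)
    (f := fun x => ∫ y, (φ n).normed volume (x - y) * f y) (fun x _ =>
      (hd x).differentiableAt.differentiableWithinAt) (fun x hx => ?_) right_mem_uIcc left_mem_uIcc)
  have hu : UniqueDiffWithinAt ℝ (uIcc s t) x :=
    uniqueDiffOn_Icc (inf_lt_sup.2 hst) x hx
  have := (hd x).hasFDerivAt.hasFDerivWithinAt (s := uIcc s t)
  rw [this.fderivWithin hu, hz x hx]
  ext; simp

/-! ### Global flows of bounded Lipschitz vector fields -/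

section Flow

variable {E : Type*} [NormedAddCommGroup E] [NormedSpace ℝ E]

/-- Curves defined on `(-n-1, n+1)` for all `n`, each extending the previous ones, glue to a
global curve. -/
lemma exists_eqOn_of_eqOn_Ioo {X : Type*} (γ : ℕ → ℝ → X)
    (h : ∀ n m, n ≤ m → EqOn (γ n) (γ m) (Ioo (-((n : ℝ) + 1)) (n + 1))) :
    ∃ Γ : ℝ → X, ∀ n, EqOn Γ (γ n) (Ioo (-((n : ℝ) + 1)) (n + 1)) := by
  refine ⟨fun t => γ ⌊|t|⌋₊ t, fun n t ht => ?_⟩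
  have h1 : |t| < n + 1 := abs_lt.2 ht
  have h2 : ⌊|t|⌋₊ ≤ n := by
    have := (Nat.floor_lt (abs_nonneg t)).2 (by exact_mod_cast h1 : |t| < ((n + 1 : ℕ) : ℝ))
    omega
  exact h _ _ h2 (abs_lt.1 (Nat.lt_floor_add_one |t|))

/-- A bounded, Lipschitz, time-dependent vector field has global integral curves. -/
theorem exists_forall_hasDerivAt [CompleteSpace E] {w : ℝ → E → E} {K M : ℝ≥0}
    (hK : ∀ t, LipschitzWith K (w t)) (hc : ∀ x, Continuous fun t => w t x)
    (hM : ∀ t x, ‖w t x‖ ≤ M) (s : ℝ) (x : E) :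
    ∃ γ : ℝ → E, γ s = x ∧ ∀ t, HasDerivAt γ (w t (γ t)) t := by
  wlog hs : s = 0 generalizing s w
  · obtain ⟨γ, h0, h1⟩ := this (w := fun t => w (t + s)) (fun t => hK _)
      (fun x => (hc x).comp (continuous_id.add continuous_const)) (fun t x => hM _ _) 0 rfl
    refine ⟨fun t => γ (t - s), by simpa using h0, fun t => ?_⟩
    have := (h1 (t - s)).comp_sub_const (x := t) (a := s)
    simpa using this
  subst hs
  have ex : ∀ n : ℕ, ∃ γ : ℝ → E, γ 0 = x ∧
      ∀ t ∈ Ioo (-((n : ℝ) + 1)) (n + 1), HasDerivAt γ (w t (γ t)) t := by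
    intro n
    have hn : (0 : ℝ) ≤ (n : ℝ) + 1 := by positivity
    let t₀ : Icc (-((n : ℝ) + 1)) (n + 1) := ⟨0, by constructor <;> linarith⟩
    -- Speed at most `M` keeps the curve within distance `M (n + 1)` of `x` up to time `n + 1`, so
    -- Picard-Lindelöf covers the whole interval.
    have hP : IsPicardLindelof w t₀ x (M * ⟨(n : ℝ) + 1, hn⟩) 0 M K :=
      { lipschitzOnWith := fun t _ => (hK t).lipschitzOnWith
        continuousOn := fun x _ => (hc x).continuousOn
        norm_le := fun t _ x _ => hM t x
        mul_max_le := by simp [t₀]; exact le_rfl }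
    obtain ⟨γ, h0, h1⟩ := hP.exists_eq_forall_mem_Icc_hasDerivWithinAt₀
    exact ⟨γ, h0, fun t ht => (h1 t (Ioo_subset_Icc_self ht)).hasDerivAt (Icc_mem_nhds ht.1 ht.2)⟩
  choose γ h0 h1 using ex
  have hU : ∀ n m, n ≤ m → EqOn (γ n) (γ m) (Ioo (-((n : ℝ) + 1)) (n + 1)) := by
    intro n m hnm
    have hnm' : (n : ℝ) ≤ m := by exact_mod_cast hnm
    refine ODE_solution_unique_of_mem_Ioo (v := w) (s := fun _ => univ) (K := K) (t₀ := 0)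
      (fun t _ => (hK t).lipschitzOnWith) ?_ (fun t ht => ⟨h1 n t ht, trivial⟩)
      (fun t ht => ⟨h1 m t ⟨?_, ?_⟩, trivial⟩) (by rw [h0, h0])
    · constructor <;> [have := n.cast_nonneg (α := ℝ); skip] <;> [linarith; positivity]
    · linarith [ht.1]
    · linarith [ht.2]
  obtain ⟨Γ, hΓ⟩ := exists_eqOn_of_eqOn_Ioo γ hU
  refine ⟨Γ, ?_, fun t => ?_⟩
  · rw [hΓ 0 (by simp), h0]
  · have ht : t ∈ Ioo (-((⌊|t|⌋₊ : ℝ) + 1)) (⌊|t|⌋₊ + 1) := abs_lt.1 (Nat.lt_floor_add_one |t|)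
    rw [hΓ _ ht]
    refine (h1 _ t ht).congr_of_eventuallyEq ?_
    filter_upwards [Ioo_mem_nhds ht.1 ht.2] with y hy using hΓ _ hy

/-- `Φ s t x` is the position at time `t` of the integral curve of `w` through `x` at time `s`. -/
structure IsGlobalFlow (w : ℝ → E → E) (K M : ℝ≥0) (Φ : ℝ → ℝ → E → E) : Prop where
  lipschitz : ∀ t, LipschitzWith K (w t)
  bound : ∀ t x, ‖w t x‖ ≤ M
  self : ∀ s x, Φ s s x = x
  hasDerivAt : ∀ s x t, HasDerivAt (fun t => Φ s t x) (w t (Φ s t x)) t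

theorem exists_isGlobalFlow [CompleteSpace E] {w : ℝ → E → E} {K M : ℝ≥0}
    (hK : ∀ t, LipschitzWith K (w t)) (hc : ∀ x, Continuous fun t => w t x)
    (hM : ∀ t x, ‖w t x‖ ≤ M) : ∃ Φ, IsGlobalFlow w K M Φ := by
  choose Φ h0 h1 using exists_forall_hasDerivAt hK hc hM
  exact ⟨fun s t x => Φ s x t, hK, hM, h0, h1⟩

namespace IsGlobalFlow

variable {w : ℝ → E → E} {K M : ℝ≥0} {Φ : ℝ → ℝ → E → E} (h : IsGlobalFlow w K M Φ)
include h

theorem unique {γ : ℝ → E} (hγ : ∀ t, HasDerivAt γ (w t (γ t)) t) (s t : ℝ) :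
    Φ s t (γ s) = γ t := by
  have := ODE_solution_unique_univ (v := w) (s := fun _ => univ) (K := K) (t₀ := s)
      (f := fun t => Φ s t (γ s)) (g := γ)
      (fun t => (h.lipschitz t).lipschitzOnWith) (fun t => ⟨h.hasDerivAt s _ t, trivial⟩)
      (fun t => ⟨hγ t, trivial⟩) (h.self s _)
  exact congrFun this t

theorem trans (s s' t : ℝ) (x : E) : Φ s' t (Φ s s' x) = Φ s t x :=
  h.unique (h.hasDerivAt s x) s' t

theorem dist_time (s t t' : ℝ) (x : E) : dist (Φ s t x) (Φ s t' x) ≤ M * dist t t' := by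
  have : LipschitzWith M fun t => Φ s t x :=
    lipschitzWith_of_nnnorm_deriv_le (fun t => (h.hasDerivAt s x t).differentiableAt) fun t => by
      rw [(h.hasDerivAt s x t).deriv]; exact h.bound _ _
  exact this.dist_le_mul t t'

/-- Grönwall's inequality forward in time; for `t ≤ s` it is applied to the time-reversed field. -/
theorem dist_space (s t : ℝ) (x y : E) :
    dist (Φ s t x) (Φ s t y) ≤ Real.exp (K * |t - s|) * dist x y := by
  rcases le_total s t with hst | hst
  · have := dist_le_of_trajectories_ODE (v := w) (K := K) (a := s) (b := t) (δ := dist x y)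
      (f := fun t => Φ s t x) (g := fun t => Φ s t y) h.lipschitz
      (HasDerivAt.continuousOn fun r _ => h.hasDerivAt s x r)
      (fun r _ => (h.hasDerivAt s x r).hasDerivWithinAt)
      (HasDerivAt.continuousOn fun r _ => h.hasDerivAt s y r)
      (fun r _ => (h.hasDerivAt s y r).hasDerivWithinAt) (by simp [h.self]) t ⟨hst, le_rfl⟩
    rwa [mul_comm, abs_of_nonneg (sub_nonneg.2 hst)]
  · have hd : ∀ x r, HasDerivAt (fun r => Φ s (-r) x) (-w (-r) (Φ s (-r) x)) r := by
      intro x r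
      have := (h.hasDerivAt s x (-r)).scomp r (hasDerivAt_neg r)
      simpa [Function.comp_def] using this
    have := dist_le_of_trajectories_ODE (v := fun r x => -w (-r) x) (K := K) (a := -s) (b := -t)
      (δ := dist x y)
      (f := fun r => Φ s (-r) x) (g := fun r => Φ s (-r) y) (fun r => (h.lipschitz _).neg)
      (HasDerivAt.continuousOn fun r _ => hd x r)
      (fun r _ => (hd x r).hasDerivWithinAt)
      (HasDerivAt.continuousOn fun r _ => hd y r)
      (fun r _ => (hd y r).hasDerivWithinAt) (by simp [h.self]) (-t) ⟨by linarith, le_rfl⟩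
    rw [abs_of_nonpos (sub_nonpos.2 hst), mul_comm]
    simp only [neg_neg] at this
    convert! this using 4
    ring

/-- Changing the starting time from `s` to `s'` amounts to moving the starting point by at most `M
|s - s'|`. -/
theorem dist_start (s s' t : ℝ) (x : E) :
    dist (Φ s t x) (Φ s' t x) ≤ Real.exp (K * |t - s'|) * (M * dist s s') := by
  rw [← h.trans s s' t x]
  refine (h.dist_space s' t _ _).trans ?_
  gcongr
  have := h.dist_time s s' s x
  rwa [h.self, dist_comm s' s] at this

theorem continuous_forward (s : ℝ) : Continuous fun p : ℝ × E => Φ s p.1 p.2 := by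
  refine continuous_iff_continuousAt.2 fun p => ?_
  rw [ContinuousAt, tendsto_iff_dist_tendsto_zero]
  have h0 : Tendsto (fun q : ℝ × E => Real.exp (K * |q.1 - s|) * dist q.2 p.2 +
      M * dist q.1 p.1) (𝓝 p) (𝓝 0) := by
    have : Continuous (fun q : ℝ × E => Real.exp (K * |q.1 - s|) * dist q.2 p.2 +
      M * dist q.1 p.1) := by fun_prop
    have := this.tendsto p
    simpa using this
  refine squeeze_zero (fun _ => dist_nonneg) (fun q => ?_) h0
  exact (dist_triangle _ (Φ s q.1 p.2) _).trans (add_le_add (h.dist_space ..) (h.dist_time ..))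

/-- This makes test functions transported by the flow Lipschitz in space-time, which is all that is
needed of them; the flow itself never has to be differentiated in its initial point. -/
theorem lipschitzOnWith_backward (t T : ℝ) : ∃ C, LipschitzOnWith C
    (fun p : ℝ × E => Φ p.1 t p.2) (Icc (t - T) (t + T) ×ˢ univ) := by
  refine ⟨Real.toNNReal (Real.exp (K * T) * (1 + M)), LipschitzOnWith.of_dist_le_mul ?_⟩
  rintro ⟨s, x⟩ ⟨hs, -⟩ ⟨s', x'⟩ ⟨hs', -⟩
  rw [Real.coe_toNNReal _ (by positivity)]
  have e : ∀ r ∈ Icc (t - T) (t + T), |t - r| ≤ T := by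
    intro r hr
    exact abs_le.2 ⟨by linarith [hr.2], by linarith [hr.1]⟩
  calc dist (Φ s t x) (Φ s' t x')
      ≤ dist (Φ s t x) (Φ s t x') + dist (Φ s t x') (Φ s' t x') := dist_triangle _ _ _
    _ ≤ Real.exp (K * T) * dist x x' + Real.exp (K * T) * (M * dist s s') := by
        refine add_le_add ((h.dist_space ..).trans ?_) ((h.dist_start ..).trans ?_)
        · gcongr; exact e s hs
        · gcongr; exact e s' hs'
    _ ≤ Real.exp (K * T) * dist (s, x) (s', x') + Real.exp (K * T) * (M * dist (s, x) (s', x')) := by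
        gcongr
        · exact le_max_right _ _
        · exact le_max_left _ _
    _ = _ := by ring

theorem continuous_backward (t : ℝ) : Continuous fun p : ℝ × E => Φ p.1 t p.2 := by
  refine continuous_iff_continuousAt.2 fun p => ?_
  obtain ⟨C, hC⟩ := h.lipschitzOnWith_backward t (|p.1 - t| + 1)
  refine hC.continuousOn.continuousAt (prod_mem_nhds (Icc_mem_nhds ?_ ?_) univ_mem)
  · linarith [neg_abs_le (p.1 - t)]
  · linarith [le_abs_self (p.1 - t)]

end IsGlobalFlow

end Flow


/-! ### Transport of a density satisfying the continuity equation -/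

namespace Bohm

/-- The unit vector `e_j` of `ℝ^d`. -/
noncomputable abbrev unitVec {d : ℕ} (j : Fin d) : Cfg d := EuclideanSpace.single j 1

/-- Rademacher's theorem and integration by parts for Lipschitz functions on space-time ask for a
Haar measure. -/
instance isAddHaarMeasure_volume_prod {d : ℕ} :
    (volume : Measure (ℝ × Cfg d)).IsAddHaarMeasure :=
  inferInstanceAs ((volume : Measure ℝ).prod (volume : Measure (Cfg d))).IsAddHaarMeasure

/-- The vector field `(ρ, J)` on space-time has vanishing divergence at `p`. -/
def ContinuityEqAt {d : ℕ} (ρ : ℝ × Cfg d → ℝ) (J : ℝ × Cfg d → Cfg d) (p : ℝ × Cfg d) : Prop :=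
  fderiv ℝ ρ p (1, 0) + ∑ j, fderiv ℝ (fun q => J q j) p (0, unitVec j) = 0

lemma sum_smul_unitVec {d : ℕ} (x : Cfg d) : ∑ j, x j • unitVec j = x := by
  have := (EuclideanSpace.basisFun (Fin d) ℝ).sum_repr x
  simpa using this

/-- A divergence-free vector field is weakly divergence-free against Lipschitz functions. -/
theorem integral_lineDeriv_eq_zero_of_continuityEq {d : ℕ} {G ρ : ℝ × Cfg d → ℝ}
    {J : ℝ × Cfg d → Cfg d} {C : ℝ≥0} {O : Set (ℝ × Cfg d)}
    (hG : LipschitzWith C G) (hGO : tsupport G ⊆ O)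
    (hρ : ContDiff ℝ 1 ρ) (hρc : HasCompactSupport ρ)
    (hJ : ContDiff ℝ 1 J) (hJc : HasCompactSupport J)
    (hdiv : ∀ p ∈ O, ContinuityEqAt ρ J p) :
    ∫ p, (ρ p * lineDeriv ℝ G p (1, 0) + ∑ j, J p j * lineDeriv ℝ G p (0, unitVec j)) = 0 := by
  -- Integration by parts against the Lipschitz function `G`. Summed over all directions it leaves
  -- the divergence times `G`, and the divergence is only needed on the support of `G`.
  have part : ∀ (σ : ℝ × Cfg d → ℝ) (v : ℝ × Cfg d), ContDiff ℝ 1 σ → HasCompactSupport σ →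
      Integrable (fun p => σ p * lineDeriv ℝ G p v) ∧ Integrable (fun p => fderiv ℝ σ p v * G p) ∧
      ∫ p, σ p * lineDeriv ℝ G p v = - ∫ p, fderiv ℝ σ p v * G p := by
    intro σ v hσ hσc
    obtain ⟨D, hD⟩ := hσ.lipschitzWith_of_hasCompactSupport hσc one_ne_zero
    refine ⟨?_, ?_, ?_⟩
    · exact (hσ.continuous.integrable_of_hasCompactSupport hσc).mul_of_top_left
        (hG.memLp_lineDeriv v)
    · refine Continuous.integrable_of_hasCompactSupport
        (((hσ.continuous_fderiv one_ne_zero).clm_apply continuous_const).mul hG.continuous) ?_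
      exact (hσc.fderiv_apply ℝ v).mul_right
    · have := hG.integral_lineDeriv_mul_eq (μ := volume) hD hσc v
      simp_rw [mul_comm (σ _)]
      rw [this, ← integral_neg]
      congr 1 with p
      rw [(hσ.differentiable one_ne_zero p).lineDeriv_eq_fderiv, map_neg, neg_mul]
  have hJj : ∀ j, ContDiff ℝ 1 (fun p => J p j) := fun j => by fun_prop
  have hJjc : ∀ j, HasCompactSupport (fun p => J p j) := fun j =>
    hJc.comp_left (g := fun x : Cfg d => x j) rfl
  have h0 := part ρ (1, 0) hρ hρc
  have h1 := fun j => part _ (0, unitVec j) (hJj j) (hJjc j)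
  rw [integral_add h0.1 (integrable_finsetSum _ fun j _ => (h1 j).1),
    integral_finsetSum _ fun j _ => (h1 j).1, h0.2.2, Finset.sum_congr rfl fun j _ => (h1 j).2.2,
    Finset.sum_neg_distrib, ← neg_add, neg_eq_zero, ← integral_finsetSum _ fun j _ => (h1 j).2.1,
    ← integral_add h0.2.1 (integrable_finsetSum _ fun j _ => (h1 j).2.1)]
  refine integral_eq_zero_of_ae (Eventually.of_forall fun p => ?_)
  by_cases hp : p ∈ O
  · have := hdiv p hp
    simp only [ContinuityEqAt] at this
    simp only [Pi.zero_apply]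
    rw [← Finset.sum_mul, ← add_mul, this, zero_mul]
  · simp [image_eq_zero_of_notMem_tsupport fun h => hp (hGO h)]

/-- Along the flow of a vector field satisfying the continuity equation, integrals of transported
Lipschitz functions are conserved. -/
theorem integral_transport_eq {d : ℕ} {w : ℝ → Cfg d → Cfg d} {K M : ℝ≥0}
    {Φ : ℝ → ℝ → Cfg d → Cfg d} (hΦ : IsGlobalFlow w K M Φ) {ρ : ℝ × Cfg d → ℝ}
    {J : ℝ × Cfg d → Cfg d} {O : Set (ℝ × Cfg d)}
    (hρ : ContDiff ℝ 1 ρ) (hρc : HasCompactSupport ρ)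
    (hJ : ContDiff ℝ 1 J) (hJc : HasCompactSupport J)
    (hdiv : ∀ p ∈ O, ContinuityEqAt ρ J p) (hJw : ∀ p ∈ O, J p = ρ p • w p.1 p.2)
    {f : Cfg d → ℝ} {C : ℝ≥0} (hf : LipschitzWith C f) (hfc : HasCompactSupport f)
    {a b : ℝ} (hfO : ∀ q ∈ tsupport f, ∀ s ∈ Icc a b, (s, Φ 0 s q) ∈ O)
    {s t : ℝ} (hs : s ∈ Icc a b) (ht : t ∈ Icc a b) :
    ∫ x, ρ (s, x) * f (Φ s 0 x) = ∫ x, ρ (t, x) * f (Φ t 0 x) := by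
  have hab : a ≤ b := hs.1.trans hs.2
  have hFc : Continuous fun p : ℝ × Cfg d => f (Φ p.1 0 p.2) :=
    hf.continuous.comp (hΦ.continuous_backward 0)
  refine eq_of_integral_deriv_mul_eq_zero (f := fun s => ∫ x, ρ (s, x) * f (Φ s 0 x))
    ?_ (fun η hη hηc hηs => ?_) hs ht
  · rw [← continuousOn_univ]
    refine continuousOn_integral_of_compact_support (k := Prod.snd '' tsupport ρ)
      (hρc.isCompact.image continuous_snd)
      (f := fun s x => ρ (s, x) * f (Φ s 0 x)) (hρ.continuous.mul hFc).continuousOn ?_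
    intro s x _ hx
    rw [image_eq_zero_of_notMem_tsupport (f := ρ), zero_mul]
    exact fun h => hx ⟨_, h, rfl⟩
  set G : ℝ × Cfg d → ℝ := fun p => η p.1 * f (Φ p.1 0 p.2) with hGdef
  -- the support of `G` is contained in the trajectories through the support of `f`
  let Z : Set (ℝ × Cfg d) := (fun p : ℝ × Cfg d => (p.1, Φ 0 p.1 p.2)) '' (Icc a b ×ˢ tsupport f)
  have hZc : IsCompact Z := (isCompact_Icc.prod hfc.isCompact).image
    (continuous_fst.prodMk (hΦ.continuous_forward 0))
  have hZO : Z ⊆ O := by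
    rintro _ ⟨⟨r, q⟩, ⟨hr, hq⟩, rfl⟩
    exact hfO q hq r hr
  have hmZ : ∀ p : ℝ × Cfg d, p.1 ∈ Icc a b → f (Φ p.1 0 p.2) ≠ 0 → p ∈ Z := by
    intro p h1 h2
    refine ⟨(p.1, Φ p.1 0 p.2), ⟨h1, subset_tsupport f h2⟩, ?_⟩
    simp [hΦ.trans, hΦ.self]
  have hη0 : ∀ r ∉ Icc a b, η r = 0 ∧ deriv η r = 0 := fun r hr => by
    have : r ∉ tsupport η := fun h => hr (Ioo_subset_Icc_self (hηs h))
    exact ⟨image_eq_zero_of_notMem_tsupport this,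
      image_eq_zero_of_notMem_tsupport fun h => this (tsupport_deriv_subset h)⟩
  have hGZ : tsupport G ⊆ Z := by
    refine closure_minimal (fun p hp => ?_) hZc.isClosed
    have hp' : η p.1 * f (Φ p.1 0 p.2) ≠ 0 := hp
    exact hmZ p (by_contra fun h => hp' (by simp [(hη0 _ h).1])) (right_ne_zero_of_mul hp')
  -- `G` is Lipschitz
  obtain ⟨C', hG⟩ : ∃ C', LipschitzWith C' G := by
    obtain ⟨c, hc⟩ := hΦ.lipschitzOnWith_backward 0 (|a| + |b|)
    -- The backward flow is Lipschitz only on bounded time windows. Since `η` vanishes off `[a, b]`,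
    -- clamping the time there leaves `G` unchanged and makes the second factor globally Lipschitz.
    let π : ℝ × Cfg d → ℝ × Cfg d := fun p => (projIcc a b hab p.1, p.2)
    have hπ : LipschitzWith 1 π := by
      have h1 : LipschitzWith 1 fun p : ℝ × Cfg d => ((projIcc a b hab p.1 : Icc a b) : ℝ) := by
        have := (LipschitzWith.subtype_val (Icc a b)).comp
          ((LipschitzWith.projIcc hab).comp (LipschitzWith.prod_fst (β := Cfg d)))
        simpa [Function.comp_def] using this
      simpa using h1.prodMk (LipschitzWith.prod_snd (α := ℝ) (β := Cfg d))
    have hF : LipschitzWith (C * c) fun p => f (Φ (π p).1 0 (π p).2) := by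
      have h1 : LipschitzWith (c * 1) fun p => Φ (π p).1 0 (π p).2 := by
        rw [← lipschitzOnWith_univ] at hπ ⊢
        refine hc.comp hπ fun p _ => ⟨?_, trivial⟩
        have := (projIcc a b hab p.1).2
        have ha := neg_abs_le a
        have hb := le_abs_self b
        have ha' := abs_nonneg a
        have hb' := abs_nonneg b
        constructor <;> [linarith [this.1]; linarith [this.2]]
      simpa [Function.comp_def] using hf.comp h1
    obtain ⟨e, he⟩ := hη.lipschitzWith_of_hasCompactSupport hηc (by simp)
    obtain ⟨m, hm⟩ := hf.continuous.bounded_above_of_compact_support hfc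
    obtain ⟨n, hn⟩ := hη.continuous.bounded_above_of_compact_support hηc
    have hm0 : 0 ≤ m := (norm_nonneg _).trans (hm 0)
    have hn0 : 0 ≤ n := (norm_nonneg _).trans (hn 0)
    have hGe : ∀ p, G p = η p.1 * f (Φ (π p).1 0 (π p).2) := by
      intro p
      by_cases hp : p.1 ∈ Icc a b
      · simp [G, π, projIcc_of_mem hab hp]
      · simp [G, (hη0 _ hp).1]
    refine ⟨Real.toNNReal (n * (C * c) + m * e), LipschitzWith.of_dist_le_mul fun p q => ?_⟩
    rw [Real.coe_toNNReal _ (by positivity), hGe, hGe, dist_eq_norm]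
    set A := f (Φ (π p).1 0 (π p).2)
    set B := f (Φ (π q).1 0 (π q).2)
    have h1 : ‖A - B‖ ≤ C * c * dist p q := by
      rw [← dist_eq_norm]; exact_mod_cast hF.dist_le_mul p q
    have h2 : ‖η p.1 - η q.1‖ ≤ e * dist p q := by
      rw [← dist_eq_norm]
      exact (he.dist_le_mul _ _).trans (by gcongr; exact le_max_left _ _)
    calc ‖η p.1 * A - η q.1 * B‖ = ‖η p.1 * (A - B) + (η p.1 - η q.1) * B‖ := by ring_nf
      _ ≤ ‖η p.1‖ * ‖A - B‖ + ‖η p.1 - η q.1‖ * ‖B‖ := by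
          refine (norm_add_le _ _).trans ?_
          rw [norm_mul, norm_mul]
      _ ≤ n * (C * c * dist p q) + e * dist p q * m := by
          gcongr
          · exact hn _
          · exact hm _
      _ = _ := by ring
  have hmain := integral_lineDeriv_eq_zero_of_continuityEq hG (hGZ.trans hZO) hρ hρc hJ hJc hdiv
  -- On `Z` the current is `ρ w`, so the left side is `ρ` times the derivative of `G` along the
  -- trajectory. The transported `f` is constant there, and only `η` gets differentiated. Off `Z`
  -- both sides vanish.
  have hae : ∀ᵐ p : ℝ × Cfg d, ρ p * lineDeriv ℝ G p (1, 0) +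
      ∑ j, J p j * lineDeriv ℝ G p (0, unitVec j) = ρ p * (deriv η p.1 * f (Φ p.1 0 p.2)) := by
    filter_upwards [hG.ae_differentiableAt] with p hp
    simp only [hp.lineDeriv_eq_fderiv]
    by_cases hpZ : p ∈ Z
    · have h1 : ρ p * fderiv ℝ G p (1, 0) + ∑ j, J p j * fderiv ℝ G p (0, unitVec j) =
          ρ p * fderiv ℝ G p (1, w p.1 p.2) := by
        have e1 : ((1 : ℝ), w p.1 p.2) = (1, 0) + ∑ j, w p.1 p.2 j • ((0 : ℝ), unitVec j) := by
          ext1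
          · simp [Prod.fst_sum]
          · simp only [Prod.snd_add, Prod.snd_sum, Prod.smul_snd, zero_add]
            exact (sum_smul_unitVec _).symm
        rw [e1, map_add, map_sum, mul_add, Finset.mul_sum, hJw p (hZO hpZ)]
        congr 1
        refine Finset.sum_congr rfl fun j _ => ?_
        rw [map_smul, PiLp.smul_apply, smul_eq_mul, smul_eq_mul, mul_assoc]
      rw [h1]
      congr 1
      have h2 : HasDerivAt (fun r : ℝ => (r, Φ p.1 r p.2)) (1, w p.1 p.2) p.1 := by
        have := (hasDerivAt_id p.1).prodMk (hΦ.hasDerivAt p.1 p.2 p.1)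
        rwa [hΦ.self] at this
      have h3 : HasDerivAt (fun r : ℝ => G (r, Φ p.1 r p.2)) (fderiv ℝ G p (1, w p.1 p.2)) p.1 := by
        refine HasFDerivAt.comp_hasDerivAt_of_eq _ hp.hasFDerivAt h2 ?_
        rw [hΦ.self]
      have h4 : HasDerivAt (fun r : ℝ => η r * f (Φ p.1 0 p.2)) (deriv η p.1 * f (Φ p.1 0 p.2))
          p.1 := ((hη.differentiable (by simp)) p.1).hasDerivAt.mul_const _
      refine h3.unique (h4.congr_of_eventuallyEq (Eventually.of_forall fun r => ?_))
      simp [G, hΦ.trans]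
    · have h1 : fderiv ℝ G p = 0 :=
        image_eq_zero_of_notMem_tsupport (f := fderiv ℝ G) fun h =>
          hpZ (hGZ (tsupport_fderiv_subset ℝ h))
      have h2 : deriv η p.1 * f (Φ p.1 0 p.2) = 0 := by
        by_contra hne
        refine hpZ (hmZ p (by_contra fun h => hne (by simp [(hη0 _ h).2]))
          (right_ne_zero_of_mul hne))
      simp [h1, h2]
  rw [integral_congr_ae hae, Measure.volume_eq_prod, integral_prod] at hmain
  · refine Eq.trans ?_ hmain
    congr 1 with r
    rw [← integral_const_mul]
    congr 1 with x
    ring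
  · rw [← Measure.volume_eq_prod]
    refine Continuous.integrable_of_hasCompactSupport ?_ hρc.mul_right
    have := (hη.continuous_deriv (by simp)).comp (continuous_fst (X := ℝ) (Y := Cfg d))
    exact hρ.continuous.mul (this.mul hFc)

/-- The flow transports the density `ρ(0, ·)` to at most the density `ρ(t, ·)`. -/
theorem map_restrict_withDensity_le {d : ℕ} {w : ℝ → Cfg d → Cfg d} {K M : ℝ≥0}
    {Φ : ℝ → ℝ → Cfg d → Cfg d} (hΦ : IsGlobalFlow w K M Φ) {ρ : ℝ × Cfg d → ℝ}
    {J : ℝ × Cfg d → Cfg d} {O : Set (ℝ × Cfg d)}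
    (hρ : ContDiff ℝ 1 ρ) (hρc : HasCompactSupport ρ) (hρ0 : ∀ p, 0 ≤ ρ p)
    (hJ : ContDiff ℝ 1 J) (hJc : HasCompactSupport J)
    (hdiv : ∀ p ∈ O, ContinuityEqAt ρ J p) (hJw : ∀ p ∈ O, J p = ρ p • w p.1 p.2)
    {t : ℝ} {U : Set (Cfg d)} (hU : IsOpen U) (hUO : ∀ q ∈ U, ∀ s ∈ uIcc 0 t, (s, Φ 0 s q) ∈ O) :
    (((volume.withDensity fun q => ENNReal.ofReal (ρ (0, q))).restrict U).map (Φ 0 t)) ≤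
      volume.withDensity fun q => ENNReal.ofReal (ρ (t, q)) := by
  have hcont : ∀ s, Continuous fun q => ρ (s, q) := fun s => hρ.continuous.comp (by fun_prop)
  have hcs : ∀ s, HasCompactSupport fun q => ρ (s, q) := fun s => by
    refine HasCompactSupport.intro (hρc.isCompact.image continuous_snd) fun x hx => ?_
    exact image_eq_zero_of_notMem_tsupport fun h => hx ⟨_, h, rfl⟩
  have hint : ∀ s, Integrable fun q => ρ (s, q) :=
    fun s => (hcont s).integrable_of_hasCompactSupport (hcs s)
  set ν : ℝ → Measure (Cfg d) := fun s => volume.withDensity fun q => ENNReal.ofReal (ρ (s, q))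
    with hν
  have hfin : ∀ s, IsFiniteMeasure (ν s) := fun s =>
    isFiniteMeasure_withDensity_ofReal (hint s).2
  have hΦc : ∀ s r, Continuous (Φ s r) := fun s r => by
    refine LipschitzWith.continuous (K := Real.toNNReal (Real.exp (K * |r - s|)))
      (LipschitzWith.of_dist_le_mul fun x y => ?_)
    rw [Real.coe_toNNReal _ (by positivity)]
    exact hΦ.dist_space s r x y
  have hνint : ∀ s (g : Cfg d → ℝ), ∫ q, g q ∂(ν s) = ∫ q, ρ (s, q) * g q := by
    intro s g
    rw [hν, integral_withDensity_eq_integral_toReal_smul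
      ((hcont s).measurable.ennreal_ofReal) (Eventually.of_forall fun _ => ENNReal.ofReal_lt_top)]
    simp [ENNReal.toReal_ofReal (hρ0 _)]
  -- the inequality on compact sets
  have hcpt : ∀ Z ⊆ U, IsCompact Z → ν 0 Z ≤ (ν t).map (Φ t 0) Z := by
    intro Z hZU hZ
    obtain ⟨δ, hδ, hδU⟩ := hZ.exists_cthickening_subset_open hU hZU
    have hlim := (tendsto_measure_cthickening_of_isCompact (μ := (ν t).map (Φ t 0)) hZ).mono_left
      (nhdsWithin_le_nhds (s := Ioi 0))
    refine ge_of_tendsto hlim ?_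
    filter_upwards [Ioo_mem_nhdsGT hδ] with r hr
    -- A Lipschitz function between the indicators of `Z` and of its closed `r`-thickening,
    -- supported inside `U`; the limit `r → 0` then gives the bound on `Z`.
    set f : Cfg d → ℝ := fun x => (thickenedIndicator hr.1 Z x : ℝ) with hf
    have hfL : LipschitzWith r.toNNReal⁻¹ f := lipschitzWith_thickenedIndicator hr.1 Z
    have hf0 : ∀ x, 0 ≤ f x := fun x => NNReal.coe_nonneg _
    have hf1 : ∀ x, f x ≤ 1 := fun x => by
      exact_mod_cast thickenedIndicator_le_one hr.1 Z x
    have hfz : ∀ x ∉ Metric.cthickening r Z, f x = 0 := fun x hx => by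
      have := thickenedIndicator_zero hr.1 Z
        (fun h => hx (Metric.thickening_subset_cthickening r Z h))
      change ((thickenedIndicator hr.1 Z x : ℝ≥0) : ℝ) = 0
      rw [this, NNReal.coe_zero]
    have hfs : tsupport f ⊆ Metric.cthickening r Z :=
      closure_minimal (fun x hx => by_contra fun h => hx (hfz x h)) Metric.isClosed_cthickening
    have hfc : HasCompactSupport f := HasCompactSupport.intro hZ.cthickening hfz
    have key := integral_transport_eq hΦ hρ hρc hJ hJc hdiv hJw hfL hfc (a := min 0 t)
      (b := max 0 t) (fun q hq => hUO q (hδU ((hfs.trans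
        (Metric.cthickening_mono hr.2.le Z)) hq))) left_mem_uIcc right_mem_uIcc
    rw [← hνint 0 (fun x => f (Φ 0 0 x)), ← hνint t (fun x => f (Φ t 0 x))] at key
    simp only [hΦ.self] at key
    have hm : MeasurableSet (Metric.cthickening r Z) := Metric.isClosed_cthickening.measurableSet
    have hi : ∀ (μ : Measure (Cfg d)) [IsFiniteMeasure μ], Integrable f μ := fun μ _ =>
      Integrable.of_bound hfL.continuous.aestronglyMeasurable 1
        (Eventually.of_forall fun x => by
          rw [Real.norm_of_nonneg (hf0 x)]; exact hf1 x)
    have h1 : (ν 0).real Z ≤ ∫ q, f q ∂(ν 0) := by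
      rw [← integral_indicator_one hZ.measurableSet]
      refine integral_mono ((integrable_const 1).indicator hZ.measurableSet) (hi _) fun x => ?_
      by_cases hx : x ∈ Z
      · have h1x : f x = 1 := by
          change ((thickenedIndicator hr.1 Z x : ℝ≥0) : ℝ) = 1
          rw [thickenedIndicator_one hr.1 Z hx, NNReal.coe_one]
        simp [hx, h1x]
      · simp [hx, hf0]
    have h2 : ∫ q, f (Φ t 0 q) ∂(ν t) ≤ ((ν t).map (Φ t 0)).real (Metric.cthickening r Z) := by
      rw [← integral_map (hΦc t 0).aemeasurable hfL.continuous.aestronglyMeasurable,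
        ← integral_indicator_one hm]
      refine integral_mono (hi _) ((integrable_const 1).indicator hm) fun x => ?_
      by_cases hx : x ∈ Metric.cthickening r Z
      · simp [hx, hf1]
      · simp [hx, hfz]
    rw [← ENNReal.toReal_le_toReal (measure_ne_top _ _) (measure_ne_top _ _)]
    exact h1.trans (key.le.trans h2)
  have hle : (ν 0).restrict U ≤ (ν t).map (Φ t 0) := by
    -- Inner regularity passes from compact to measurable subsets of `U`.
    refine Measure.le_iff.2 fun S hS => ?_
    rw [Measure.restrict_apply hS,
      (hS.inter hU.measurableSet).measure_eq_iSup_isCompact]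
    refine iSup_le fun Z => iSup_le fun hZ => iSup_le fun hZc => ?_
    exact (hcpt Z (hZ.trans inter_subset_right) hZc).trans
      (measure_mono (hZ.trans inter_subset_left))
  refine (Measure.map_mono hle (hΦc 0 t).measurable).trans ?_
  rw [Measure.map_map (hΦc 0 t).measurable (hΦc t 0).measurable]
  have : Φ 0 t ∘ Φ t 0 = id := by
    ext1 x
    simp [hΦ.trans, hΦ.self]
  rw [this, Measure.map_id]

lemma ContinuityEqAt.congr {d : ℕ} {ρ ρ' : ℝ × Cfg d → ℝ} {J J' : ℝ × Cfg d → Cfg d}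
    {p : ℝ × Cfg d} (h : ContinuityEqAt ρ J p) (hρ : ρ' =ᶠ[𝓝 p] ρ) (hJ : J' =ᶠ[𝓝 p] J) :
    ContinuityEqAt ρ' J' p := by
  unfold ContinuityEqAt at h ⊢
  rw [hρ.fderiv_eq]
  refine Eq.trans ?_ h
  congr 1
  refine Finset.sum_congr rfl fun j _ => ?_
  have : (fun q => J' q j) =ᶠ[𝓝 p] fun q => J q j := hJ.mono fun q hq => by
    simp only [hq]
  rw [this.fderiv_eq]

/-! ### Exit from compact sets: quantitative existence of solutions -/

/-- A smooth cutoff function that is `1` on a compact set and supported in a given open set. -/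
lemma exists_contDiff_cutoff {P : Type*} [NormedAddCommGroup P] [NormedSpace ℝ P]
    [FiniteDimensional ℝ P] {Z D : Set P} (hZ : IsCompact Z) (hD : IsOpen D) (hZD : Z ⊆ D) :
    ∃ κ : P → ℝ, ContDiff ℝ ∞ κ ∧ HasCompactSupport κ ∧ tsupport κ ⊆ D ∧ EqOn κ 1 Z ∧
      ∀ p, 0 ≤ κ p := by
  obtain ⟨Z', hZ', h1, h2⟩ := exists_compact_between hZ hD hZD
  obtain ⟨κ, h0, h1', h01⟩ := exists_contMDiffMap_zero_one_of_isClosed (n := ⊤)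
    (modelWithCornersSelf ℝ P) (s := (interior Z')ᶜ) (t := Z) isOpen_interior.isClosed_compl
    hZ.isClosed (disjoint_left.2 fun p hp hp' => hp (h1 hp'))
  have hs : tsupport κ ⊆ Z' := closure_minimal
    (fun p hp => by_contra fun h => hp (h0 fun h' => h (interior_subset h'))) hZ'.isClosed
  exact ⟨κ, κ.contMDiff.contDiff, hZ'.of_isClosed_subset (isClosed_tsupport _) hs, hs.trans h2,
    h1', fun p => (h01 p).1⟩

lemma contDiff_smul_of_tsupport_subset {P F : Type*} [NormedAddCommGroup P] [NormedSpace ℝ P]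
    [NormedAddCommGroup F] [NormedSpace ℝ F] {n : WithTop ℕ∞} {κ : P → ℝ} {f : P → F} {D : Set P}
    (hD : IsOpen D) (hκ : ContDiff ℝ n κ) (hs : tsupport κ ⊆ D) (hf : ContDiffOn ℝ n f D) :
    ContDiff ℝ n fun p => κ p • f p := by
  refine contDiff_iff_contDiffAt.2 fun p => ?_
  by_cases hp : p ∈ tsupport κ
  · exact hκ.contDiffAt.smul (hf.contDiffAt (hD.mem_nhds (hs hp)))
  · have : (fun p => κ p • f p) =ᶠ[𝓝 p] fun _ => 0 := by
      filter_upwards [(isClosed_tsupport κ).isOpen_compl.mem_nhds hp] with q hq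
      rw [image_eq_zero_of_notMem_tsupport hq, zero_smul]
    exact contDiffAt_const.congr_of_eventuallyEq this

/-- The curve `γ` stays in `D` and solves `γ' = v(t, γ)` on the time set `I`. -/
def IsSolutionOn {d : ℕ} (D : Set (ℝ × Cfg d)) (v : ℝ × Cfg d → Cfg d) (I : Set ℝ)
    (γ : ℝ → Cfg d) : Prop :=
  ∀ s ∈ I, (s, γ s) ∈ D ∧ HasDerivAt γ (v (s, γ s)) s

/-- The curve `γ` solves `γ' = v(t, γ)` in `D` on an open interval containing `0` and `t`,
and runs from `q` to `x`. -/
def SolutionJoins {d : ℕ} (D : Set (ℝ × Cfg d)) (v : ℝ × Cfg d → Cfg d) (t : ℝ) (q x : Cfg d) :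
    Prop :=
  ∃ (I : Set ℝ) (γ : ℝ → Cfg d), IsOpen I ∧ I.OrdConnected ∧ 0 ∈ I ∧ t ∈ I ∧
    IsSolutionOn D v I γ ∧ γ 0 = q ∧ γ t = x

/-- The measure with density `ρ(s, ·)` on the time slice of `D`. -/
noncomputable def sliceMeasure {d : ℕ} (D : Set (ℝ × Cfg d)) (ρ : ℝ × Cfg d → ℝ) (s : ℝ) :
    Measure (Cfg d) :=
  volume.withDensity fun q => D.indicator (fun p => ENNReal.ofReal (ρ p)) (s, q)

lemma measurable_indicator_of_continuousOn {X Y : Type*} [TopologicalSpace X] [MeasurableSpace X]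
    [OpensMeasurableSpace X] [TopologicalSpace Y] [MeasurableSpace Y] [BorelSpace Y] [Zero Y]
    {D : Set X} (hD : IsOpen D) {f : X → Y} (hf : ContinuousOn f D) :
    Measurable (D.indicator f) := by
  classical
  rw [← piecewise_eq_indicator]
  exact hf.measurable_piecewise continuousOn_const hD.measurableSet

/-- The set of `(s, q)` such that the curve `Φ 0 · q` stays in `O` from time `0` to time `s`. -/
def staysIn {d : ℕ} (Φ : ℝ → ℝ → Cfg d → Cfg d) (O : Set (ℝ × Cfg d)) : Set (ℝ × Cfg d) :=
  {p | ∀ θ ∈ Icc (0 : ℝ) 1, (θ * p.1, Φ 0 (θ * p.1) p.2) ∈ O}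

/-- A tube-lemma argument. Rescaling time by `θ ∈ [0, 1]` makes the compact parameter set
independent of the end time and treats both signs of time at once. -/
lemma isOpen_staysIn {d : ℕ} {Φ : ℝ → ℝ → Cfg d → Cfg d} {O : Set (ℝ × Cfg d)} (hO : IsOpen O)
    (hΦ : Continuous fun p : ℝ × Cfg d => Φ 0 p.1 p.2) : IsOpen (staysIn Φ O) := by
  refine isOpen_iff_mem_nhds.2 fun p hp => ?_
  refine isCompact_Icc.eventually_forall_of_forall_eventually
    (P := fun (p : ℝ × Cfg d) (θ : ℝ) => (θ * p.1, Φ 0 (θ * p.1) p.2) ∈ O) fun θ hθ => ?_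
  have hc : Continuous fun z : (ℝ × Cfg d) × ℝ => (z.2 * z.1.1, Φ 0 (z.2 * z.1.1) z.1.2) := by
    have h1 : Continuous fun z : (ℝ × Cfg d) × ℝ => z.2 * z.1.1 := by fun_prop
    exact h1.prodMk (hΦ.comp (h1.prodMk (by fun_prop)))
  exact hc.continuousAt.eventually (hO.mem_nhds (hp θ hθ))

lemma mem_of_mem_staysIn {d : ℕ} {Φ : ℝ → ℝ → Cfg d → Cfg d} {O : Set (ℝ × Cfg d)} {t : ℝ}
    {q : Cfg d} (h : (t, q) ∈ staysIn Φ O) {s : ℝ} (hs : s ∈ uIcc 0 t) : (s, Φ 0 s q) ∈ O := by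
  rw [← segment_eq_uIcc, segment_eq_image] at hs
  obtain ⟨θ, hθ, rfl⟩ := hs
  simpa using h θ hθ

/-- The first exit from `O` of a curve that does not stay in `O`. -/
lemma exists_exit_of_notMem_staysIn {d : ℕ} {Φ : ℝ → ℝ → Cfg d → Cfg d} {O : Set (ℝ × Cfg d)}
    (hO : IsOpen O) (hΦ : Continuous fun p : ℝ × Cfg d => Φ 0 p.1 p.2) {t : ℝ} {q : Cfg d}
    (h0 : (0, Φ 0 0 q) ∈ O) (h : (t, q) ∉ staysIn Φ O) :
    ∃ s₀ ∈ uIcc 0 t, (s₀, Φ 0 s₀ q) ∉ O ∧ ∀ s ∈ uIcc 0 s₀, s ≠ s₀ → (s, q) ∈ staysIn Φ O := by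
  have hc : Continuous fun θ : ℝ => (θ * t, Φ 0 (θ * t) q) := by
    have h1 : Continuous fun θ : ℝ => θ * t := by fun_prop
    exact h1.prodMk (hΦ.comp (h1.prodMk continuous_const))
  set S : Set ℝ := Icc 0 1 ∩ (fun θ : ℝ => (θ * t, Φ 0 (θ * t) q)) ⁻¹' Oᶜ with hS
  have hSc : IsCompact S := isCompact_Icc.inter_right (hO.isClosed_compl.preimage hc)
  have hSn : S.Nonempty := by
    simp only [staysIn, mem_ofPred_eq, not_forall] at h
    obtain ⟨θ, hθ, hθO⟩ := h
    exact ⟨θ, hθ, hθO⟩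
  -- `θ₀` is the first exit in rescaled time; it is positive because the curve starts in the open
  -- set.
  obtain ⟨θ₀, hθ₀, hmin⟩ := hSc.exists_isLeast hSn
  have hlt : ∀ θ, 0 ≤ θ → θ < θ₀ → (θ * t, Φ 0 (θ * t) q) ∈ O := fun θ h1 h2 => by
    by_contra hθ
    exact absurd (hmin ⟨⟨h1, h2.le.trans hθ₀.1.2⟩, hθ⟩) (not_le.2 h2)
  have hpos : 0 < θ₀ := lt_of_le_of_ne hθ₀.1.1 fun h => hθ₀.2 (by simpa [← h] using h0)
  refine ⟨θ₀ * t, ?_, hθ₀.2, fun s hs hne => ?_⟩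
  · rw [← segment_eq_uIcc, segment_eq_image]
    exact ⟨θ₀, hθ₀.1, by simp⟩
  · rw [← segment_eq_uIcc, segment_eq_image] at hs
    obtain ⟨θ, hθ, rfl⟩ := hs
    simp only [smul_eq_mul] at hne ⊢
    have hθ1 : θ < 1 := lt_of_le_of_ne hθ.2 fun h => hne (by simp [h])
    intro θ' hθ'
    have := hlt (θ' * θ * θ₀) (mul_nonneg (mul_nonneg hθ'.1 hθ.1) hpos.le) (by
      have : θ' * θ < 1 := (mul_le_of_le_one_left hθ.1 hθ'.2).trans_lt hθ1
      nlinarith)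
    simpa [mul_assoc] using this

/-- Quantitative existence: the set of initial points whose solution leaves a large compact set
before time `t` is small. -/
theorem exists_isOpen_solutionJoins {d : ℕ} {D : Set (ℝ × Cfg d)} (hD : IsOpen D)
    {v : ℝ × Cfg d → Cfg d} (hv : ContDiffOn ℝ 1 v D) {ρ : ℝ × Cfg d → ℝ}
    (hρ : ContDiffOn ℝ 1 ρ D) (hρ0 : ∀ p ∈ D, 0 ≤ ρ p)
    (hdiv : ∀ p ∈ D, ContinuityEqAt ρ (fun p => ρ p • v p) p)
    {ι : Type*} [Fintype ι] {h : ι → ℝ × Cfg d → ℝ} (hh : ∀ i, ContDiffOn ℝ 1 (h i) D)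
    {t n : ℝ} (hn : 0 < n) {Z : Set (ℝ × Cfg d)} (hZ : IsCompact Z) (hZD : Z ⊆ D)
    (hZh : ∀ p ∈ D, |p.1| < |t| + 1 → (∀ i, |h i p| < 2 * n) → p ∈ Z) :
    ∃ (U : Set (Cfg d)) (φ : Cfg d → Cfg d), IsOpen U ∧ Continuous φ ∧
      (∀ q ∈ U, SolutionJoins D v t q (φ q)) ∧
      ((sliceMeasure D ρ 0).restrict U).map φ ≤ sliceMeasure D ρ t ∧
      sliceMeasure D ρ 0 Uᶜ ≤ sliceMeasure D ρ 0 {q | (0, q) ∈ D ∧ ∀ i, |h i (0, q)| < n}ᶜ +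
        ∑ i, (∫⁻ s in uIcc 0 t, ∫⁻ x, D.indicator
          (fun p => ENNReal.ofReal (ρ p) * ‖fderiv ℝ (h i) p (1, v p)‖ₑ) (s, x)) /
            ENNReal.ofReal n := by
  classical
  -- Multiplying by `κ` turns `ρ`, `ρ v` and `v` into compactly supported C¹ objects on all of
  -- space-time that are unchanged on `Z`. The velocity then has a global flow, which follows true
  -- solutions while it stays in `Z`.
  obtain ⟨κ, hκ, hκc, hκD, hκ1, hκ0⟩ := exists_contDiff_cutoff hZ hD hZD
  have hκ' : ContDiff ℝ 1 κ := hκ.of_le (by exact_mod_cast le_top)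
  set σ : ℝ × Cfg d → ℝ := fun p => κ p • ρ p with hσdef
  set J : ℝ × Cfg d → Cfg d := fun p => κ p • (ρ p • v p) with hJdef
  set W : ℝ × Cfg d → Cfg d := fun p => κ p • v p with hWdef
  have hσ : ContDiff ℝ 1 σ := contDiff_smul_of_tsupport_subset hD hκ' hκD hρ
  have hJ : ContDiff ℝ 1 J := contDiff_smul_of_tsupport_subset hD hκ' hκD (hρ.smul hv)
  have hW : ContDiff ℝ 1 W := contDiff_smul_of_tsupport_subset hD hκ' hκD hv
  have hσc : HasCompactSupport σ := hκc.smul_right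
  have hJc : HasCompactSupport J := hκc.smul_right
  have hWc : HasCompactSupport W := hκc.smul_right
  obtain ⟨K, hK⟩ := hW.lipschitzWith_of_hasCompactSupport hWc one_ne_zero
  obtain ⟨M, hM⟩ := hW.continuous.bounded_above_of_compact_support hWc
  obtain ⟨Φ, hΦ⟩ := exists_isGlobalFlow (w := fun s x => W (s, x)) (K := K) (M := M.toNNReal)
    (fun s => by simpa [Function.comp_def] using hK.comp (LipschitzWith.prodMk_left s))
    (fun x => hW.continuous.comp (by fun_prop))
    (fun s x => (hM _).trans (Real.le_coe_toNNReal M))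
  have hΦc : Continuous fun p : ℝ × Cfg d => Φ 0 p.1 p.2 := hΦ.continuous_forward 0
  -- The bound `2 * n` leaves a gap of `n` to the initial values admitted below. The extra unit of
  -- time ensures that no curve leaves `O` through the time bound between `0` and `t`.
  set O : Set (ℝ × Cfg d) := {p | p ∈ D ∧ (|p.1| < |t| + 1 ∧ ∀ i, |h i p| < 2 * n)} with hOdef
  have hO : IsOpen O := by
    have : O = D ∩ (({p | |p.1| < |t| + 1}) ∩ ⋂ i, D ∩ h i ⁻¹' {y | |y| < 2 * n}) := by
      ext p
      simp only [hOdef, mem_ofPred_eq, mem_inter_iff, mem_iInter, mem_preimage]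
      exact ⟨fun hp => ⟨hp.1, hp.2.1, fun i => ⟨hp.1, hp.2.2 i⟩⟩,
        fun hp => ⟨hp.1, hp.2.1, fun i => (hp.2.2 i).2⟩⟩
    rw [this]
    refine hD.inter ((isOpen_lt (by fun_prop) continuous_const).inter
      (isOpen_iInter_of_finite fun i => ?_))
    exact (hh i).continuousOn.isOpen_inter_preimage hD (isOpen_lt continuous_abs continuous_const)
  have hOD : O ⊆ D := fun p hp => hp.1
  have hOZ : O ⊆ Z := fun p hp => hZh p hp.1 hp.2.1 hp.2.2
  have hκO : ∀ p ∈ O, κ =ᶠ[𝓝 p] 1 := fun p hp => by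
    filter_upwards [hO.mem_nhds hp] with q hq using hκ1 (hOZ hq)
  have hdivO : ∀ p ∈ O, ContinuityEqAt σ J p := fun p hp =>
    (hdiv p (hOD hp)).congr ((hκO p hp).mono fun q hq => by simp [σ, hq])
      ((hκO p hp).mono fun q hq => by simp [J, hq])
  have hJW : ∀ p ∈ O, J p = σ p • W (p.1, p.2) := fun p hp => by
    simp [J, σ, W, hκ1 (hOZ hp)]
  set r : ℝ × Cfg d → ℝ≥0∞ := D.indicator (fun p => ENNReal.ofReal (ρ p)) with hrdef
  have hr : Measurable r := measurable_indicator_of_continuousOn hD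
    (ENNReal.continuous_ofReal.comp_continuousOn hρ.continuousOn)
  set μ : ℝ → Measure (Cfg d) := fun s => sliceMeasure D ρ s with hμdef
  set ν : ℝ → Measure (Cfg d) :=
    fun s => volume.withDensity fun q => ENNReal.ofReal (σ (s, q)) with hνdef
  set V : Set (ℝ × Cfg d) := staysIn Φ O with hVdef
  have hV : IsOpen V := isOpen_staysIn hO hΦc
  have hVs : ∀ s, IsOpen {q | (s, q) ∈ V} := fun s => hV.preimage (by fun_prop)
  have hΦm : ∀ s, Continuous (Φ 0 s) := fun s => hΦc.comp (f := fun q => (s, q)) (by fun_prop)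
  have hOs : ∀ s, MeasurableSet {q | (s, q) ∈ O} := fun s =>
    (hO.preimage (f := fun q => (s, q)) (by fun_prop)).measurableSet
  have hμν : ∀ s (S : Set (Cfg d)), MeasurableSet S → S ⊆ {q | (s, q) ∈ O} →
      (μ s).restrict S = (ν s).restrict S := by
    intro s S hS hSO
    rw [hμdef, hνdef]
    simp only [sliceMeasure]
    rw [restrict_withDensity hS, restrict_withDensity hS]
    refine withDensity_congr_ae ?_
    filter_upwards [ae_restrict_mem hS] with q hq
    have hqO := hSO hq
    simp [indicator_of_mem (hOD hqO), σ, hκ1 (hOZ hqO)]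
  -- transport of the slice measures
  have htrans : ∀ s, ((μ 0).restrict {q | (s, q) ∈ V}).map (Φ 0 s) ≤ μ s := by
    intro s
    have h1 : ∀ q ∈ {q | (s, q) ∈ V}, (0, q) ∈ O := fun q hq => by
      simpa [hΦ.self] using mem_of_mem_staysIn hq left_mem_uIcc
    rw [hμν 0 _ (hVs s).measurableSet h1]
    have h2 := map_restrict_withDensity_le hΦ hσ hσc
      (fun p => ?_) hJ hJc hdivO hJW (t := s) (hVs s) (fun q hq r hr => mem_of_mem_staysIn hq hr)
    · refine Measure.le_iff.2 fun S hS => ?_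
      have h3 : (((ν 0).restrict {q | (s, q) ∈ V}).map (Φ 0 s)) S =
          (((ν 0).restrict {q | (s, q) ∈ V}).map (Φ 0 s)) (S ∩ {q | (s, q) ∈ O}) := by
        rw [Measure.map_apply (hΦm s).measurable hS,
          Measure.map_apply (hΦm s).measurable (hS.inter (hOs s)),
          Measure.restrict_apply ((hΦm s).measurable hS),
          Measure.restrict_apply ((hΦm s).measurable (hS.inter (hOs s)))]
        congr 1
        ext q
        simp only [mem_inter_iff, mem_preimage, mem_ofPred_eq]
        exact ⟨fun hq => ⟨⟨hq.1, mem_of_mem_staysIn hq.2 right_mem_uIcc⟩, hq.2⟩,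
          fun hq => ⟨hq.1.1, hq.2⟩⟩
      rw [h3]
      refine (h2 _).trans ?_
      have h4 := hμν s _ (hOs s) subset_rfl
      have h5 : ν s (S ∩ {q | (s, q) ∈ O}) = μ s (S ∩ {q | (s, q) ∈ O}) := by
        rw [← Measure.restrict_apply hS, ← Measure.restrict_apply hS, h4]
      exact h5.le.trans (measure_mono inter_subset_left)
    · by_cases hp : p ∈ D
      · exact mul_nonneg (hκ0 p) (hρ0 p hp)
      · simp [σ, image_eq_zero_of_notMem_tsupport fun h => hp (hκD h)]
  refine ⟨{q | (t, q) ∈ V}, Φ 0 t, hVs t, hΦm t, fun q hq => ?_, htrans t, ?_⟩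
  · -- the curve is a solution on an open interval
    have hc : Continuous fun s => (s, Φ 0 s q) :=
      continuous_id.prodMk (hΦc.comp (f := fun s => (s, q)) (by fun_prop))
    obtain ⟨I, hI, hIc, hIs, hIsub⟩ : ∃ I : Set ℝ, IsOpen I ∧ I.OrdConnected ∧ uIcc 0 t ⊆ I ∧
        ∀ s ∈ I, (s, Φ 0 s q) ∈ O := by
      obtain ⟨δ, hδ, hδO⟩ := (isCompact_uIcc (a := (0 : ℝ)) (b := t)).exists_thickening_subset_open
        (hO.preimage hc) fun s hs => mem_of_mem_staysIn hq hs
      refine ⟨Metric.thickening δ (uIcc 0 t), Metric.isOpen_thickening, ?_,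
        Metric.self_subset_thickening hδ _, hδO⟩
      exact ((convex_uIcc 0 t).thickening δ).ordConnected
    refine ⟨I, fun s => Φ 0 s q, hI, hIc, hIs left_mem_uIcc, hIs right_mem_uIcc,
      fun s hs => ⟨hOD (hIsub s hs), ?_⟩, hΦ.self 0 q, rfl⟩
    have := hΦ.hasDerivAt 0 q s
    simpa [W, hκ1 (hOZ (hIsub s hs))] using this
  -- Chebyshev's inequality for the variation of the functions `h i` along the flow
  set g : ι → ℝ × Cfg d → ℝ≥0∞ :=
    fun i => D.indicator (fun p => ‖fderiv ℝ (h i) p (1, v p)‖ₑ) with hgdef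
  have hgc : ∀ i, ContinuousOn (fun p => fderiv ℝ (h i) p (1, v p)) D := fun i =>
    ((hh i).continuousOn_fderiv_of_isOpen hD le_rfl).clm_apply
      (continuousOn_const.prodMk hv.continuousOn)
  have hg : ∀ i, Measurable (g i) := fun i =>
    measurable_indicator_of_continuousOn hD (continuous_enorm.comp_continuousOn (hgc i))
  have hgs : ∀ i s, Measurable fun x => g i (s, x) := fun i s =>
    (hg i).comp (by fun_prop : Measurable fun x : Cfg d => (s, x))
  set F : ι → ℝ × Cfg d → ℝ≥0∞ := fun i => V.indicator fun p => g i (p.1, Φ 0 p.1 p.2) with hFdef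
  have hF : ∀ i, Measurable (F i) := fun i =>
    ((hg i).comp (measurable_fst.prodMk hΦc.measurable)).indicator hV.measurableSet
  set A : ι → Cfg d → ℝ≥0∞ := fun i q => ∫⁻ s in uIcc 0 t, F i (s, q) with hAdef
  have hA : ∀ i, Measurable (A i) := fun i =>
    Measurable.lintegral_prod_left' (μ := volume.restrict (uIcc 0 t)) (hF i)
  have hrμ : ∀ s, Measurable fun q => r (s, q) := fun s => hr.comp (by fun_prop)
  -- After exchanging the integrals, `htrans` bounds the transported surviving mass at each time `s`
  -- by `μ s`, and the flow disappears from the estimate.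
  have hAint : ∀ i, ∫⁻ q, A i q ∂(μ 0) ≤ ∫⁻ s in uIcc 0 t, ∫⁻ x, D.indicator
      (fun p => ENNReal.ofReal (ρ p) * ‖fderiv ℝ (h i) p (1, v p)‖ₑ) (s, x) := by
    intro i
    have : SFinite (μ 0) := by
      simp only [hμdef, sliceMeasure]; infer_instance
    rw [hAdef, lintegral_lintegral_swap
      (f := fun q s => F i (s, q)) ((hF i).comp measurable_swap).aemeasurable]
    refine lintegral_mono fun s => ?_
    have h1 : ∫⁻ q, F i (s, q) ∂(μ 0) =
        ∫⁻ x, g i (s, x) ∂(((μ 0).restrict {q | (s, q) ∈ V}).map (Φ 0 s)) := by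
      rw [lintegral_map (hgs i s) (hΦm s).measurable,
        ← lintegral_indicator (hVs s).measurableSet]
      rfl
    have h2 : ∫⁻ x, g i (s, x) ∂(μ s) = ∫⁻ x, r (s, x) * g i (s, x) := by
      simp only [hμdef, sliceMeasure]
      rw [lintegral_withDensity_eq_lintegral_mul _ (hrμ s) (hgs i s)]
      rfl
    change ∫⁻ q, F i (s, q) ∂(μ 0) ≤ _
    rw [h1]
    refine (lintegral_mono' (htrans s) le_rfl).trans ?_
    rw [h2]
    refine lintegral_mono fun x => ?_
    by_cases hx : (s, x) ∈ D <;> simp [r, g, hx]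
  have hn2 : ENNReal.ofReal n ≠ 0 := by simpa using hn
  -- A curve starting with every `|h i| < n` can leave `O` only where some `|h i| ≥ 2 * n`, so that
  -- `h i` has varied by at least `n` on the way.
  have hexit : {q | (t, q) ∈ V}ᶜ ⊆ {q | (0, q) ∈ D ∧ ∀ i, |h i (0, q)| < n}ᶜ ∪
      ⋃ i, {q | ENNReal.ofReal n ≤ A i q} := by
    intro q hq
    by_contra hcon
    simp only [mem_union, mem_compl_iff, not_or, not_not, mem_iUnion, not_exists] at hcon
    obtain ⟨⟨hq0, hqh⟩, hqA⟩ := hcon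
    have hqO : (0, q) ∈ O := ⟨hq0, by simpa using by positivity, fun i => by linarith [hqh i]⟩
    obtain ⟨s₀, hs₀, hs₀O, hstay⟩ :=
      exists_exit_of_notMem_staysIn hO hΦc (by rwa [hΦ.self]) hq
    have hc : Continuous fun s => (s, Φ 0 s q) :=
      continuous_id.prodMk (hΦc.comp (f := fun s => (s, q)) (by fun_prop))
    have hne : s₀ ≠ 0 := by
      rintro rfl
      exact hs₀O (by rwa [hΦ.self])
    have hOs : ∀ s ∈ uIcc 0 s₀, s ≠ s₀ → (s, Φ 0 s q) ∈ O := fun s hs hss =>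
      mem_of_mem_staysIn (hstay s hs hss) right_mem_uIcc
    -- Before `s₀` the curve is in `O ⊆ Z`. As `Z` is closed, the exit point is still in `Z ⊆ D`,
    -- where each `h i` is differentiable.
    have hZs : ∀ s ∈ uIcc 0 s₀, (s, Φ 0 s q) ∈ Z := by
      have h1 : uIcc 0 s₀ ⊆ closure (uIcc 0 s₀ \ {s₀}) := by
        intro s hs
        by_cases hss : s = s₀
        · subst hss
          have h2 : closure (uIoo 0 s) = uIcc 0 s := closure_uIoo hne.symm
          have h3 : uIoo 0 s ⊆ uIcc 0 s \ {s} := fun x hx =>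
            ⟨uIoo_subset_uIcc_self hx, fun hxs => right_notMem_uIoo (hxs ▸ hx)⟩
          exact closure_mono h3 (h2 ▸ hs)
        · exact subset_closure ⟨hs, hss⟩
      intro s hs
      exact closure_minimal (t := (fun s => (s, Φ 0 s q)) ⁻¹' Z)
        (fun x hx => hOZ (hOs x hx.1 hx.2)) (hZ.isClosed.preimage hc) (h1 hs)
    have hs₀Z : (s₀, Φ 0 s₀ q) ∈ D := hZD (hZs s₀ right_mem_uIcc)
    obtain ⟨i, hi⟩ : ∃ i, 2 * n ≤ |h i (s₀, Φ 0 s₀ q)| := by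
      by_contra hi
      push Not at hi
      refine hs₀O ⟨hs₀Z, ?_, hi⟩
      have : |s₀| ≤ |t| := by simpa using abs_sub_left_of_mem_uIcc hs₀
      change |s₀| < |t| + 1
      linarith
    refine hqA i ?_
    have hderiv : ∀ s ∈ uIcc 0 s₀, HasDerivAt (fun s => h i (s, Φ 0 s q))
        (fderiv ℝ (h i) (s, Φ 0 s q) (1, v (s, Φ 0 s q))) s := by
      intro s hs
      have h1 : HasDerivAt (fun s => (s, Φ 0 s q)) (1, v (s, Φ 0 s q)) s := by
        have := (hasDerivAt_id s).prodMk (hΦ.hasDerivAt 0 q s)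
        simpa [W, hκ1 (hZs s hs)] using this
      exact (((hh i).contDiffAt (hD.mem_nhds (hZD (hZs s hs)))).differentiableAt
        one_ne_zero).hasFDerivAt.comp_hasDerivAt s h1
    have hcd : ContinuousOn (fun s => fderiv ℝ (h i) (s, Φ 0 s q) (1, v (s, Φ 0 s q)))
        (uIcc 0 s₀) := (hgc i).comp hc.continuousOn fun s hs => hZD (hZs s hs)
    have hftc := intervalIntegral.integral_eq_sub_of_hasDerivAt hderiv hcd.intervalIntegrable
    have h3 : n ≤ ‖∫ s in (0)..s₀, fderiv ℝ (h i) (s, Φ 0 s q) (1, v (s, Φ 0 s q))‖ := by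
      rw [hftc, hΦ.self, Real.norm_eq_abs]
      have := abs_sub_abs_le_abs_sub (h i (s₀, Φ 0 s₀ q)) (h i (0, q))
      linarith [hqh i]
    have h4 : ‖∫ s in (0)..s₀, fderiv ℝ (h i) (s, Φ 0 s q) (1, v (s, Φ 0 s q))‖ₑ ≤
        ∫⁻ s in uIoc 0 s₀, ‖fderiv ℝ (h i) (s, Φ 0 s q) (1, v (s, Φ 0 s q))‖ₑ := by
      have := intervalIntegral.norm_intervalIntegral_eq
        (fun s => fderiv ℝ (h i) (s, Φ 0 s q) (1, v (s, Φ 0 s q))) 0 s₀ volume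
      rw [← ofReal_norm, this, ofReal_norm]
      exact enorm_integral_le_lintegral_enorm _
    calc ENNReal.ofReal n ≤ ‖∫ s in (0)..s₀,
          fderiv ℝ (h i) (s, Φ 0 s q) (1, v (s, Φ 0 s q))‖ₑ := by
          rw [← ofReal_norm]; exact ENNReal.ofReal_le_ofReal h3
      _ ≤ _ := h4
      _ = ∫⁻ s in uIoc 0 s₀, F i (s, q) := by
          refine setLIntegral_congr_fun_ae measurableSet_uIoc ?_
          -- `F i` is cut off to `V`, which the curve may leave at the single time `s₀`.
          have : ∀ᵐ s : ℝ, s ≠ s₀ := by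
            simp [ae_iff]
          filter_upwards [this] with s hss hs
          have hs' := uIoc_subset_uIcc hs
          have hm := hstay s hs' hss
          simp only [F, indicator_of_mem (show (s, q) ∈ V from hm), g,
            indicator_of_mem (hZD (hZs s hs'))]
      _ ≤ A i q := lintegral_mono_set (uIoc_subset_uIcc.trans (uIcc_subset_uIcc left_mem_uIcc hs₀))
  calc μ 0 {q | (t, q) ∈ V}ᶜ
      ≤ μ 0 ({q | (0, q) ∈ D ∧ ∀ i, |h i (0, q)| < n}ᶜ ∪ ⋃ i, {q | ENNReal.ofReal n ≤ A i q}) :=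
        measure_mono hexit
    _ ≤ μ 0 {q | (0, q) ∈ D ∧ ∀ i, |h i (0, q)| < n}ᶜ +
          ∑ i, μ 0 {q | ENNReal.ofReal n ≤ A i q} :=
        (measure_union_le _ _).trans (by gcongr; exact measure_iUnion_fintype_le _ _)
    _ ≤ _ := by
        gcongr with i
        refine (meas_ge_le_lintegral_div (hA i).aemeasurable hn2 ENNReal.ofReal_ne_top).trans ?_
        gcongr
        exact hAint i

/-! ### Uniqueness and gluing of solutions -/

variable {d : ℕ} {D : Set (ℝ × Cfg d)} {v : ℝ × Cfg d → Cfg d}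

/-- Solutions through the same point at time `0` agree. -/
theorem IsSolutionOn.eqOn (hD : IsOpen D) (hv : ContDiffOn ℝ 1 v D) {I : Set ℝ} (hI : IsOpen I)
    (hIc : I.OrdConnected) (h0 : 0 ∈ I) {γ₁ γ₂ : ℝ → Cfg d} (h₁ : IsSolutionOn D v I γ₁)
    (h₂ : IsSolutionOn D v I γ₂) (h : γ₁ 0 = γ₂ 0) : EqOn γ₁ γ₂ I := by
  have hloc : ∀ t ∈ I, γ₁ t = γ₂ t → γ₁ =ᶠ[𝓝 t] γ₂ := by
    intro t ht he
    obtain ⟨K, N, hN, hK⟩ :=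
      (hv.contDiffAt (hD.mem_nhds (h₁ t ht).1)).exists_lipschitzOnWith
    have hev : ∀ γ : ℝ → Cfg d, IsSolutionOn D v I γ → γ t = γ₁ t →
        ∀ᶠ s in 𝓝 t, HasDerivAt γ (v (s, γ s)) s ∧ γ s ∈ {x | (s, x) ∈ N} := by
      intro γ hγ hγt
      have hc : ContinuousAt (fun s => (s, γ s)) t :=
        continuousAt_id.prodMk (hγ t ht).2.continuousAt
      have h3 : N ∈ 𝓝 (t, γ t) := by rwa [hγt]
      filter_upwards [hI.mem_nhds ht, hc h3] with s hs hs'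
      exact ⟨(hγ s hs).2, hs'⟩
    refine ODE_solution_unique_of_eventually (v := fun s x => v (s, x)) (K := K)
      (s := fun s => {x | (s, x) ∈ N}) (Eventually.of_forall fun s => ?_) (hev γ₁ h₁ rfl)
      (hev γ₂ h₂ he.symm) he
    have := hK.comp ((LipschitzWith.prodMk_left s).lipschitzOnWith (s := {x | (s, x) ∈ N}))
      (fun x hx => hx)
    simpa [Function.comp_def] using this
  -- Connectedness of `I`: the interior of the agreement set contains `0`, and its limit points in
  -- `I` belong to it by continuity and local uniqueness.
  have hsub : I ⊆ interior {t | γ₁ t = γ₂ t} := by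
    refine hIc.isPreconnected.subset_of_closure_inter_subset isOpen_interior
      ⟨0, h0, mem_interior_iff_mem_nhds.2 (hloc 0 h0 h)⟩ ?_
    rintro t ⟨htc, htI⟩
    refine mem_interior_iff_mem_nhds.2 (hloc t htI ?_)
    have hfr : ∃ᶠ s in 𝓝 t, γ₁ s = γ₂ s :=
      (mem_closure_iff_frequently.1 htc).mono fun s hs =>
        interior_subset (s := {t | γ₁ t = γ₂ t}) hs
    have hcl : IsClosed {p : Cfg d × Cfg d | p.1 = p.2} := isClosed_diagonal
    have hc : Tendsto (fun s => (γ₁ s, γ₂ s)) (𝓝 t) (𝓝 (γ₁ t, γ₂ t)) :=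
      (h₁ t htI).2.continuousAt.prodMk_nhds (h₂ t htI).2.continuousAt
    exact hcl.mem_of_frequently_of_tendsto hfr hc
  exact fun t ht => interior_subset (s := {t | γ₁ t = γ₂ t}) (hsub ht)

lemma IsSolutionOn.mono {I I' : Set ℝ} {γ : ℝ → Cfg d} (h : IsSolutionOn D v I γ) (hI : I' ⊆ I) :
    IsSolutionOn D v I' γ := fun s hs => h s (hI hs)

lemma SolutionJoins.unique (hD : IsOpen D) (hv : ContDiffOn ℝ 1 v D) {t : ℝ} {q x y : Cfg d}
    (hx : SolutionJoins D v t q x) (hy : SolutionJoins D v t q y) : x = y := by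
  obtain ⟨I, γ, hI, hIc, h0, ht, hγ, hq, rfl⟩ := hx
  obtain ⟨I', γ', hI', hIc', h0', ht', hγ', hq', rfl⟩ := hy
  exact (hγ.mono inter_subset_left).eqOn hD hv (hI.inter hI') (hIc.inter hIc') ⟨h0, h0'⟩
    (hγ'.mono inter_subset_right) (hq.trans hq'.symm) ⟨ht, ht'⟩

/-- A solution that can be continued to all integer times is global. -/
theorem existsUnique_isSolutionOn_univ (hD : IsOpen D) (hv : ContDiffOn ℝ 1 v D) {q : Cfg d}
    (h : ∀ n : ℕ, (∃ x, SolutionJoins D v (n + 1) q x) ∧ ∃ x, SolutionJoins D v (-(n + 1)) q x) :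
    ∃! Q : ℝ → Cfg d, Q 0 = q ∧ IsSolutionOn D v univ Q := by
  have ex : ∀ n : ℕ, ∃ γ : ℝ → Cfg d, γ 0 = q ∧
      IsSolutionOn D v (Ioo (-((n : ℝ) + 1)) (n + 1)) γ := by
    intro n
    obtain ⟨⟨x, I, γ, hI, hIc, h0, ht, hγ, hq, -⟩, y, I', γ', hI', hIc', h0', ht', hγ', hq', -⟩ :=
      h n
    have he : EqOn γ γ' (I ∩ I') :=
      (hγ.mono inter_subset_left).eqOn hD hv (hI.inter hI') (hIc.inter hIc') ⟨h0, h0'⟩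
        (hγ'.mono inter_subset_right) (hq.trans hq'.symm)
    -- The two halves agree on the neighbourhood `I ∩ I'` of `0`, so the glued curve is
    -- differentiable at `0` as well.
    set Γ : ℝ → Cfg d := fun s => if 0 ≤ s then γ s else γ' s with hΓ
    have h1 : ∀ s ∈ I ∩ Ioi 0 ∪ I ∩ I', Γ s = γ s := by
      rintro s (hs | hs)
      · simp [Γ, (show 0 < s from hs.2).le]
      · by_cases h0s : 0 ≤ s <;> simp [Γ, h0s, he hs]
    have h2 : ∀ s ∈ I' ∩ Iio 0, Γ s = γ' s := fun s hs => by
      simp [Γ, not_le.2 (show s < 0 from hs.2)]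
    refine ⟨Γ, by simp [Γ, hq], fun s hs => ?_⟩
    rcases lt_or_ge s 0 with hs0 | hs0
    · have hsI : s ∈ I' := hIc'.out ht' h0' ⟨hs.1.le, hs0.le⟩
      rw [h2 s ⟨hsI, hs0⟩]
      refine ⟨(hγ' s hsI).1, (hγ' s hsI).2.congr_of_eventuallyEq ?_⟩
      filter_upwards [(hI'.inter isOpen_Iio).mem_nhds ⟨hsI, hs0⟩] with r hr using h2 r hr
    · have hsI : s ∈ I := hIc.out h0 ht ⟨hs0, hs.2.le⟩
      have hsm : s ∈ I ∩ Ioi 0 ∪ I ∩ I' := by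
        rcases hs0.eq_or_lt with rfl | hs0
        · exact Or.inr ⟨h0, h0'⟩
        · exact Or.inl ⟨hsI, hs0⟩
      rw [h1 s hsm]
      refine ⟨(hγ s hsI).1, (hγ s hsI).2.congr_of_eventuallyEq ?_⟩
      filter_upwards [((hI.inter isOpen_Ioi).union (hI.inter hI')).mem_nhds hsm] with r hr
        using h1 r hr
  choose γ hγ0 hγ using ex
  obtain ⟨Q, hQ⟩ := exists_eqOn_of_eqOn_Ioo γ fun n m hnm => by
    have hnm' : (n : ℝ) ≤ m := by exact_mod_cast hnm
    have hn : (0 : ℝ) ≤ n := n.cast_nonneg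
    exact (hγ n).eqOn hD hv isOpen_Ioo ordConnected_Ioo ⟨by linarith, by linarith⟩
      ((hγ m).mono (Ioo_subset_Ioo (by linarith) (by linarith))) (by rw [hγ0, hγ0])
  refine ⟨Q, ⟨?_, fun s _ => ?_⟩, fun Q' hQ' => ?_⟩
  · rw [hQ 0 (by simp), hγ0]
  · have hs : s ∈ Ioo (-((⌊|s|⌋₊ : ℝ) + 1)) (⌊|s|⌋₊ + 1) := abs_lt.1 (Nat.lt_floor_add_one |s|)
    rw [hQ _ hs]
    refine ⟨(hγ _ s hs).1, (hγ _ s hs).2.congr_of_eventuallyEq ?_⟩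
    filter_upwards [isOpen_Ioo.mem_nhds hs] with r hr using hQ _ hr
  · ext1 s
    have hs : s ∈ Ioo (-((⌊|s|⌋₊ : ℝ) + 1)) (⌊|s|⌋₊ + 1) := abs_lt.1 (Nat.lt_floor_add_one |s|)
    rw [hQ _ hs]
    have hn : (0 : ℝ) ≤ (⌊|s|⌋₊ : ℝ) := Nat.cast_nonneg _
    exact (hQ'.2.mono (subset_univ _)).eqOn hD hv isOpen_Ioo ordConnected_Ioo
      ⟨by linarith, by linarith⟩ (hγ ⌊|s|⌋₊) (by rw [hQ'.1, hγ0]) hs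

/-! ### Almost sure global existence and equivariance in the abstract setting -/

/-- The hypotheses for global existence: a density `ρ` satisfying the continuity equation with
velocity `v`, and functions `h i` which confine to compact sets and whose variation along
the flow is integrable. -/
structure ConfinedFlow {ι : Type*} (D : Set (ℝ × Cfg d)) (v : ℝ × Cfg d → Cfg d)
    (ρ : ℝ × Cfg d → ℝ) (h : ι → ℝ × Cfg d → ℝ) : Prop where
  isOpen : IsOpen D
  contDiffOn_velocity : ContDiffOn ℝ 1 v D
  contDiffOn_density : ContDiffOn ℝ 1 ρ D
  density_nonneg : ∀ p ∈ D, 0 ≤ ρ p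
  continuityEq : ∀ p ∈ D, ContinuityEqAt ρ (fun p => ρ p • v p) p
  contDiffOn : ∀ i, ContDiffOn ℝ 1 (h i) D
  confine : ∀ T R : ℝ, ∃ Z ⊆ D, IsCompact Z ∧
    ∀ p ∈ D, |p.1| < T → (∀ i, |h i p| < R) → p ∈ Z
  variation : ∀ T : ℝ, 0 < T → ∀ i, ∫⁻ s in Icc (-T) T, ∫⁻ x, D.indicator
    (fun p => ENNReal.ofReal (ρ p) * ‖fderiv ℝ (h i) p (1, v p)‖ₑ) (s, x) ≠ ⊤
  mass : sliceMeasure D ρ 0 univ ≠ ⊤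

namespace ConfinedFlow

variable {ι : Type*} [Fintype ι] {ρ : ℝ × Cfg d → ℝ} {h : ι → ℝ × Cfg d → ℝ}
  (H : ConfinedFlow D v ρ h)
include H

/-- Both error terms of `exists_isOpen_solutionJoins` vanish as the level grows: the initial one
because the mass is finite and each point of the slice has finite values `h i`, the Chebyshev one
because a finite constant is divided by the level. -/
theorem exists_isOpen_le (t : ℝ) {ε : ℝ≥0∞} (hε : ε ≠ 0) :
    ∃ (U : Set (Cfg d)) (φ : Cfg d → Cfg d), IsOpen U ∧ Continuous φ ∧
      (∀ q ∈ U, SolutionJoins D v t q (φ q)) ∧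
      ((sliceMeasure D ρ 0).restrict U).map φ ≤ sliceMeasure D ρ t ∧
      sliceMeasure D ρ 0 Uᶜ ≤ ε := by
  set μ := sliceMeasure D ρ 0 with hμ
  set c : ι → ℝ≥0∞ := fun i => ∫⁻ s in uIcc 0 t, ∫⁻ x, D.indicator
    (fun p => ENNReal.ofReal (ρ p) * ‖fderiv ℝ (h i) p (1, v p)‖ₑ) (s, x) with hc
  have hct : ∀ i, c i ≠ ⊤ := fun i => by
    refine ne_top_of_le_ne_top (H.variation (|t| + 1) (by positivity) i)
      (lintegral_mono_set fun s hs => ?_)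
    have h1 : |s| ≤ |t| := by simpa using abs_sub_left_of_mem_uIcc hs
    exact abs_le.1 (h1.trans (by linarith))
  set V : ℕ → Set (Cfg d) := fun n => {q | (0, q) ∈ D ∧ ∀ i, |h i (0, q)| < (n : ℝ) + 1} with hV
  have hVo : ∀ n, IsOpen (V n) := fun n => by
    have : V n = (fun q => ((0 : ℝ), q)) ⁻¹' (D ∩ ⋂ i, D ∩ h i ⁻¹' {y | |y| < (n : ℝ) + 1}) := by
      ext q
      simp only [hV, mem_ofPred_eq, mem_inter_iff, mem_iInter, mem_preimage]
      exact ⟨fun hp => ⟨hp.1, fun i => ⟨hp.1, hp.2 i⟩⟩, fun hp => ⟨hp.1, fun i => (hp.2 i).2⟩⟩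
    rw [this]
    refine (H.isOpen.inter (isOpen_iInter_of_finite fun i => ?_)).preimage (by fun_prop)
    exact (H.contDiffOn i).continuousOn.isOpen_inter_preimage H.isOpen
      (isOpen_lt continuous_abs continuous_const)
  have hVlim : Tendsto (fun n => μ (V n)ᶜ) atTop (𝓝 0) := by
    have h1 := tendsto_measure_iInter_atTop (μ := μ) (s := fun n => (V n)ᶜ)
      (fun n => (hVo n).measurableSet.compl.nullMeasurableSet)
      (fun n m hnm => compl_subset_compl.2 fun q hq => ⟨hq.1, fun i => (hq.2 i).trans_le (by
        have : (n : ℝ) ≤ m := by exact_mod_cast hnm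
        linarith)⟩) ⟨0, ne_top_of_le_ne_top H.mass (measure_mono (subset_univ _))⟩
    have h2 : μ (⋂ n, (V n)ᶜ) = 0 := by
      have h3 : (⋂ n, (V n)ᶜ) ⊆ {q | (0, q) ∈ D}ᶜ := by
        intro q hq hqD
        rw [mem_iInter] at hq
        obtain ⟨n, hn⟩ := exists_nat_gt (∑ i, |h i (0, q)|)
        refine hq n ⟨hqD, fun i => ?_⟩
        have : |h i (0, q)| ≤ ∑ i, |h i (0, q)| := Finset.single_le_sum
          (f := fun i => |h i (0, q)|) (fun i _ => abs_nonneg _) (Finset.mem_univ i)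
        linarith
      refine measure_mono_null h3 ?_
      have hDm : MeasurableSet {q : Cfg d | (0, q) ∈ D}ᶜ :=
        (H.isOpen.preimage (f := fun q => ((0 : ℝ), q)) (by fun_prop)).measurableSet.compl
      rw [hμ, sliceMeasure, withDensity_apply _ hDm]
      refine setLIntegral_eq_zero hDm fun q hq => ?_
      simp [indicator_of_notMem (show ((0 : ℝ), q) ∉ D from hq)]
    rwa [h2] at h1
  have hclim : Tendsto (fun n : ℕ => ∑ i, c i / ENNReal.ofReal ((n : ℝ) + 1)) atTop (𝓝 0) := by
    have : Tendsto (fun n : ℕ => ∑ i, c i / ENNReal.ofReal ((n : ℝ) + 1)) atTop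
        (𝓝 (∑ i : ι, 0)) := by
      refine tendsto_finsetSum _ fun i _ => ?_
      have h1 : Tendsto (fun n : ℕ => ENNReal.ofReal ((n : ℝ) + 1)) atTop (𝓝 ⊤) :=
        ENNReal.tendsto_ofReal_atTop.comp
          (tendsto_atTop_add_const_right _ _ tendsto_natCast_atTop_atTop)
      have h2 := ENNReal.Tendsto.const_div h1 (Or.inr (hct i))
      simpa using h2
    simpa using this
  have hev := (hVlim.add hclim).eventually_le_const (show 0 + 0 < ε by
    simpa using pos_iff_ne_zero.2 hε)
  obtain ⟨n, hn⟩ := hev.exists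
  obtain ⟨Z, hZD, hZ, hZh⟩ := H.confine (|t| + 1) (2 * ((n : ℝ) + 1))
  obtain ⟨U, φ, h1, h2, h3, h4, h5⟩ := exists_isOpen_solutionJoins H.isOpen H.contDiffOn_velocity
    H.contDiffOn_density H.density_nonneg H.continuityEq H.contDiffOn
    (by positivity : (0 : ℝ) < (n : ℝ) + 1) hZ hZD hZh
  exact ⟨U, φ, h1, h2, h3, h4, h5.trans hn⟩

theorem ae_exists_solutionJoins (t : ℝ) :
    ∀ᵐ q ∂(sliceMeasure D ρ 0), ∃ x, SolutionJoins D v t q x := by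
  rw [ae_iff]
  refine le_antisymm (ENNReal.le_of_forall_pos_le_add fun ε hε _ => ?_) zero_le
  obtain ⟨U, φ, -, -, h3, -, h5⟩ := H.exists_isOpen_le t
    (ε := ε) (by simpa using hε.ne')
  rw [zero_add]
  have hs : {q | ¬∃ x, SolutionJoins D v t q x} ⊆ Uᶜ := fun q hq hqU => hq ⟨_, h3 q hqU⟩
  exact (measure_mono hs).trans h5

/-- Global existence and uniqueness of solutions for almost every initial point. -/
theorem ae_existsUnique :
    ∀ᵐ q ∂(sliceMeasure D ρ 0), ∃! Q : ℝ → Cfg d, Q 0 = q ∧ IsSolutionOn D v univ Q := by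
  have h1 : ∀ᵐ q ∂(sliceMeasure D ρ 0), ∀ n : ℕ, (∃ x, SolutionJoins D v (n + 1) q x) ∧
      ∃ x, SolutionJoins D v (-(n + 1)) q x :=
    ae_all_iff.2 fun n => (H.ae_exists_solutionJoins _).and (H.ae_exists_solutionJoins _)
  filter_upwards [h1] with q hq
  exact existsUnique_isSolutionOn_univ H.isOpen H.contDiffOn_velocity hq

/-- Equivariance of the slice measures under the flow map. -/
theorem equivariant {t : ℝ} (hmass : sliceMeasure D ρ t univ = sliceMeasure D ρ 0 univ)
    {F : Cfg d → Option (Cfg d)} (hF : ∀ q x, SolutionJoins D v t q x → F q = some x)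
    {B : Set (Option (Cfg d))} (hB : MeasurableSet (some ⁻¹' B)) :
    NullMeasurableSet (F ⁻¹' B) (sliceMeasure D ρ 0) ∧
      sliceMeasure D ρ 0 (F ⁻¹' B) = sliceMeasure D ρ t (some ⁻¹' B) := by
  set μ := sliceMeasure D ρ 0 with hμ
  set μt := sliceMeasure D ρ t with hμt
  have hpos : ∀ n : ℕ, ((n : ℝ≥0∞) + 1)⁻¹ ≠ 0 := fun n => by
    simp
  choose U φ hU hφ hUφ hmap hUc using fun n : ℕ => H.exists_isOpen_le t (hpos n)
  have hlim : Tendsto (fun n : ℕ => ((n : ℝ≥0∞) + 1)⁻¹) atTop (𝓝 0) := by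
    have := (tendsto_add_atTop_iff_nat 1).2 ENNReal.tendsto_inv_nat_nhds_zero
    simpa using this
  have hmem : ∀ (B : Set (Option (Cfg d))) n, ∀ q ∈ U n, q ∈ F ⁻¹' B ↔ φ n q ∈ some ⁻¹' B := by
    intro B n q hq
    rw [mem_preimage, hF q _ (hUφ n q hq), mem_preimage]
  have hnull : ∀ B : Set (Option (Cfg d)), MeasurableSet (some ⁻¹' B) →
      NullMeasurableSet (F ⁻¹' B) μ := by
    intro B hB
    have hS : MeasurableSet (⋃ n, U n ∩ φ n ⁻¹' (some ⁻¹' B)) :=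
      MeasurableSet.iUnion fun n => (hU n).measurableSet.inter ((hφ n).measurable hB)
    -- `F` is arbitrary where no solution exists, so measurability is obtained only up to a null
    -- set: on each `U n` it coincides with the continuous `φ n`.
    have hae : ∀ᵐ q ∂μ, q ∈ ⋃ n, U n := by
      rw [ae_iff]
      refine le_antisymm (ge_of_tendsto' hlim fun n => ?_) zero_le
      have hs : {q | q ∉ ⋃ n, U n} ⊆ (U n)ᶜ := fun q hq hqn => hq (mem_iUnion.2 ⟨n, hqn⟩)
      exact (measure_mono hs).trans (hUc n)
    refine hS.nullMeasurableSet.congr ?_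
    filter_upwards [hae] with q hq
    refine propext ⟨fun hq' => ?_, fun hq' => ?_⟩
    · obtain ⟨n, hn⟩ := mem_iUnion.1 hq'
      exact (hmem B n q hn.1).2 hn.2
    · obtain ⟨n, hn⟩ := mem_iUnion.1 hq
      exact mem_iUnion.2 ⟨n, hn, (hmem B n q hn).1 hq'⟩
  have hle : ∀ B : Set (Option (Cfg d)), MeasurableSet (some ⁻¹' B) →
      μ (F ⁻¹' B) ≤ μt (some ⁻¹' B) := by
    intro B hB
    have h1 : ∀ n : ℕ, μ (F ⁻¹' B) ≤ μt (some ⁻¹' B) + ((n : ℝ≥0∞) + 1)⁻¹ := by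
      intro n
      have h2 : F ⁻¹' B ⊆ (φ n ⁻¹' (some ⁻¹' B) ∩ U n) ∪ (U n)ᶜ := by
        intro q hq
        by_cases hqU : q ∈ U n
        · exact Or.inl ⟨(hmem B n q hqU).1 hq, hqU⟩
        · exact Or.inr hqU
      refine (measure_mono h2).trans ((measure_union_le _ _).trans (add_le_add ?_ (hUc n)))
      have h3 := hmap n (some ⁻¹' B)
      rwa [Measure.map_apply (hφ n).measurable hB,
        Measure.restrict_apply ((hφ n).measurable hB)] at h3
    have h4 := hlim.const_add (μt (some ⁻¹' B))
    rw [add_zero] at h4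
    exact ge_of_tendsto' h4 h1
  refine ⟨hnull B hB, le_antisymm (hle B hB) ?_⟩
  -- The inequality also holds for the complement. The total masses are equal and finite, so neither
  -- inequality can be strict.
  have h1 := hle Bᶜ hB.compl
  have h2 : μ (F ⁻¹' B) + μ (F ⁻¹' Bᶜ) = μ univ := measure_add_measure_compl₀ (hnull B hB)
  have h3 : μt (some ⁻¹' B) + μt (some ⁻¹' Bᶜ) = μt univ := measure_add_measure_compl hB
  have hfin : μ (F ⁻¹' Bᶜ) ≠ ⊤ := ne_top_of_le_ne_top H.mass (measure_mono (subset_univ _))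
  rw [hmass, ← h2] at h3
  refine (ENNReal.add_le_add_iff_right hfin).1 ?_
  rw [← h3]
  gcongr

end ConfinedFlow

/-! ### The unitary group and the time derivative in L² -/

section UnitaryGroup

variable {𝓗 : Type*} [NormedAddCommGroup 𝓗] [InnerProductSpace ℂ 𝓗]
  {H : 𝓗 →ₗ.[ℂ] 𝓗}

lemma IsUnitaryGroupOf.hasDerivAt [NormedSpace ℝ 𝓗] [IsScalarTower ℝ ℂ 𝓗]
    {U : ℝ → 𝓗 ≃ₗᵢ[ℂ] 𝓗} (hU : IsUnitaryGroupOf H U) {f g : 𝓗} (h : (f, g) ∈ H.graph) (t : ℝ) :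
    HasDerivAt (fun s => U s f) (-(Complex.I • U t g)) t := by
  have h0 := (hU.generator f g).1 h
  have h1 : HasDerivAt (fun s => U s f) (-(Complex.I • g)) (t - t) := by rwa [sub_self]
  have h2 : HasDerivAt (fun s => U (s - t) f) (-(Complex.I • g)) t := h1.comp_sub_const t t
  have h3 := (((U t).toContinuousLinearEquiv : 𝓗 →L[ℂ] 𝓗).restrictScalars
    ℝ).hasFDerivAt.comp_hasDerivAt t h2
  have e1 : ∀ s, U t (U (s - t) f) = U s f := fun s => by
    rw [← hU.map_add, add_sub_cancel]
  simpa [Function.comp_def, e1] using h3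

/-- By the group law, differentiating the orbit of `U t f` at time `0` is differentiating the orbit
of `f` at time `t`. -/
lemma IsUnitaryGroupOf.map_mem_graph [NormedSpace ℝ 𝓗] [IsScalarTower ℝ ℂ 𝓗]
    {U : ℝ → 𝓗 ≃ₗᵢ[ℂ] 𝓗} (hU : IsUnitaryGroupOf H U) {f g : 𝓗} (h : (f, g) ∈ H.graph) (t : ℝ) :
    (U t f, U t g) ∈ H.graph := by
  rw [hU.generator]
  have h1 := hU.hasDerivAt h (0 + t)
  have h2 := h1.comp_add_const 0 t
  simpa [hU.map_add] using h2

/-- Symmetry of `H`, used to move it from the evolving state onto a test function, where it is the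
explicit differential expression. -/
lemma inner_eq_inner_of_mem_graph [CompleteSpace 𝓗] (hH : IsSelfAdjoint H) {f g u v : 𝓗}
    (hfg : (f, g) ∈ H.graph) (huv : (u, v) ∈ H.graph) : inner ℂ v f = inner ℂ u g := by
  rw [LinearPMap.mem_graph_iff] at hfg huv
  obtain ⟨x, rfl, rfl⟩ := hfg
  obtain ⟨y, rfl, rfl⟩ := huv
  have h1 := LinearPMap.adjoint_isFormalAdjoint hH.dense_domain
  rw [show H.adjoint = H from hH] at h1
  exact h1 y x

end UnitaryGroup

/-- A classical time derivative agrees almost everywhere with the `L²` derivative. -/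
lemma ae_eq_of_hasDerivAt_L2 {d k : ℕ} {Ω : Set (Cfg d)} {f : ℝ → L2 d k} {g : L2 d k} {t : ℝ}
    (hf : HasDerivAt f g t) {ψ : ℝ → Cfg d → Spin k} (hψ : ∀ s, ψ s =ᵐ[volume] f s)
    {ψ' : Cfg d → Spin k} (hψ' : ∀ q ∈ Ω, HasDerivAt (fun s => ψ s q) (ψ' q) t) :
    ∀ᵐ q, q ∈ Ω → ψ' q = g q := by
  set τ : ℕ → ℝ := fun n => 1 / ((n : ℝ) + 1) with hτ
  have hτ0 : ∀ n, τ n ≠ 0 := fun n => by positivity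
  have hτl : Tendsto τ atTop (𝓝[≠] 0) := tendsto_nhdsWithin_iff.2
    ⟨tendsto_one_div_add_atTop_nhds_zero_nat, Eventually.of_forall hτ0⟩
  have h1 : Tendsto (fun n => (τ n)⁻¹ • (f (t + τ n) - f t)) atTop (𝓝 g) :=
    (hasDerivAt_iff_tendsto_slope_zero.1 hf).comp hτl
  -- Convergence of the difference quotients in L² gives almost everywhere convergence along a
  -- subsequence, which must agree with the pointwise limit.
  obtain ⟨ns, hns, hlim⟩ := (tendstoInMeasure_of_tendsto_Lp h1).exists_seq_tendsto_ae
  have h2 : ∀ᵐ q, ∀ n, ((τ n)⁻¹ • (f (t + τ n) - f t) : L2 d k) q =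
      (τ n)⁻¹ • (ψ (t + τ n) q - ψ t q) := by
    refine ae_all_iff.2 fun n => ?_
    filter_upwards [Lp.coeFn_smul (τ n)⁻¹ (f (t + τ n) - f t), Lp.coeFn_sub (f (t + τ n)) (f t),
      hψ (t + τ n), hψ t] with q a1 a2 a3 a4
    rw [a1, Pi.smul_apply, a2, Pi.sub_apply, a3, a4]
  filter_upwards [hlim, h2] with q a1 a2 hq
  have h3 := ((hasDerivAt_iff_tendsto_slope_zero.1 (hψ' q hq)).comp hτl).comp hns.tendsto_atTop
  refine tendsto_nhds_unique h3 (a1.congr fun n => ?_)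
  rw [a2]
  rfl

/-! ### From the weak to the classical Schrödinger equation -/

section PartialDerivatives

variable {d : ℕ} {F : Type*} [NormedAddCommGroup F] [NormedSpace ℝ F]

lemma contDiffOn_pd {f : Cfg d → F} {Ω : Set (Cfg d)} (hΩ : IsOpen Ω) {m n : WithTop ℕ∞}
    (hf : ContDiffOn ℝ n f Ω) (hmn : m + 1 ≤ n) (j : Fin d) : ContDiffOn ℝ m (pd j f) Ω :=
  (hf.fderiv_of_isOpen hΩ hmn).clm_apply contDiffOn_const

lemma contDiff_pd {f : Cfg d → F} (hf : ContDiff ℝ ∞ f) (j : Fin d) : ContDiff ℝ ∞ (pd j f) :=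
  (hf.fderiv_right (by simp)).clm_apply contDiff_const

lemma tsupport_pd_subset (f : Cfg d → F) (j : Fin d) : tsupport (pd j f) ⊆ tsupport f :=
  tsupport_fderiv_apply_subset ℝ _

/-- The wave function and `A` are regular only on open sets; a cutoff supported there makes the
product continuous on the whole space. -/
lemma integrable_smul_of_tsupport_subset {η : Cfg d → ℝ} {O : Set (Cfg d)} (hO : IsOpen O)
    (hη : Continuous η) (hηc : HasCompactSupport η) (hηO : tsupport η ⊆ O) {g : Cfg d → F}
    (hg : ContinuousOn g O) : Integrable (fun q => η q • g q) := by
  refine Continuous.integrable_of_hasCompactSupport ?_ hηc.smul_right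
  refine continuous_iff_continuousAt.2 fun q => ?_
  by_cases hq : q ∈ tsupport η
  · exact hη.continuousAt.smul (hg.continuousAt (hO.mem_nhds (hηO hq)))
  · have : (fun q => η q • g q) =ᶠ[𝓝 q] fun _ => 0 := by
      filter_upwards [(isClosed_tsupport η).isOpen_compl.mem_nhds hq] with r hr
      rw [image_eq_zero_of_notMem_tsupport hr, zero_smul]
    exact continuousAt_const.congr this.symm

/-- Integration by parts against a test function supported in an open set. -/
lemma integral_pd_smul {χ : Cfg d → ℝ} {O : Set (Cfg d)} (hO : IsOpen O) (hχ : ContDiff ℝ ∞ χ)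
    (hχc : HasCompactSupport χ) (hχO : tsupport χ ⊆ O) {f : Cfg d → F} (hf : ContDiffOn ℝ 1 f O)
    (j : Fin d) : ∫ q, pd j χ q • f q = -∫ q, χ q • pd j f q := by
  have hs := tsupport_pd_subset χ j
  rw [eq_neg_iff_add_eq_zero, add_comm, ← eq_neg_iff_add_eq_zero]
  exact integral_smul_fderiv_eq_neg_fderiv_smul_of_integrable (𝕜 := ℝ)
    (integrable_smul_of_tsupport_subset hO (contDiff_pd hχ j).continuous
      (hχc.of_isClosed_subset (isClosed_tsupport _) hs) (hs.trans hχO) hf.continuousOn)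
    (integrable_smul_of_tsupport_subset hO hχ.continuous hχc hχO
      (contDiffOn_pd hO hf (m := 0) (by simp) j).continuousOn)
    (integrable_smul_of_tsupport_subset hO hχ.continuous hχc hχO hf.continuousOn)
    (fun x _ => (hχ.differentiable (by simp)) x)
    (fun x hx => (hf.contDiffAt (hO.mem_nhds (hχO hx))).differentiableAt one_ne_zero)

end PartialDerivatives

section Schrodinger

variable {d k : ℕ} {O : Set (Cfg d)}

/-- Both derivatives have the same integrals against test functions supported in `O`, so the
fundamental lemma of the calculus of variations identifies them. In particular the choice made in
`weakPartial` is harmless. -/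
lemma weakPartial_ae_eq_pd (hO : IsOpen O) {f : Cfg d → ℝ} (hf : ContDiffOn ℝ 1 f O) {j : Fin d}
    (h : ∃ g, HasWeakPartial j f g) : ∀ᵐ q, q ∈ O → weakPartial j f q - pd j f q = 0 := by
  have hw : weakPartial j f = h.choose := dif_pos h
  have hg := h.choose_spec
  rw [← hw] at hg
  have hpc : ContinuousOn (pd j f) O := (contDiffOn_pd hO hf (m := 0) (by simp) j).continuousOn
  refine hO.ae_eq_zero_of_integral_contDiff_smul_eq_zero
    ((hg.locallyIntegrable_deriv.locallyIntegrableOn O).sub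
      (hpc.locallyIntegrableOn hO.measurableSet)) fun χ hχ hχc hχO => ?_
  have h1 := hg.integral_eq χ hχ hχc
  have h2 := integral_pd_smul hO hχ hχc hχO hf j
  simp_rw [smul_sub]
  rw [integral_sub
    (hg.locallyIntegrable_deriv.integrable_smul_left_of_hasCompactSupport hχ.continuous hχc)
    (integrable_smul_of_tsupport_subset hO hχ.continuous hχc hχO hpc)]
  simp only [smul_eq_mul, mul_comm] at h1 h2 ⊢
  linarith

/-- The classical expression `(∂_j - i A_j)² f` for twice differentiable `f` and
differentiable `A`. -/
noncomputable def magneticSqC {F : Type*} [NormedAddCommGroup F] [NormedSpace ℝ F] [Module ℂ F]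
    (A : Cfg d → Cfg d) (j : Fin d) (f : Cfg d → F) (q : Cfg d) : F :=
  pd j (pd j f) q - (2 * Complex.I * (A q j : ℂ)) • pd j f q
    - (Complex.I * ((pd j (fun x => A x j) q : ℝ) : ℂ)) • f q - ((A q j : ℂ) ^ 2) • f q

lemma pd_smul_const {F : Type*} [NormedAddCommGroup F] [NormedSpace ℝ F] {χ : Cfg d → ℝ}
    (hχ : Differentiable ℝ χ) (e : F) (j : Fin d) :
    pd j (fun q => χ q • e) = fun q => pd j χ q • e := by
  ext1 q
  simp [pd, fderiv_smul_const (hχ q)]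

lemma pd_apply {u : Cfg d → Spin k} {q : Cfg d} (hu : DifferentiableAt ℝ u q) (j : Fin d)
    (a : Fin k) : pd j (fun q => u q a) q = pd j u q a := by
  have h1 := (((EuclideanSpace.proj a : Spin k →L[ℂ] ℂ).restrictScalars ℝ).hasFDerivAt
    (x := u q)).comp q hu.hasFDerivAt
  have h2 : HasFDerivAt (fun q => u q a) _ q := h1
  rw [pd, h2.fderiv]
  rfl

lemma locallyIntegrableOn_toEuclideanLin (hO : IsOpen O) {V : Cfg d → Matrix (Fin k) (Fin k) ℂ}
    (hV : ∀ a b, MemL2loc O (fun q => V q a b)) {u : Cfg d → Spin k} (hu : ContinuousOn u O)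
    (a : Fin k) : LocallyIntegrableOn (fun q => Matrix.toEuclideanLin (V q) (u q) a) O := by
  rw [locallyIntegrableOn_iff hO.isLocallyClosed]
  intro K hK hKc
  have e : (fun q => Matrix.toEuclideanLin (V q) (u q) a) = fun q => ∑ b, V q a b * u q b := by
    ext1 q
    simp [Matrix.toLpLin_apply, Matrix.mulVec, dotProduct]
  rw [e]
  refine integrable_finsetSum _ fun b _ => ?_
  have : IsFiniteMeasure (volume.restrict K) := ⟨by simpa using hKc.measure_lt_top⟩
  have h1 : IntegrableOn (fun q => V q a b) K := (hV a b K hK hKc).integrable one_le_two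
  refine h1.mul_continuousOn ?_ hKc
  exact ((EuclideanSpace.proj b : Spin k →L[ℂ] ℂ).continuous.comp_continuousOn hu).mono hK

end Schrodinger

variable {d k : ℕ} {O : Set (Cfg d)}

/-- The inner product of `H₀ (χ e_a)` with `u` in terms of the component `u_a`. -/
lemma inner_schrodingerExpr_single {m : Fin d → ℝ} {A : Cfg d → Cfg d}
    {V : Cfg d → Matrix (Fin k) (Fin k) ℂ} {q : Cfg d} (hV : (V q).IsHermitian) {χ : Cfg d → ℝ}
    (hχ : ContDiff ℝ ∞ χ) (a : Fin k) (x : Spin k) :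
    inner ℂ (schrodingerExpr m A V (fun q => χ q • EuclideanSpace.single a (1 : ℂ)) q) x =
      (∑ j, -(1 / 2 * ((m j)⁻¹ : ℂ)) * (pd j (pd j χ) q • x a
        + 2 * Complex.I * (pd j χ q • ((A q j : ℂ) * x a))
        + Complex.I * (χ q • ((weakPartial j (fun x => A x j) q : ℂ) * x a))
        - χ q • ((A q j : ℂ) ^ 2 * x a))) + χ q • Matrix.toEuclideanLin (V q) x a := by
  have hsym := Matrix.isSymmetric_toEuclideanLin_iff.2 hV
  have hd : Differentiable ℝ χ := hχ.differentiable (by simp)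
  have hd' : ∀ j, Differentiable ℝ (pd j χ) := fun j =>
    (contDiff_pd hχ j).differentiable (by simp)
  have hs : ∀ r : ℝ, r • (EuclideanSpace.single a (1 : ℂ) : Spin k) =
      (r : ℂ) • EuclideanSpace.single a (1 : ℂ) := fun r => (Complex.coe_smul r _).symm
  have hi : ∀ (c : ℂ) (x : Spin k), inner ℂ (c • (EuclideanSpace.single a (1 : ℂ) : Spin k)) x =
      (starRingEnd ℂ) c * x a := fun c x => by
    rw [inner_smul_left, EuclideanSpace.inner_single_left]
    simp
  have hm : ∀ j, magneticSq A j (fun q => χ q • (EuclideanSpace.single a (1 : ℂ) : Spin k)) q =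
      (((pd j (pd j χ) q : ℝ) : ℂ) - 2 * Complex.I * (A q j : ℂ) * ((pd j χ q : ℝ) : ℂ)
        - Complex.I * (weakPartial j (fun x => A x j) q : ℂ) * (χ q : ℂ)
        - (A q j : ℂ) ^ 2 * (χ q : ℂ)) • EuclideanSpace.single a (1 : ℂ) := by
    intro j
    rw [magneticSq, pd_smul_const hd, pd_smul_const (hd' j)]
    simp only [hs, sub_smul, smul_smul]
  rw [schrodingerExpr, inner_add_left, hsym, inner_neg_left, inner_smul_left, sum_inner]
  congr 1
  · simp only [hm, inner_smul_left, EuclideanSpace.inner_single_left, Finset.mul_sum,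
      ← Finset.sum_neg_distrib, map_sub, map_mul, map_pow, Complex.conj_ofReal, Complex.conj_I,
      Complex.real_smul, map_one, one_mul, map_ofNat, map_div₀, map_inv₀, Complex.ofReal_inv]
    refine Finset.sum_congr rfl fun j _ => ?_
    ring
  · simp only [hs]
    rw [hi, Complex.conj_ofReal, Complex.real_smul]

/-- A weak solution of the stationary equation `H₀ u = w` that is `C²` is a classical solution
almost everywhere. -/
theorem ae_eq_of_weak_schrodinger (hO : IsOpen O) (m : Fin d → ℝ) {A : Cfg d → Cfg d}
    (hA : MemH1loc A) (hAC : ContDiffOn ℝ 1 A O) {V : Cfg d → Matrix (Fin k) (Fin k) ℂ}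
    (hVh : ∀ q ∈ O, (V q).IsHermitian) (hV : ∀ a b, MemL2loc O (fun q => V q a b))
    {u w : Cfg d → Spin k} (hu : ContDiffOn ℝ 2 u O) (hw : ContinuousOn w O)
    (hweak : ∀ φ : Cfg d → Spin k, ContDiff ℝ ∞ φ → HasCompactSupport φ → tsupport φ ⊆ O →
      ∫ q, inner ℂ (schrodingerExpr m A V φ q) (u q) = ∫ q, inner ℂ (φ q) (w q)) :
    ∀ᵐ q, q ∈ O → w q = (∑ j, -(1 / 2 * ((m j)⁻¹ : ℂ)) • magneticSqC A j u q) +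
      Matrix.toEuclideanLin (V q) (u q) := by
  have hAj : ∀ j, ContDiffOn ℝ 1 (fun q => A q j) O := fun j =>
    ((EuclideanSpace.proj j : Cfg d →L[ℝ] ℝ).contDiff.comp_contDiffOn hAC)
  have hAjC : ∀ j, ContDiffOn ℝ 1 (fun q => (A q j : ℂ)) O := fun j =>
    Complex.ofRealCLM.contDiff.comp_contDiffOn (hAj j)
  have hwp : ∀ᵐ q, q ∈ O → ∀ j, weakPartial j (fun x => A x j) q = pd j (fun x => A x j) q := by
    have := ae_all_iff.2 fun j => weakPartial_ae_eq_pd hO (hAj j)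
      (j := j) (((hA j).2 j).imp fun g hg => hg.1)
    filter_upwards [this] with q hq hqO j using sub_eq_zero.1 (hq j hqO)
  suffices hcomp : ∀ a, ∀ᵐ q, q ∈ O →
      (∑ j, -(1 / 2 * ((m j)⁻¹ : ℂ)) * magneticSqC A j (fun x => u x a) q) +
        Matrix.toEuclideanLin (V q) (u q) a - w q a = 0 by
    filter_upwards [ae_all_iff.2 hcomp] with q hq hqO
    ext a
    rw [← sub_eq_zero.1 (hq a hqO)]
    have h1 : ∀ x ∈ O, DifferentiableAt ℝ u x := fun x hx =>
      (hu.contDiffAt (hO.mem_nhds hx)).differentiableAt two_ne_zero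
    have h2 : ∀ j, DifferentiableAt ℝ (pd j u) q := fun j =>
      ((contDiffOn_pd hO hu (m := 1) (by norm_num) j).contDiffAt
        (hO.mem_nhds hqO)).differentiableAt one_ne_zero
    have h3 : ∀ j, pd j (fun x => u x a) =ᶠ[𝓝 q] fun x => pd j u x a := fun j => by
      filter_upwards [hO.mem_nhds hqO] with x hx using pd_apply (h1 x hx) j a
    have h4 : ∀ j, pd j (pd j fun x => u x a) q = pd j (pd j u) q a := fun j => by
      rw [← pd_apply (h2 j) j a, pd, (h3 j).fderiv_eq, pd]
    have hsum : (∑ j, -(1 / 2 * ((m j)⁻¹ : ℂ)) • magneticSqC A j u q) a =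
        ∑ j, (-(1 / 2 * ((m j)⁻¹ : ℂ)) • magneticSqC A j u q) a := by
      simp
    rw [PiLp.add_apply, hsum]
    congr 1
    refine Finset.sum_congr rfl fun j _ => ?_
    simp only [magneticSqC, h4, (h3 j).self_of_nhds, PiLp.smul_apply, PiLp.sub_apply]
    rfl
  intro a
  set f : Cfg d → ℂ := fun q => u q a with hf
  have hpr := ((EuclideanSpace.proj a : Spin k →L[ℂ] ℂ).restrictScalars ℝ).contDiff (n := 2)
  have hfC : ContDiffOn ℝ 2 f O := hpr.comp_contDiffOn hu
  have hf1 : ContDiffOn ℝ 1 f O := hfC.of_le one_le_two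
  have hpf : ∀ j, ContDiffOn ℝ 1 (pd j f) O := fun j => contDiffOn_pd hO hfC (by norm_num) j
  have hppf : ∀ j, ContinuousOn (pd j (pd j f)) O := fun j =>
    (contDiffOn_pd hO (hpf j) (m := 0) (by simp) j).continuousOn
  have hAf : ∀ j, ContDiffOn ℝ 1 (fun q => (A q j : ℂ) * f q) O := fun j => (hAjC j).mul hf1
  have hpA : ∀ j, ContinuousOn (fun q => ((pd j (fun x => A x j) q : ℝ) : ℂ)) O := fun j =>
    Complex.continuous_ofReal.comp_continuousOn
      (contDiffOn_pd hO (hAj j) (m := 0) (by simp) j).continuousOn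
  have hpAf : ∀ j, ∀ q ∈ O, pd j (fun q => (A q j : ℂ) * f q) q =
      ((pd j (fun x => A x j) q : ℝ) : ℂ) * f q + (A q j : ℂ) * pd j f q := by
    intro j q hq
    have h1 := ((hAj j).contDiffAt (hO.mem_nhds hq)).differentiableAt one_ne_zero
    have h2 := (hf1.contDiffAt (hO.mem_nhds hq)).differentiableAt one_ne_zero
    have h3 := (Complex.ofRealCLM.hasFDerivAt.comp q h1.hasFDerivAt).mul h2.hasFDerivAt
    have h4 : HasFDerivAt (fun q => (A q j : ℂ) * f q) _ q := h3
    rw [pd, h4.fderiv]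
    simp [pd]
    ring
  have hwa : ContinuousOn (fun q => w q a) O :=
    (EuclideanSpace.proj a : Spin k →L[ℂ] ℂ).continuous.comp_continuousOn hw
  have hVloc := locallyIntegrableOn_toEuclideanLin hO hV hu.continuousOn a
  have hmc : ∀ j, ContinuousOn (magneticSqC A j f) O := fun j => by
    refine (((hppf j).sub ((continuousOn_const.mul (hAjC j).continuousOn).smul
      (hpf j).continuousOn)).sub ((continuousOn_const.mul (hpA j)).smul hf1.continuousOn)).sub
      (((hAjC j).continuousOn.pow 2).smul hf1.continuousOn)
  have hsc : ContinuousOn (fun q => ∑ j, -(1 / 2 * ((m j)⁻¹ : ℂ)) * magneticSqC A j f q) O :=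
    continuousOn_finsetSum _ fun j _ => continuousOn_const.mul (hmc j)
  refine hO.ae_eq_zero_of_integral_contDiff_smul_eq_zero
    (((hsc.locallyIntegrableOn hO.measurableSet).add hVloc).sub
      (hwa.locallyIntegrableOn hO.measurableSet)) fun χ hχ hχc hχO => ?_
  set e : Spin k := EuclideanSpace.single a (1 : ℂ) with he
  have hφ := hweak (fun q => χ q • e) (hχ.smul contDiff_const) hχc.smul_right
    ((tsupport_smul_subset_left χ _).trans hχO)
  -- integrability of the terms
  have I1 := fun {g : Cfg d → ℂ} (hg : ContinuousOn g O) =>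
    integrable_smul_of_tsupport_subset hO hχ.continuous hχc hχO hg
  have I2 := fun (j) {g : Cfg d → ℂ} (hg : ContinuousOn g O) =>
    integrable_smul_of_tsupport_subset hO (contDiff_pd hχ j).continuous
      (hχc.of_isClosed_subset (isClosed_tsupport _) (tsupport_pd_subset χ j))
      ((tsupport_pd_subset χ j).trans hχO) hg
  have I3 := fun (j) {g : Cfg d → ℂ} (hg : ContinuousOn g O) =>
    integrable_smul_of_tsupport_subset hO (contDiff_pd (contDiff_pd hχ j) j).continuous
      (hχc.of_isClosed_subset (isClosed_tsupport _)
        ((tsupport_pd_subset _ j).trans (tsupport_pd_subset χ j)))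
      (((tsupport_pd_subset _ j).trans (tsupport_pd_subset χ j)).trans hχO) hg
  have IV : Integrable fun q => χ q • Matrix.toEuclideanLin (V q) (u q) a := by
    have h1 : IntegrableOn (fun q => χ q • Matrix.toEuclideanLin (V q) (u q) a) (tsupport χ) :=
      (hVloc.integrableOn_compact_subset hχO hχc.isCompact).continuousOn_smul
        hχ.continuous.continuousOn hχc.isCompact
    rwa [integrableOn_iff_integrable_of_support_subset] at h1
    exact (Function.support_smul_subset_left χ _).trans (subset_tsupport χ)
  -- rewriting both sides of the weak equation
  have hr : ∫ q, inner ℂ (χ q • e) (w q) = ∫ q, χ q • w q a := by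
    congr 1 with q
    rw [← Complex.coe_smul, inner_smul_left, he, EuclideanSpace.inner_single_left]
    simp
  have hl : ∫ q, inner ℂ (schrodingerExpr m A V (fun q => χ q • e) q) (u q) =
      ∫ q, ((∑ j, -(1 / 2 * ((m j)⁻¹ : ℂ)) * (pd j (pd j χ) q • f q
        + 2 * Complex.I * (pd j χ q • ((A q j : ℂ) * f q))
        + Complex.I * (χ q • (((pd j (fun x => A x j) q : ℝ) : ℂ) * f q))
        - χ q • ((A q j : ℂ) ^ 2 * f q))) + χ q • Matrix.toEuclideanLin (V q) (u q) a) := by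
    -- On `O` the weak derivative of `A` may be replaced by the classical one; off `O` the test
    -- function vanishes with all its derivatives.
    refine integral_congr_ae ?_
    filter_upwards [hwp] with q hq
    by_cases hqO : q ∈ O
    · rw [inner_schrodingerExpr_single (hVh q hqO) hχ]
      simp only [hq hqO, hf]
    · have z : ∀ g : Cfg d → ℝ, tsupport g ⊆ tsupport χ → g q = 0 := fun g hg =>
        image_eq_zero_of_notMem_tsupport fun h => hqO (hχO (hg h))
      have z1 := z χ subset_rfl
      have z2 := fun j => z (pd j χ) (tsupport_pd_subset χ j)
      have z3 := fun j => z (pd j (pd j χ))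
        ((tsupport_pd_subset _ j).trans (tsupport_pd_subset χ j))
      have hd : Differentiable ℝ χ := hχ.differentiable (by simp)
      have hd' : ∀ j, Differentiable ℝ (pd j χ) := fun j =>
        (contDiff_pd hχ j).differentiable (by simp)
      have hm : ∀ j, magneticSq A j (fun q => χ q • e) q = 0 := fun j => by
        rw [magneticSq, pd_smul_const hd, pd_smul_const (hd' j)]
        simp [z1, z2, z3]
      simp [schrodingerExpr, hm, z1, z2, z3]
  rw [hl, hr] at hφ
  have J1 : ∀ j, Integrable fun q => pd j (pd j χ) q • f q := fun j => I3 j hf1.continuousOn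
  have J2 : ∀ j, Integrable fun q => 2 * Complex.I * (pd j χ q • ((A q j : ℂ) * f q)) :=
    fun j => (I2 j (hAf j).continuousOn).const_mul (2 * Complex.I)
  have J3' : ∀ j, Integrable fun q => χ q • (((pd j (fun x => A x j) q : ℝ) : ℂ) * f q) :=
    fun j => I1 ((hpA j).mul hf1.continuousOn)
  have J3 : ∀ j, Integrable fun q =>
      Complex.I * (χ q • (((pd j (fun x => A x j) q : ℝ) : ℂ) * f q)) :=
    fun j => (J3' j).const_mul Complex.I
  have J4 : ∀ j, Integrable fun q => χ q • ((A q j : ℂ) ^ 2 * f q) :=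
    fun j => I1 (((hAjC j).continuousOn.pow 2).mul hf1.continuousOn)
  have J12 : ∀ j, Integrable fun q => pd j (pd j χ) q • f q
        + 2 * Complex.I * (pd j χ q • ((A q j : ℂ) * f q)) := fun j => (J1 j).add (J2 j)
  have J123 : ∀ j, Integrable fun q => pd j (pd j χ) q • f q
        + 2 * Complex.I * (pd j χ q • ((A q j : ℂ) * f q))
        + Complex.I * (χ q • (((pd j (fun x => A x j) q : ℝ) : ℂ) * f q)) :=
    fun j => (J12 j).add (J3 j)
  have JJ : ∀ j, Integrable fun q => -(1 / 2 * ((m j)⁻¹ : ℂ)) * (pd j (pd j χ) q • f q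
        + 2 * Complex.I * (pd j χ q • ((A q j : ℂ) * f q))
        + Complex.I * (χ q • (((pd j (fun x => A x j) q : ℝ) : ℂ) * f q))
        - χ q • ((A q j : ℂ) ^ 2 * f q)) := fun j => ((J123 j).sub (J4 j)).const_mul _
  have hint : ∫ q, ((∑ j, -(1 / 2 * ((m j)⁻¹ : ℂ)) * (pd j (pd j χ) q • f q
        + 2 * Complex.I * (pd j χ q • ((A q j : ℂ) * f q))
        + Complex.I * (χ q • (((pd j (fun x => A x j) q : ℝ) : ℂ) * f q))
        - χ q • ((A q j : ℂ) ^ 2 * f q))) + χ q • Matrix.toEuclideanLin (V q) (u q) a) =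
      ∑ j, -(1 / 2 * ((m j)⁻¹ : ℂ)) * (∫ q, χ q • magneticSqC A j f q) +
        ∫ q, χ q • Matrix.toEuclideanLin (V q) (u q) a := by
    rw [integral_add (integrable_finsetSum _ fun j _ => JJ j) IV,
      integral_finsetSum _ fun j _ => JJ j]
    congr 1
    refine Finset.sum_congr rfl fun j _ => ?_
    rw [integral_const_mul]
    congr 1
    -- The second-order term is integrated by parts twice, the term with `∂_j χ` times `A_j f` once.
    -- The latter contributes `-2i (∂_j A_j) f - 2i A_j ∂_j f`; with the `i (∂_j A_j) f` already
    -- present, exactly the terms of `magneticSqC` remain.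
    rw [integral_sub (J123 j) (J4 j),
      integral_add (J12 j) (J3 j), integral_add (J1 j) (J2 j), integral_const_mul,
      integral_const_mul, integral_pd_smul hO (contDiff_pd hχ j)
        (hχc.of_isClosed_subset (isClosed_tsupport _) (tsupport_pd_subset χ j))
        ((tsupport_pd_subset χ j).trans hχO) hf1 j,
      integral_pd_smul hO hχ hχc hχO (hpf j) j, integral_pd_smul hO hχ hχc hχO (hAf j) j, neg_neg]
    have e1 : ∫ q, χ q • pd j (fun q => (A q j : ℂ) * f q) q =
        ∫ q, (χ q • (((pd j (fun x => A x j) q : ℝ) : ℂ) * f q) + χ q • ((A q j : ℂ) * pd j f q)) := by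
      congr 1 with q
      by_cases hq : q ∈ O
      · rw [hpAf j q hq, smul_add]
      · simp [image_eq_zero_of_notMem_tsupport fun h => hq (hχO h)]
    have J5 : Integrable fun q => χ q • ((A q j : ℂ) * pd j f q) :=
      I1 ((hAjC j).continuousOn.mul (hpf j).continuousOn)
    have J6 : Integrable fun q => 2 * Complex.I * (χ q • ((A q j : ℂ) * pd j f q)) :=
      J5.const_mul _
    have J7 : Integrable fun q => χ q • pd j (pd j f) q := I1 (hppf j)
    have J67 : Integrable fun q => χ q • pd j (pd j f) q
        - 2 * Complex.I * (χ q • ((A q j : ℂ) * pd j f q)) := J7.sub J6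
    have J673 : Integrable fun q => χ q • pd j (pd j f) q
        - 2 * Complex.I * (χ q • ((A q j : ℂ) * pd j f q))
        - Complex.I * (χ q • (((pd j (fun x => A x j) q : ℝ) : ℂ) * f q)) := J67.sub (J3 j)
    have e2 : ∀ q, χ q • magneticSqC A j f q = χ q • pd j (pd j f) q
        - 2 * Complex.I * (χ q • ((A q j : ℂ) * pd j f q))
        - Complex.I * (χ q • (((pd j (fun x => A x j) q : ℝ) : ℂ) * f q))
        - χ q • ((A q j : ℂ) ^ 2 * f q) := by
      intro q
      simp only [magneticSqC, Complex.real_smul, smul_eq_mul]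
      ring
    simp_rw [e2]
    rw [e1, integral_add (J3' j) J5, integral_sub J673 (J4 j), integral_sub J67 (J3 j),
      integral_sub J7 J6, integral_const_mul, integral_const_mul]
    ring
  rw [hint] at hφ
  have hfinal : ∫ q, χ q • ((∑ j, -(1 / 2 * ((m j)⁻¹ : ℂ)) * magneticSqC A j f q) +
      Matrix.toEuclideanLin (V q) (u q) a - w q a) =
      ∑ j, -(1 / 2 * ((m j)⁻¹ : ℂ)) * (∫ q, χ q • magneticSqC A j f q) +
        (∫ q, χ q • Matrix.toEuclideanLin (V q) (u q) a) - ∫ q, χ q • w q a := by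
    have e3 : ∀ q, χ q • ((∑ j, -(1 / 2 * ((m j)⁻¹ : ℂ)) * magneticSqC A j f q) +
        Matrix.toEuclideanLin (V q) (u q) a - w q a) =
        (∑ j, -(1 / 2 * ((m j)⁻¹ : ℂ)) * (χ q • magneticSqC A j f q)) +
          χ q • Matrix.toEuclideanLin (V q) (u q) a - χ q • w q a := by
      intro q
      simp only [smul_sub, smul_add, Finset.smul_sum, mul_smul_comm]
    have J8 : ∀ j, Integrable fun q => -(1 / 2 * ((m j)⁻¹ : ℂ)) * (χ q • magneticSqC A j f q) :=
      fun j => (I1 (hmc j)).const_mul _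
    have J9 : Integrable fun q =>
        ∑ j, -(1 / 2 * ((m j)⁻¹ : ℂ)) * (χ q • magneticSqC A j f q) :=
      integrable_finsetSum _ fun j _ => J8 j
    have J10 : Integrable fun q => (∑ j, -(1 / 2 * ((m j)⁻¹ : ℂ)) * (χ q • magneticSqC A j f q)) +
        χ q • Matrix.toEuclideanLin (V q) (u q) a := J9.add IV
    simp_rw [e3]
    rw [integral_sub J10 (I1 hwa), integral_add J9 IV, integral_finsetSum _ fun j _ => J8 j]
    simp_rw [integral_const_mul]
  rw [hfinal, hφ, sub_self]

/-! ### The continuity equation for |ψ|² -/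

/-- The wave function as a function on space-time. -/
def wave {d k : ℕ} (ψ : ℝ → Cfg d → Spin k) (p : ℝ × Cfg d) : Spin k := ψ p.1 p.2

/-- The space-time region above `Ω` where the wave function does not vanish. -/
def nonNodal {d k : ℕ} (ψ : ℝ → Cfg d → Spin k) (Ω : Set (Cfg d)) : Set (ℝ × Cfg d) :=
  {p | p.2 ∈ Ω ∧ wave ψ p ≠ 0}

section WaveFunction

variable {d k : ℕ} {ψ : ℝ → Cfg d → Spin k} {Ω : Set (Cfg d)} {t : ℝ} {q : Cfg d}

lemma isOpen_nonNodal (hΩ : IsOpen Ω) (hc : ContinuousOn (wave ψ) (univ ×ˢ Ω)) :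
    IsOpen (nonNodal ψ Ω) := by
  have := hc.isOpen_inter_preimage (isOpen_univ.prod hΩ) (isOpen_compl_singleton (x := 0))
  convert this using 1
  ext p
  simp [nonNodal]

lemma isOpen_image_nonNodal (hΩ : IsOpen Ω) (hc : ContinuousOn (wave ψ) (univ ×ˢ Ω)) :
    IsOpen {q ∈ Ω | ∃ t, ψ t q ≠ 0} := by
  convert isOpenMap_snd _ (isOpen_nonNodal hΩ hc) using 1
  ext q
  simp [nonNodal, wave]

lemma differentiableAt_wave (hΩ : IsOpen Ω) (h : ContDiffOn ℝ 2 (wave ψ) (univ ×ˢ Ω)) (hq : q ∈ Ω) :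
    DifferentiableAt ℝ (wave ψ) (t, q) :=
  (h.contDiffAt ((isOpen_univ.prod hΩ).mem_nhds ⟨mem_univ _, hq⟩)).differentiableAt two_ne_zero

lemma pd_slice {F : Type*} [NormedAddCommGroup F] [NormedSpace ℝ F] {f : ℝ × Cfg d → F}
    (h : DifferentiableAt ℝ f (t, q)) (j : Fin d) :
    pd j (fun x => f (t, x)) q = fderiv ℝ f (t, q) (0, unitVec j) := by
  have h1 : HasFDerivAt (fun x : Cfg d => (t, x)) (ContinuousLinearMap.inr ℝ ℝ (Cfg d)) q :=
    hasFDerivAt_prodMk_right t q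
  have h2 : HasFDerivAt (fun x => f (t, x)) _ q := h.hasFDerivAt.comp q h1
  rw [pd, h2.fderiv]
  rfl

lemma hasDerivAt_wave (hΩ : IsOpen Ω) (h : ContDiffOn ℝ 2 (wave ψ) (univ ×ˢ Ω)) (hq : q ∈ Ω) :
    HasDerivAt (fun s => ψ s q) (fderiv ℝ (wave ψ) (t, q) (1, 0)) t :=
  (differentiableAt_wave hΩ h hq).hasFDerivAt.comp_hasDerivAt (f := fun s => (s, q)) t
    ((hasDerivAt_id t).prodMk (hasDerivAt_const t q))

lemma contDiffOn_fderiv_wave (hΩ : IsOpen Ω) (h : ContDiffOn ℝ 2 (wave ψ) (univ ×ˢ Ω))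
    (w : ℝ × Cfg d) : ContDiffOn ℝ 1 (fun p => fderiv ℝ (wave ψ) p w) (univ ×ˢ Ω) :=
  (h.fderiv_of_isOpen (isOpen_univ.prod hΩ) (by norm_num)).clm_apply contDiffOn_const

lemma contDiffOn_slice (h : ContDiffOn ℝ 2 (wave ψ) (univ ×ˢ Ω)) (t : ℝ) :
    ContDiffOn ℝ 2 (ψ t) Ω :=
  h.comp (contDiff_prodMk_right t).contDiffOn fun _ hq => ⟨mem_univ _, hq⟩

/-- The wave function satisfies the Schrödinger equation pointwise almost everywhere on
`{q ∈ Ω | ψ(t,q) ≠ 0 for some t}`. -/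
theorem schrodinger_eq_ae (hΩ : IsOpen Ω) (m : Fin d → ℝ) {A : Cfg d → Cfg d} (hA : MemH1loc A)
    {V : Cfg d → Matrix (Fin k) (Fin k) ℂ} (hVh : ∀ q ∈ Ω, (V q).IsHermitian)
    (hV : ∀ a b, MemL2loc Ω (fun q => V q a b))
    {H : L2 d k →ₗ.[ℂ] L2 d k} (hH : IsSelfAdjoint H) (hext : ExtendsSchrodinger m A V Ω H)
    {U : ℝ → L2 d k ≃ₗᵢ[ℂ] L2 d k} (hU : IsUnitaryGroupOf H U) {f g : L2 d k}
    (hfg : (f, g) ∈ H.graph) (hψ : ∀ t, ψ t =ᵐ[volume] U t f)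
    (hC : ContDiffOn ℝ 2 (wave ψ) (univ ×ˢ Ω))
    (hAC : ContDiffOn ℝ 1 A {q ∈ Ω | ∃ t, ψ t q ≠ 0}) (t : ℝ) :
    ∀ᵐ q, q ∈ {q ∈ Ω | ∃ t, ψ t q ≠ 0} → Complex.I • fderiv ℝ (wave ψ) (t, q) (1, 0) =
      (∑ j, -(1 / 2 * ((m j)⁻¹ : ℂ)) • magneticSqC A j (ψ t) q)
        + Matrix.toEuclideanLin (V q) (ψ t q) := by
  have hO := isOpen_image_nonNodal hΩ hC.continuousOn
  have hsub : {q ∈ Ω | ∃ t, ψ t q ≠ 0} ⊆ Ω := fun q hq => hq.1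
  have hder := ae_eq_of_hasDerivAt_L2 (hU.hasDerivAt hfg t) hψ
    (fun q hq => hasDerivAt_wave (t := t) hΩ hC hq)
  refine ae_eq_of_weak_schrodinger (w := fun q => Complex.I • fderiv ℝ (wave ψ) (t, q) (1, 0)) hO m
    hA hAC (fun q hq => hVh q hq.1)
    (fun a b K hK hKc => hV a b K (hK.trans hsub) hKc) ((contDiffOn_slice hC t).mono hsub) ?_ ?_
  · exact (((contDiffOn_fderiv_wave hΩ hC (1, 0)).continuousOn.comp
      (Continuous.prodMk_right t).continuousOn (s := {q ∈ Ω | ∃ t, ψ t q ≠ 0})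
      fun q hq => ⟨mem_univ _, hsub hq⟩).const_smul Complex.I)
  · intro φ hφ hφc hφO
    obtain ⟨a, b, hab, ha, hb⟩ := hext φ hφ hφc (hφO.trans hsub)
    have h1 := inner_eq_inner_of_mem_graph hH (hU.map_mem_graph hfg t) hab
    rw [L2.inner_def, L2.inner_def] at h1
    have e1 : ∫ q, inner ℂ (schrodingerExpr m A V φ q) (ψ t q) = ∫ q, inner ℂ (b q) (U t f q) := by
      refine integral_congr_ae ?_
      filter_upwards [hb, hψ t] with q h1 h2
      rw [h1, h2]
    have e2 : ∫ q, inner ℂ (φ q) (Complex.I • fderiv ℝ (wave ψ) (t, q) (1, 0)) =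
        ∫ q, inner ℂ (a q) (U t g q) := by
      refine integral_congr_ae ?_
      filter_upwards [ha, hder, Lp.coeFn_neg (Complex.I • U t g),
        Lp.coeFn_smul Complex.I (U t g)] with q h1 h2 h3 h4
      rw [h1]
      by_cases hq : φ q = 0
      · simp [hq]
      · rw [h2 (hφO (subset_tsupport φ hq)).1, h3, Pi.neg_apply, h4, Pi.smul_apply, smul_neg,
          smul_smul, Complex.I_mul_I, neg_one_smul, neg_neg]
    rw [e1, e2]
    exact h1

lemma inner_toEuclideanLin_self_im {M : Matrix (Fin k) (Fin k) ℂ} (hM : M.IsHermitian)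
    (u : Spin k) : (inner ℂ u (Matrix.toEuclideanLin M u)).im = 0 := by
  have h := (Matrix.isSymmetric_toEuclideanLin_iff.2 hM) u u
  have h2 := inner_conj_symm (𝕜 := ℂ) u (Matrix.toEuclideanLin M u)
  rw [h] at h2
  exact Complex.conj_eq_iff_im.1 h2

/-- The divergence of the probability current, up to the factor `1 / m_j`. -/
noncomputable def currentDivergence (A : Cfg d → Cfg d) (u : Cfg d → Spin k) (j : Fin d)
    (q : Cfg d) : ℝ :=
  (inner ℂ (u q) (pd j (pd j u) q)).im - 2 * A q j * (inner ℂ (u q) (pd j u q)).re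
    - pd j (fun x => A x j) q * ‖u q‖ ^ 2

lemma inner_magneticSqC_im (A : Cfg d → Cfg d) (u : Cfg d → Spin k) (j : Fin d) (q : Cfg d) :
    (inner ℂ (u q) (magneticSqC A j u q)).im = currentDivergence A u j q := by
  have e : ((A q j : ℂ) ^ 2) = ((A q j ^ 2 : ℝ) : ℂ) := by push_cast; rfl
  simp only [magneticSqC, currentDivergence, inner_sub_right, inner_smul_right, e,
    inner_self_eq_norm_sq_to_K, Complex.sub_im, ← Complex.ofReal_pow, Complex.coe_algebraMap,
    ← Complex.ofReal_mul, Complex.ofReal_im]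
  simp
  exact Or.inl (by norm_cast)

/-- Pairing with `u` and taking imaginary parts removes the Hermitian matrix, whose expectation
value is real. -/
lemma re_inner_add_currentDivergence {m : Fin d → ℝ} {A : Cfg d → Cfg d}
    {M : Matrix (Fin k) (Fin k) ℂ} (hM : M.IsHermitian) {u : Cfg d → Spin k} {w : Spin k}
    (h : Complex.I • w = (∑ j, -(1 / 2 * ((m j)⁻¹ : ℂ)) • magneticSqC A j u q)
      + Matrix.toEuclideanLin M (u q)) :
    2 * (inner ℂ (u q) w).re + ∑ j, (m j)⁻¹ * currentDivergence A u j q = 0 := by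
  have h1 := congrArg (fun z => (inner ℂ (u q) z).im) h
  have e : ∀ j, (inner ℂ (u q) (-(1 / 2 * ((m j)⁻¹ : ℂ)) • magneticSqC A j u q)).im =
      -(1 / 2) * ((m j)⁻¹ * currentDivergence A u j q) := fun j => by
    rw [← inner_magneticSqC_im, inner_smul_right,
      show (-(1 / 2 * ((m j)⁻¹ : ℂ))) = ((-(1 / 2 * (m j)⁻¹) : ℝ) : ℂ) by push_cast; rfl,
      Complex.im_ofReal_mul]
    ring
  simp only [inner_add_right, inner_sum, Complex.add_im, inner_toEuclideanLin_self_im hM,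
    Complex.im_sum, e, ← Finset.mul_sum] at h1
  simp only [inner_smul_right, Complex.mul_im, Complex.I_re, Complex.I_im] at h1
  linarith

/-- The probability density `|ψ|²`. -/
noncomputable def density (ψ : ℝ → Cfg d → Spin k) (p : ℝ × Cfg d) : ℝ := ‖wave ψ p‖ ^ 2

/-- The probability current. -/
noncomputable def current (m : Fin d → ℝ) (A : Cfg d → Cfg d) (ψ : ℝ → Cfg d → Spin k)
    (p : ℝ × Cfg d) : Cfg d :=
  WithLp.toLp 2 fun j => (m j)⁻¹ *
    ((inner ℂ (wave ψ p) (fderiv ℝ (wave ψ) p (0, unitVec j))).im - A p.2 j * density ψ p)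

lemma fderiv_density (hu : DifferentiableAt ℝ (wave ψ) (t, q)) (v : ℝ × Cfg d) :
    fderiv ℝ (density ψ) (t, q) v =
      2 * (inner ℂ (ψ t q) (fderiv ℝ (wave ψ) (t, q) v)).re := by
  have e : density ψ = fun p => Complex.reCLM (inner ℂ (wave ψ p) (wave ψ p)) := by
    ext p
    exact (inner_self_eq_norm_sq (𝕜 := ℂ) (wave ψ p)).symm
  have h1 := Complex.reCLM.hasFDerivAt.comp (t, q) (hu.inner ℂ hu).hasFDerivAt
  have h2 : HasFDerivAt (fun p => Complex.reCLM (inner ℂ (wave ψ p) (wave ψ p))) _ (t, q) := h1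
  rw [← e] at h2
  rw [h2.fderiv, ContinuousLinearMap.comp_apply, fderiv_inner_apply ℂ hu hu]
  have := inner_re_symm (𝕜 := ℂ) (fderiv ℝ (wave ψ) (t, q) v) (wave ψ (t, q))
  simp only [RCLike.re_to_complex] at this
  simp only [Complex.reCLM_apply, Complex.add_re, this]
  rw [wave]
  ring

lemma pd_pd_slice (hΩ : IsOpen Ω) (h : ContDiffOn ℝ 2 (wave ψ) (univ ×ˢ Ω)) (hq : q ∈ Ω)
    (j : Fin d) : pd j (fun x => fderiv ℝ (wave ψ) (t, x) (0, unitVec j)) q =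
      pd j (pd j (ψ t)) q := by
  have : (fun x => fderiv ℝ (wave ψ) (t, x) (0, unitVec j)) =ᶠ[𝓝 q] pd j (ψ t) := by
    filter_upwards [hΩ.mem_nhds hq] with x hx
    exact (pd_slice (differentiableAt_wave hΩ h hx) j).symm
  rw [pd, this.fderiv_eq, pd]

/-- In the divergence of the current the terms `⟨∂_j ψ, ∂_j ψ⟩` are real and drop out of the
imaginary part, which leaves `currentDivergence`. -/
lemma continuityEqAt_current (hΩ : IsOpen Ω) {m : Fin d → ℝ} {A : Cfg d → Cfg d}
    (hC : ContDiffOn ℝ 2 (wave ψ) (univ ×ˢ Ω)) (hq : q ∈ Ω) (hA : DifferentiableAt ℝ A q)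
    (h : 2 * (inner ℂ (ψ t q) (fderiv ℝ (wave ψ) (t, q) (1, 0))).re
      + ∑ j, (m j)⁻¹ * currentDivergence A (ψ t) j q = 0) :
    ContinuityEqAt (density ψ) (current m A ψ) (t, q) := by
  have hu := differentiableAt_wave (t := t) hΩ hC hq
  have hre := fun v => fderiv_density hu v
  have hdens : DifferentiableAt ℝ (density ψ) (t, q) := hu.norm_sq ℂ
  have hder : ∀ j, DifferentiableAt ℝ (fun p => fderiv ℝ (wave ψ) p (0, unitVec j)) (t, q) :=
    fun j => ((contDiffOn_fderiv_wave hΩ hC _).contDiffAt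
      ((isOpen_univ.prod hΩ).mem_nhds ⟨mem_univ _, hq⟩)).differentiableAt one_ne_zero
  have hinn : ∀ j, DifferentiableAt ℝ
      (fun p => (inner ℂ (wave ψ p) (fderiv ℝ (wave ψ) p (0, unitVec j))).im) (t, q) := fun j =>
    (Complex.imCLM.differentiableAt.comp (t, q) (hu.inner ℂ (hder j)))
  have hAj : ∀ j, HasFDerivAt (fun x => A x j) (fderiv ℝ (fun x => A x j) q) q := fun j =>
    ((EuclideanSpace.proj (𝕜 := ℝ) j).differentiableAt.comp q hA).hasFDerivAt
  have hAp : ∀ j, HasFDerivAt (fun p : ℝ × Cfg d => A p.2 j)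
      ((fderiv ℝ (fun x => A x j) q).comp (ContinuousLinearMap.snd ℝ ℝ (Cfg d))) (t, q) := fun j =>
    HasFDerivAt.comp (g := fun x => A x j) (f := Prod.snd) (t, q) (hAj j) hasFDerivAt_snd
  have hdiv : ∀ j, fderiv ℝ (fun p => current m A ψ p j) (t, q) (0, unitVec j) =
      (m j)⁻¹ * currentDivergence A (ψ t) j q := fun j => by
    have h1 : HasFDerivAt (fun p => current m A ψ p j) _ (t, q) :=
      (((hinn j).hasFDerivAt.sub ((hAp j).mul hdens.hasFDerivAt)).const_mul (m j)⁻¹)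
    have h2 : fderiv ℝ (fun p => (inner ℂ (wave ψ p) (fderiv ℝ (wave ψ) p (0, unitVec j))).im)
        (t, q) (0, unitVec j) = (inner ℂ (ψ t q) (pd j (pd j (ψ t)) q)).im := by
      have h3 := Complex.imCLM.hasFDerivAt.comp (t, q) (hu.inner ℂ (hder j)).hasFDerivAt
      have h4 : HasFDerivAt
        (fun p => (inner ℂ (wave ψ p) (fderiv ℝ (wave ψ) p (0, unitVec j))).im) _ (t, q) := h3
      rw [h4.fderiv, ContinuousLinearMap.comp_apply, fderiv_inner_apply ℂ hu (hder j),
        ← pd_slice (hder j), pd_pd_slice hΩ hC hq]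
      have := inner_self_im (𝕜 := ℂ) (fderiv ℝ (wave ψ) (t, q) (0, unitVec j))
      simp only [RCLike.im_to_complex] at this
      simp only [Complex.imCLM_apply, Complex.add_im, this, add_zero]
      rfl
    rw [h1.fderiv]
    simp only [smul_apply, sub_apply,
      add_apply, ContinuousLinearMap.comp_apply, ContinuousLinearMap.coe_snd',
      smul_eq_mul, h2, hre, ← pd_slice hu j]
    simp only [currentDivergence, density, pd, wave]
    ring
  rw [ContinuityEqAt, hre, Finset.sum_congr rfl fun j _ => hdiv j]
  exact h

/-- The density cancels the denominator of the velocity, and `Im ⟨ψ, i A_j ψ⟩ = A_j |ψ|²`. The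
current involves no quotient and is therefore the convenient object to differentiate. -/
lemma density_smul_velocity (hΩ : IsOpen Ω) {m : Fin d → ℝ} {A : Cfg d → Cfg d}
    (hC : ContDiffOn ℝ 2 (wave ψ) (univ ×ˢ Ω)) {p : ℝ × Cfg d} (hp : p ∈ nonNodal ψ Ω) :
    density ψ p • velocity m A ψ p.1 p.2 = current m A ψ p := by
  obtain ⟨t, q⟩ := p
  ext j
  have h0 : ‖ψ t q‖ ≠ 0 := norm_ne_zero_iff.2 hp.2
  have e : inner ℂ (ψ t q) (ψ t q) = ((‖ψ t q‖ ^ 2 : ℝ) : ℂ) := by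
    rw [inner_self_eq_norm_sq_to_K]; push_cast; rfl
  have e2 : pd j (ψ t) q = fderiv ℝ (wave ψ) (t, q) (0, unitVec j) :=
    pd_slice (differentiableAt_wave hΩ hC hp.1) j
  simp only [PiLp.smul_apply, velocity, current, density, wave, smul_eq_mul, e, ← e2,
    inner_sub_right, inner_smul_right, Complex.div_ofReal_im, Complex.sub_im, mul_assoc]
  rw [← Complex.ofReal_mul, Complex.I_mul_im, Complex.ofReal_re]
  field_simp

/-- The velocity field as a function on space-time. -/
noncomputable def velocityField (m : Fin d → ℝ) (A : Cfg d → Cfg d) (ψ : ℝ → Cfg d → Spin k)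
    (p : ℝ × Cfg d) : Cfg d := velocity m A ψ p.1 p.2

/-- The continuity equation for the Bohmian velocity field. -/
theorem continuityEqAt_velocityField (hΩ : IsOpen Ω) {m : Fin d → ℝ} {A : Cfg d → Cfg d}
    {V : Cfg d → Matrix (Fin k) (Fin k) ℂ} (hVh : ∀ q ∈ Ω, (V q).IsHermitian)
    (hC : ContDiffOn ℝ 2 (wave ψ) (univ ×ˢ Ω))
    (hAC : ContDiffOn ℝ 1 A {q ∈ Ω | ∃ t, ψ t q ≠ 0})
    (hS : ∀ t, ∀ᵐ q, q ∈ {q ∈ Ω | ∃ t, ψ t q ≠ 0} →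
      Complex.I • fderiv ℝ (wave ψ) (t, q) (1, 0) =
        (∑ j, -(1 / 2 * ((m j)⁻¹ : ℂ)) • magneticSqC A j (ψ t) q)
        + Matrix.toEuclideanLin (V q) (ψ t q))
    {p : ℝ × Cfg d} (hp : p ∈ nonNodal ψ Ω) :
    ContinuityEqAt (density ψ) (fun p => density ψ p • velocityField m A ψ p) p := by
  obtain ⟨t, q⟩ := p
  set O := {q ∈ Ω | ∃ t, ψ t q ≠ 0} with hOdef
  have hO : IsOpen O := isOpen_image_nonNodal hΩ hC.continuousOn
  have hsub : O ⊆ Ω := fun q hq => hq.1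
  have hqO : q ∈ O := ⟨hp.1, t, hp.2⟩
  have hut := (contDiffOn_slice hC t).mono hsub
  have c0 : ContinuousOn (ψ t) O := hut.continuousOn
  have c1 : ∀ j, ContDiffOn ℝ 1 (pd j (ψ t)) O := fun j => contDiffOn_pd hO hut (by norm_num) j
  have c2 : ∀ j, ContinuousOn (pd j (pd j (ψ t))) O := fun j =>
    (contDiffOn_pd hO (c1 j) (m := 0) (by simp) j).continuousOn
  have cA : ∀ j, ContDiffOn ℝ 1 (fun x => A x j) O := fun j =>
    (EuclideanSpace.proj (𝕜 := ℝ) j).contDiff.comp_contDiffOn hAC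
  have cA' : ∀ j, ContinuousOn (pd j fun x => A x j) O := fun j =>
    (contDiffOn_pd hO (cA j) (m := 0) (by simp) j).continuousOn
  have ct : ContinuousOn (fun q => fderiv ℝ (wave ψ) (t, q) (1, 0)) O :=
    (contDiffOn_fderiv_wave hΩ hC (1, 0)).continuousOn.comp
      (Continuous.prodMk_right t).continuousOn fun q hq => ⟨mem_univ _, hsub hq⟩
  have hG : EqOn (fun q => 2 * (inner ℂ (ψ t q) (fderiv ℝ (wave ψ) (t, q) (1, 0))).re
      + ∑ j, (m j)⁻¹ * currentDivergence A (ψ t) j q) (fun _ => 0) O := by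
    -- The Schrödinger equation holds only almost everywhere because of `V`. Here `V` has cancelled
    -- and the remaining terms are continuous on `O`, so the identity holds at every point of `O`.
    refine Measure.eqOn_open_of_ae_eq (μ := volume) ?_ hO ?_ continuousOn_const
    · rw [EventuallyEq, ae_restrict_iff' hO.measurableSet]
      filter_upwards [hS t] with x hx hxO
      exact re_inner_add_currentDivergence (hVh x (hsub hxO)) (hx hxO)
    · refine (continuousOn_const.mul
        (Complex.continuous_re.comp_continuousOn (c0.inner (𝕜 := ℂ) ct))).add
        (continuousOn_finsetSum _ fun j _ => continuousOn_const.mul (((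
          Complex.continuous_im.comp_continuousOn (c0.inner (𝕜 := ℂ) (c2 j))).sub
          ((continuousOn_const.mul (cA j).continuousOn).mul
          (Complex.continuous_re.comp_continuousOn
            (c0.inner (𝕜 := ℂ) (c1 j).continuousOn)))).sub
          ((cA' j).mul (c0.norm.pow 2))))
  refine ContinuityEqAt.congr (continuityEqAt_current hΩ hC hp.1
    ((hAC.contDiffAt (hO.mem_nhds hqO)).differentiableAt one_ne_zero) (hG hqO))
    EventuallyEq.rfl ?_
  filter_upwards [(isOpen_nonNodal hΩ hC.continuousOn).mem_nhds hp] with p hp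
  exact density_smul_velocity hΩ hC hp

end WaveFunction

/-! ### Hardy's inequality in codimension three -/

/-- The squared distance from the affine subspace through `c` orthogonal to the orthonormal
vectors `b i`. -/
noncomputable def distSq {d : ℕ} (b : Fin 3 → Cfg d) (c x : Cfg d) : ℝ :=
  ∑ i, (inner ℝ (b i) (x - c)) ^ 2

section Hardy

variable {d k : ℕ} {b : Fin 3 → Cfg d} {c : Cfg d} {u : Cfg d → Spin k} {Ω : Set (Cfg d)}

lemma distSq_nonneg (b : Fin 3 → Cfg d) (c x : Cfg d) : 0 ≤ distSq b c x :=
  Finset.sum_nonneg fun _ _ => sq_nonneg _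

lemma contDiff_distSq (b : Fin 3 → Cfg d) (c : Cfg d) {n : WithTop ℕ∞} :
    ContDiff ℝ n (distSq b c) :=
  ContDiff.sum fun _ _ => (contDiff_const.inner ℝ (contDiff_id.sub contDiff_const)).pow 2

lemma hasDerivAt_norm_sq_spin {γ : ℝ → Spin k} {γ' : Spin k} {s : ℝ} (h : HasDerivAt γ γ' s) :
    HasDerivAt (fun s => ‖γ s‖ ^ 2) (2 * (inner ℂ (γ s) γ').re) s := by
  have h1 := Complex.reCLM.hasFDerivAt.comp_hasDerivAt s (h.inner ℂ h)
  have e : (Complex.reCLM ∘ fun s => inner ℂ (γ s) (γ s)) = fun s => ‖γ s‖ ^ 2 := by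
    ext p
    exact inner_self_eq_norm_sq (𝕜 := ℂ) (γ p)
  rw [e] at h1
  refine h1.congr_deriv ?_
  have := inner_re_symm (𝕜 := ℂ) γ' (γ s)
  simp only [RCLike.re_to_complex] at this
  simp only [Complex.reCLM_apply, Complex.add_re, this]
  ring

/-- The component `⟨b_i, x - c⟩ / (r² + ε)` of the regularized Hardy vector field. -/
noncomputable def hardyField (b : Fin 3 → Cfg d) (c : Cfg d) (ε : ℝ) (i : Fin 3) (x : Cfg d) : ℝ :=
  inner ℝ (b i) (x - c) / (distSq b c x + ε)

/-- The derivative of the component `i` of the Hardy vector field in the direction `b i`. -/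
noncomputable def hardyFieldDeriv (b : Fin 3 → Cfg d) (c : Cfg d) (ε : ℝ) (i : Fin 3)
    (x : Cfg d) : ℝ :=
  1 / (distSq b c x + ε) - 2 * hardyField b c ε i x ^ 2

lemma continuous_hardyField (b : Fin 3 → Cfg d) (c : Cfg d) {ε : ℝ} (hε : 0 < ε) (i : Fin 3) :
    Continuous (hardyField b c ε i) :=
  (continuous_const.inner (continuous_id.sub continuous_const)).div
    ((contDiff_distSq b c (n := 0)).continuous.add continuous_const) fun x =>
      (add_pos_of_nonneg_of_pos (distSq_nonneg b c x) hε).ne'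

lemma continuous_hardyFieldDeriv (b : Fin 3 → Cfg d) (c : Cfg d) {ε : ℝ} (hε : 0 < ε) (i : Fin 3) :
    Continuous (hardyFieldDeriv b c ε i) :=
  (continuous_const.div ((contDiff_distSq b c (n := 0)).continuous.add continuous_const) fun x =>
      (add_pos_of_nonneg_of_pos (distSq_nonneg b c x) hε).ne').sub
    (continuous_const.mul ((continuous_hardyField b c hε i).pow 2))

lemma hasDerivAt_hardyField (hb : Orthonormal ℝ b) {ε : ℝ} (hε : 0 < ε) (i : Fin 3) (x : Cfg d) :
    HasDerivAt (fun s : ℝ => hardyField b c ε i (x + s • b i)) (hardyFieldDeriv b c ε i x) 0 := by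
  have hpos := (add_pos_of_nonneg_of_pos (distSq_nonneg b c x) hε).ne'
  have h1 : ∀ l, HasDerivAt (fun s : ℝ => inner ℝ (b l) (x + s • b i - c))
      (if l = i then 1 else 0) 0 := fun l => by
    have h2 := orthonormal_iff_ite.1 hb l i
    have h3 : ∀ s : ℝ, inner ℝ (b l) (x + s • b i - c) =
        inner ℝ (b l) (x - c) + s * (if l = i then 1 else 0) := fun s => by
      rw [add_sub_right_comm, inner_add_right, inner_smul_right, h2]
    simp_rw [h3]
    simpa only [one_mul, id] using ((hasDerivAt_id (0 : ℝ)).mul_const _).const_add _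
  have h4 : HasDerivAt (fun s : ℝ => distSq b c (x + s • b i)) (2 * inner ℝ (b i) (x - c)) 0 := by
    have := HasDerivAt.fun_sum (u := Finset.univ) fun l _ => (h1 l).fun_pow 2
    refine this.congr_deriv ?_
    simp
  have h5 := (h1 i).fun_div (h4.add_const ε) (by simpa using hpos)
  refine h5.congr_deriv ?_
  simp only [hardyFieldDeriv, hardyField, if_true, zero_smul, add_zero]
  field_simp

/-- With `r² = distSq b c x`, the sum equals `r² / (r² + ε)²`. -/
lemma sum_hardyField_sq_le (b : Fin 3 → Cfg d) (c : Cfg d) {ε : ℝ} (hε : 0 < ε) (x : Cfg d) :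
    ∑ i, hardyField b c ε i x ^ 2 ≤ 1 / (distSq b c x + ε) := by
  have h0 := distSq_nonneg b c x
  have : ∑ i, hardyField b c ε i x ^ 2 = distSq b c x / (distSq b c x + ε) ^ 2 := by
    simp [hardyField, div_pow, ← Finset.sum_div, distSq]
  rw [this, div_le_div_iff₀ (by positivity) (by positivity)]
  nlinarith

/-- A crude bound, degenerate as `ε → 0`; it serves only to make the integrals converge. -/
lemma abs_hardyField_le {ε : ℝ} (hε : 0 < ε) (i : Fin 3) (x : Cfg d) :
    |hardyField b c ε i x| ≤ 1 + 1 / ε := by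
  have h1 := (Finset.single_le_sum (f := fun i => hardyField b c ε i x ^ 2)
    (fun i _ => sq_nonneg _) (Finset.mem_univ i)).trans (sum_hardyField_sq_le b c hε x)
  have h2 : 1 / (distSq b c x + ε) ≤ 1 / ε :=
    one_div_le_one_div_of_le hε (le_add_of_nonneg_left (distSq_nonneg b c x))
  have : |hardyField b c ε i x| ^ 2 ≤ 1 / ε := by rw [sq_abs]; exact h1.trans h2
  nlinarith [sq_nonneg (|hardyField b c ε i x| - 1), abs_nonneg (hardyField b c ε i x)]

lemma abs_hardyFieldDeriv_le {ε : ℝ} (hε : 0 < ε) (i : Fin 3) (x : Cfg d) :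
    |hardyFieldDeriv b c ε i x| ≤ 2 / ε := by
  have h1 := (Finset.single_le_sum (f := fun i => hardyField b c ε i x ^ 2)
    (fun i _ => sq_nonneg _) (Finset.mem_univ i)).trans (sum_hardyField_sq_le b c hε x)
  have h2 : 1 / (distSq b c x + ε) ≤ 1 / ε :=
    one_div_le_one_div_of_le hε (le_add_of_nonneg_left (distSq_nonneg b c x))
  have h3 := sq_nonneg (hardyField b c ε i x)
  have h4 : 0 < 1 / (distSq b c x + ε) :=
    one_div_pos.2 (add_pos_of_nonneg_of_pos (distSq_nonneg b c x) hε)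
  have e : 2 / ε = 2 * (1 / ε) := by ring
  rw [hardyFieldDeriv, e, abs_le]
  constructor <;> nlinarith

/-- **Hardy's inequality** in codimension three, with regularized weight. -/
lemma integral_div_distSq_add_le (hΩ : IsOpen Ω)
    (hN : ∀ v : Cfg d, ∀ᵐ x : Cfg d, ∀ s : ℝ, x + s • v ∉ Ωᶜ) (hb : Orthonormal ℝ b)
    (hu : ContDiffOn ℝ 1 u Ω) (hu2 : MemLp u 2 volume)
    (hdu : ∀ i, MemLp (fun q => fderiv ℝ u q (b i)) 2 volume) {ε : ℝ} (hε : 0 < ε) :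
    Integrable (fun q => ‖u q‖ ^ 2 / (distSq b c q + ε)) ∧
    ∫ q, ‖u q‖ ^ 2 / (distSq b c q + ε) ≤ 4 * ∫ q, ∑ i, ‖fderiv ℝ u q (b i)‖ ^ 2 := by
  have I1 : Integrable (fun q => ‖u q‖ ^ 2) := hu2.integrable_norm_pow two_ne_zero
  have I2 : ∀ i, Integrable (fun q => ‖fderiv ℝ u q (b i)‖ ^ 2) := fun i =>
    (hdu i).integrable_norm_pow two_ne_zero
  have I3 : ∀ i, Integrable (fun q => ‖u q‖ ^ 2 * hardyField b c ε i q) := fun i => by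
    refine I1.mul_bdd (c := 1 + 1 / ε) (continuous_hardyField b c hε i).aestronglyMeasurable ?_
    exact Eventually.of_forall fun x => abs_hardyField_le hε i x
  have I4 : ∀ i, Integrable (fun q => ‖u q‖ ^ 2 * hardyFieldDeriv b c ε i q) := fun i => by
    refine I1.mul_bdd (c := 2 / ε) (continuous_hardyFieldDeriv b c hε i).aestronglyMeasurable ?_
    exact Eventually.of_forall fun x => abs_hardyFieldDeriv_le hε i x
  have I5 : ∀ i, Integrable (fun q => 2 * (inner ℂ (u q) (fderiv ℝ u q (b i))).re
      * hardyField b c ε i q) := fun i => by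
    refine Integrable.mul_bdd (c := 1 + 1 / ε) ?_
      (continuous_hardyField b c hε i).aestronglyMeasurable
      (Eventually.of_forall fun x => abs_hardyField_le hε i x)
    refine (I1.add (I2 i)).mono' ((Complex.continuous_re.comp_aestronglyMeasurable
      (hu2.1.inner (hdu i).1)).const_mul 2) (Eventually.of_forall fun q => ?_)
    have h1 := norm_inner_le_norm (𝕜 := ℂ) (u q) (fderiv ℝ u q (b i))
    have h2 := Complex.abs_re_le_norm (inner ℂ (u q) (fderiv ℝ u q (b i)))
    have h3 := two_mul_le_add_sq ‖u q‖ ‖fderiv ℝ u q (b i)‖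
    rw [Real.norm_eq_abs, abs_mul, abs_two]
    simp only [Pi.add_apply]
    linarith
  have I6 : Integrable (fun q => ‖u q‖ ^ 2 / (distSq b c q + ε)) := by
    simp_rw [div_eq_mul_inv]
    refine I1.mul_bdd (c := ε⁻¹) (Continuous.aestronglyMeasurable
      (((contDiff_distSq b c (n := 0)).continuous.add continuous_const).inv₀ fun x =>
      (add_pos_of_nonneg_of_pos (distSq_nonneg b c x) hε).ne'))
      (Eventually.of_forall fun x => ?_)
    have h0 := distSq_nonneg b c x
    rw [norm_inv, Real.norm_of_nonneg (by positivity)]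
    exact inv_anti₀ hε (by linarith)
  refine ⟨I6, ?_⟩
  -- The integrand is the derivative of `‖u‖²` times the Hardy field along `b i`. It is available
  -- only on `Ω`, which suffices because almost every line stays in `Ω`.
  have hz : ∀ i, ∫ q, (2 * (inner ℂ (u q) (fderiv ℝ u q (b i))).re * hardyField b c ε i q
      + ‖u q‖ ^ 2 * hardyFieldDeriv b c ε i q) = 0 := fun i => by
    refine integral_hasLineDerivAt_eq_zero (hN (b i)) (f := fun q => ‖u q‖ ^ 2 * hardyField b c ε i q)
      (fun x hx => ?_) (I3 i) ((I5 i).add (I4 i))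
    have hx' : x ∈ Ω := not_not.1 hx
    have h1 : HasDerivAt (fun s : ℝ => u (x + s • b i)) (fderiv ℝ u x (b i)) 0 :=
      ((hu.contDiffAt (hΩ.mem_nhds hx')).differentiableAt one_ne_zero).hasFDerivAt.hasLineDerivAt _
    have h2 := (hasDerivAt_norm_sq_spin h1).fun_mul (hasDerivAt_hardyField (c := c) hb hε i x)
    simpa [HasLineDerivAt] using h2
  have hsum : ∫ q, ∑ i, (2 * (inner ℂ (u q) (fderiv ℝ u q (b i))).re * hardyField b c ε i q
      + ‖u q‖ ^ 2 * hardyFieldDeriv b c ε i q) = 0 := by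
    rw [integral_finsetSum _ fun i _ => ((I5 i).add (I4 i) : Integrable (fun q => _ + _) _)]
    exact Finset.sum_eq_zero fun i _ => hz i
  have I7 : Integrable fun q => ∑ i, ‖fderiv ℝ u q (b i)‖ ^ 2 :=
    integrable_finsetSum _ fun i _ => I2 i
  have hle : ∫ q, (1 / 2 * (‖u q‖ ^ 2 / (distSq b c q + ε))
      - 2 * ∑ i, ‖fderiv ℝ u q (b i)‖ ^ 2) ≤ 0 := by
    rw [← hsum]
    refine integral_mono ((I6.const_mul _).sub (I7.const_mul _))
      (integrable_finsetSum _ fun i _ => (I5 i).add (I4 i)) fun q => ?_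
    -- The mixed term is estimated by `2xy ≤ 2x² + y²/2`, adding `1/2` to the coefficient `2` from
    -- `hardyFieldDeriv`. Summed over three directions, the weight keeps the coefficient `3 - 5/2 =
    -- 1/2 > 0`; here codimension three enters.
    have h1 : ∀ i, ‖u q‖ ^ 2 * (1 / (distSq b c q + ε)) - 5 / 2 * (‖u q‖ ^ 2
        * hardyField b c ε i q ^ 2) - 2 * ‖fderiv ℝ u q (b i)‖ ^ 2 ≤
        2 * (inner ℂ (u q) (fderiv ℝ u q (b i))).re * hardyField b c ε i q
          + ‖u q‖ ^ 2 * hardyFieldDeriv b c ε i q := fun i => by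
      have a1 := norm_inner_le_norm (𝕜 := ℂ) (u q) (fderiv ℝ u q (b i))
      have a2 := Complex.abs_re_le_norm (inner ℂ (u q) (fderiv ℝ u q (b i)))
      have a3 := neg_abs_le ((inner ℂ (u q) (fderiv ℝ u q (b i))).re * hardyField b c ε i q)
      have a4 : |(inner ℂ (u q) (fderiv ℝ u q (b i))).re * hardyField b c ε i q| ≤
          ‖fderiv ℝ u q (b i)‖ * (‖u q‖ * |hardyField b c ε i q|) := by
        rw [abs_mul]
        calc _ ≤ (‖u q‖ * ‖fderiv ℝ u q (b i)‖) * |hardyField b c ε i q| := by gcongr; linarith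
          _ = _ := by ring
      have a5 := sq_nonneg (2 * ‖fderiv ℝ u q (b i)‖ - ‖u q‖ * |hardyField b c ε i q|)
      have a6 : (‖u q‖ * |hardyField b c ε i q|) ^ 2 = ‖u q‖ ^ 2 * hardyField b c ε i q ^ 2 := by
        rw [mul_pow, sq_abs]
      rw [hardyFieldDeriv]
      nlinarith
    have h2 := Finset.sum_le_sum fun i (_ : i ∈ Finset.univ) => h1 i
    refine le_trans ?_ h2
    have h3 := sum_hardyField_sq_le b c hε q
    have h4 := mul_le_mul_of_nonneg_left h3 (sq_nonneg ‖u q‖)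
    simp only [Finset.sum_sub_distrib, ← Finset.mul_sum, Finset.sum_const, Finset.card_univ,
      Fintype.card_fin, nsmul_eq_mul]
    rw [div_eq_mul_one_div (‖u q‖ ^ 2)]
    push_cast
    linarith
  rw [integral_sub (I6.const_mul _) (I7.const_mul _), integral_const_mul, integral_const_mul] at hle
  linarith

/-- **Hardy's inequality** in codimension three. -/
theorem lintegral_div_distSq_le (hΩ : IsOpen Ω)
    (hN : ∀ v : Cfg d, ∀ᵐ x : Cfg d, ∀ s : ℝ, x + s • v ∉ Ωᶜ) (hb : Orthonormal ℝ b)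
    (hr : ∀ x ∈ Ω, distSq b c x ≠ 0) (hu : ContDiffOn ℝ 1 u Ω) (hu2 : MemLp u 2 volume) :
    ∫⁻ q in Ω, ENNReal.ofReal (‖u q‖ ^ 2 / distSq b c q) ≤
      12 * ∫⁻ q in Ω, ∑ j, ‖pd j u q‖ₑ ^ 2 := by
  have hΩae : ∀ᵐ x : Cfg d, x ∈ Ω := by
    filter_upwards [hN 0] with x hx
    simpa using hx 0
  rw [Measure.restrict_eq_self_of_ae_mem hΩae]
  set G : ℝ≥0∞ := ∫⁻ q, ∑ j, ‖pd j u q‖ₑ ^ 2 with hG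
  by_cases hGt : G = ⊤
  · simp [hGt]
  have hm : ∀ v, AEStronglyMeasurable (fun q => fderiv ℝ u q v) volume := fun v => by
    rw [← Measure.restrict_eq_self_of_ae_mem hΩae]
    exact ((hu.continuousOn_fderiv_of_isOpen hΩ le_rfl).clm_apply
      continuousOn_const).aestronglyMeasurable hΩ.measurableSet
  have hpt : ∀ q i, ‖fderiv ℝ u q (b i)‖ₑ ^ 2 ≤ ∑ j, ‖pd j u q‖ₑ ^ 2 := fun q i => by
    have e : fderiv ℝ u q (b i) = ∑ j, b i j • pd j u q := by
      conv_lhs => rw [← sum_smul_unitVec (b i)]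
      simp [pd, unitVec]
    have h1 : ‖fderiv ℝ u q (b i)‖ ^ 2 ≤ ∑ j, ‖pd j u q‖ ^ 2 := by
      calc ‖fderiv ℝ u q (b i)‖ ^ 2 ≤ (∑ j, |b i j| * ‖pd j u q‖) ^ 2 := by
            gcongr
            rw [e]
            refine (norm_sum_le _ _).trans (Finset.sum_le_sum fun j _ => ?_)
            rw [norm_smul, Real.norm_eq_abs]
        _ ≤ (∑ j, |b i j| ^ 2) * ∑ j, ‖pd j u q‖ ^ 2 := Finset.sum_mul_sq_le_sq_mul_sq _ _ _
        _ = ∑ j, ‖pd j u q‖ ^ 2 := by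
            have h2 : ∑ j, |b i j| ^ 2 = ‖b i‖ ^ 2 := by
              rw [EuclideanSpace.norm_sq_eq]
              simp
            rw [h2, hb.1 i]
            simp
    have h2 := ENNReal.ofReal_le_ofReal h1
    rw [ENNReal.ofReal_sum_of_nonneg fun _ _ => sq_nonneg _] at h2
    simpa [ENNReal.ofReal_pow, ofReal_norm] using h2
  have hdu : ∀ i, MemLp (fun q => fderiv ℝ u q (b i)) 2 volume := fun i => by
    refine ⟨hm _, ?_⟩
    rw [eLpNorm_lt_top_iff_lintegral_rpow_enorm_lt_top two_ne_zero ENNReal.ofNat_ne_top]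
    simp only [ENNReal.toReal_ofNat, ENNReal.rpow_ofNat]
    exact (lintegral_mono fun q => hpt q i).trans_lt (lt_top_iff_ne_top.2 hGt)
  -- Each of the three unit directions is bounded by the full gradient; with the factor `4` of the
  -- regularized inequality this makes `12`.
  have hsum : ENNReal.ofReal (∫ q, ∑ i, ‖fderiv ℝ u q (b i)‖ ^ 2) ≤ 3 * G := by
    rw [ofReal_integral_eq_lintegral_ofReal
      (integrable_finsetSum _ fun i _ => (hdu i).integrable_norm_pow two_ne_zero)
      (Eventually.of_forall fun q => Finset.sum_nonneg fun i _ => sq_nonneg _)]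
    calc _ ≤ ∫⁻ q, 3 * ∑ j, ‖pd j u q‖ₑ ^ 2 := by
          refine lintegral_mono fun q => ?_
          rw [ENNReal.ofReal_sum_of_nonneg fun _ _ => sq_nonneg _]
          refine (Finset.sum_le_sum (g := fun _ => ∑ j, ‖pd j u q‖ₑ ^ 2) fun i _ => ?_).trans
            (by simp)
          simpa [ENNReal.ofReal_pow, ofReal_norm] using hpt q i
      _ = 3 * G := lintegral_const_mul' _ _ (by simp)
  set ε : ℕ → ℝ := fun n => 1 / ((n : ℝ) + 1) with hε
  have hε0 : ∀ n, 0 < ε n := fun n => by positivity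
  have hεl : Tendsto ε atTop (𝓝 0) := tendsto_one_div_add_atTop_nhds_zero_nat
  have hbound : ∀ n, ∫⁻ q, ENNReal.ofReal (‖u q‖ ^ 2 / (distSq b c q + ε n)) ≤ 12 * G := fun n => by
    obtain ⟨h1, h2⟩ := integral_div_distSq_add_le (c := c) hΩ hN hb hu hu2 hdu (hε0 n)
    rw [← ofReal_integral_eq_lintegral_ofReal h1 (Eventually.of_forall fun q =>
      div_nonneg (sq_nonneg _) (add_pos_of_nonneg_of_pos (distSq_nonneg b c q) (hε0 n)).le)]
    refine (ENNReal.ofReal_le_ofReal h2).trans ?_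
    rw [ENNReal.ofReal_mul (by norm_num)]
    calc _ ≤ ENNReal.ofReal 4 * (3 * G) := by gcongr
      _ = 12 * G := by
        rw [← mul_assoc]
        norm_num
  have hmeas : ∀ n, AEMeasurable (fun q => ENNReal.ofReal (‖u q‖ ^ 2 / (distSq b c q + ε n))) :=
    fun n => (integral_div_distSq_add_le hΩ hN hb hu hu2 hdu (hε0 n)).1.1.aemeasurable.ennreal_ofReal
  -- Fatou's lemma removes the regularization, since the bound does not depend on `ε`.
  calc ∫⁻ q, ENNReal.ofReal (‖u q‖ ^ 2 / distSq b c q)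
      ≤ ∫⁻ q, liminf (fun n => ENNReal.ofReal (‖u q‖ ^ 2 / (distSq b c q + ε n))) atTop := by
        refine lintegral_mono_ae ?_
        filter_upwards [hΩae] with q hq
        have h1 : Tendsto (fun n => distSq b c q + ε n) atTop (𝓝 (distSq b c q)) := by
          simpa using hεl.const_add (distSq b c q)
        exact (ENNReal.tendsto_ofReal (tendsto_const_nhds.div h1 (hr q hq))).liminf_eq.ge
    _ ≤ liminf (fun n => ∫⁻ q, ENNReal.ofReal (‖u q‖ ^ 2 / (distSq b c q + ε n))) atTop :=
        lintegral_liminf_le' hmeas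
    _ ≤ 12 * G := liminf_le_of_frequently_le' (Frequently.of_forall hbound)

end Hardy

/-! ### Affine subspaces of codimension three -/

section AffineSubspaces

variable {d n : ℕ} {S : Fin n → AffineSubspace ℝ (Cfg d)}

lemma isOpen_conf (S : Fin n → AffineSubspace ℝ (Cfg d)) : IsOpen (conf S) :=
  (isClosed_iUnion_of_finite fun l => (S l).closed_of_finiteDimensional).isOpen_compl

/-- Almost every line of given direction avoids affine subspaces of codimension at least two. -/
lemma ae_forall_add_smul_notMem (hS_dim : ∀ l, Module.finrank ℝ (S l).direction + 3 = d)
    (v : Cfg d) : ∀ᵐ x : Cfg d, ∀ s : ℝ, x + s • v ∉ (conf S)ᶜ := by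
  have key : ∀ l, ∀ᵐ x : Cfg d, ∀ s : ℝ, x + s • v ∉ S l := fun l => by
    by_cases hne : (S l : Set (Cfg d)).Nonempty
    swap
    · exact Eventually.of_forall fun x s hx => hne ⟨_, hx⟩
    obtain ⟨c, hc⟩ := hne
    -- Every line in direction `v` that meets `S l` lies in `T`, whose dimension is at most `d - 2`,
    -- so `T` is a null set.
    set T := AffineSubspace.mk' c ((S l).direction ⊔ Submodule.span ℝ {v}) with hT
    have hTt : T ≠ ⊤ := fun h => by
      have h1 : T.direction = ⊤ := by rw [h, AffineSubspace.direction_top]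
      rw [hT, AffineSubspace.direction_mk'] at h1
      have h2 := Submodule.finrank_add_le_finrank_add_finrank (S l).direction
        (Submodule.span ℝ {v})
      have h3 := finrank_span_le_card (R := ℝ) ({v} : Set (Cfg d))
      rw [toFinset_singleton, Finset.card_singleton] at h3
      rw [h1, finrank_top, finrank_euclideanSpace_fin] at h2
      have := hS_dim l
      omega
    have h0 := Measure.addHaar_affineSubspace volume T hTt
    refine (measure_eq_zero_iff_ae_notMem.1 h0).mono fun x hx s hxs => hx ?_
    rw [SetLike.mem_coe, hT, AffineSubspace.mem_mk', vsub_eq_sub]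
    have e : x - c = (x + s • v - c) + (-s) • v := by module
    rw [e]
    exact add_mem (Submodule.mem_sup_left ((S l).vsub_mem_direction hxs hc))
      (Submodule.mem_sup_right (Submodule.smul_mem _ _ (Submodule.mem_span_singleton_self v)))
  filter_upwards [ae_all_iff.2 key] with x hx s
  simp only [conf, compl_compl, mem_iUnion, SetLike.mem_coe, not_exists]
  exact fun l => hx l s

/-- An affine subspace of codimension three is the zero set of `distSq` for a suitable
orthonormal system. -/
lemma exists_orthonormal_distSq {T : AffineSubspace ℝ (Cfg d)}
    (hT : Module.finrank ℝ T.direction + 3 = d) {c : Cfg d} (hc : c ∈ T) :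
    ∃ b : Fin 3 → Cfg d, Orthonormal ℝ b ∧ ∀ x, distSq b c x = 0 ↔ x ∈ T := by
  have h3 : Module.finrank ℝ T.directionᗮ = 3 := by
    have := T.direction.finrank_add_finrank_orthogonal
    rw [finrank_euclideanSpace_fin] at this
    omega
  set B := (stdOrthonormalBasis ℝ T.directionᗮ).reindex (finCongr h3)
  refine ⟨fun i => (B i : Cfg d), ?_, fun x => ⟨fun hx => ?_, fun hx => ?_⟩⟩
  · exact B.orthonormal.comp_linearIsometry T.directionᗮ.subtypeₗᵢ
  · have h1 : ∀ i, inner ℝ (B i : Cfg d) (x - c) = 0 := fun i => by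
      have := (Finset.sum_eq_zero_iff_of_nonneg fun i _ => sq_nonneg _).1 hx i (Finset.mem_univ i)
      exact pow_eq_zero_iff two_ne_zero |>.1 this
    have h2 : x - c ∈ T.directionᗮᗮ := by
      rw [Submodule.mem_orthogonal]
      intro y hy
      have h4 := B.sum_repr ⟨y, hy⟩
      have h5 : y = ∑ i, B.repr ⟨y, hy⟩ i • (B i : Cfg d) := by
        conv_lhs => rw [show y = ((⟨y, hy⟩ : T.directionᗮ) : Cfg d) from rfl, ← h4]
        simp
      rw [h5, sum_inner]
      exact Finset.sum_eq_zero fun i _ => by rw [inner_smul_left, h1, mul_zero]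
    rw [Submodule.orthogonal_orthogonal] at h2
    have := AffineSubspace.vadd_mem_of_mem_direction h2 hc
    simpa using this
  · refine Finset.sum_eq_zero fun i _ => ?_
    have h1 : inner ℝ (B i : Cfg d) (x - c) = 0 :=
      Submodule.inner_left_of_mem_orthogonal (T.vsub_mem_direction hx hc) (B i).2
    simp [h1]

end AffineSubspaces

variable {d k n : ℕ} {ψ : ℝ → Cfg d → Spin k} {Ω : Set (Cfg d)} {m : Fin d → ℝ} {A : Cfg d → Cfg d}

/-! ### The confining functions and their variation along trajectories -/

section Confiners

/-- The functions `log |ψ|²`, `log (1 + |q|²)` and `log dist(q, S_l)²`, which stay bounded only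
away from the nodes, from infinity and from the subspaces. -/
noncomputable def confiner (ψ : ℝ → Cfg d → Spin k)
    (b : Fin n → Fin 3 → Cfg d) (c : Fin n → Cfg d) :
    Option (Option (Fin n)) → ℝ × Cfg d → ℝ
  | none => fun p => Real.log (density ψ p)
  | some none => fun p => Real.log (1 + ‖p.2‖ ^ 2)
  | some (some l) => fun p => Real.log (distSq (b l) (c l) p.2)

lemma density_pos {p : ℝ × Cfg d} (hp : p ∈ nonNodal ψ Ω) : 0 < density ψ p :=
  pow_pos (norm_pos_iff.2 hp.2) 2

lemma nonNodal_subset : nonNodal ψ Ω ⊆ univ ×ˢ Ω := fun _ hp => ⟨mem_univ _, hp.1⟩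

lemma contDiffOn_density (hC : ContDiffOn ℝ 2 (wave ψ) (univ ×ˢ Ω)) :
    ContDiffOn ℝ 1 (density ψ) (nonNodal ψ Ω) :=
  ((hC.mono nonNodal_subset).of_le (by norm_num)).norm_sq ℂ

lemma contDiffOn_velocityField (hΩ : IsOpen Ω) (hC : ContDiffOn ℝ 2 (wave ψ) (univ ×ˢ Ω))
    (hAC : ContDiffOn ℝ 1 A {q ∈ Ω | ∃ t, ψ t q ≠ 0}) :
    ContDiffOn ℝ 1 (velocityField m A ψ) (nonNodal ψ Ω) := by
  have h1 : ContDiffOn ℝ 1 (fun p => (density ψ p)⁻¹ • current m A ψ p) (nonNodal ψ Ω) := by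
    refine ((contDiffOn_density hC).inv fun p hp => (density_pos hp).ne').smul
      (contDiffOn_euclidean.2 fun j => contDiffOn_const.mul (ContDiffOn.sub ?_ (ContDiffOn.mul ?_
        (contDiffOn_density hC))))
    · exact Complex.imCLM.contDiff.comp_contDiffOn
        (((hC.of_le (by norm_num)).mono nonNodal_subset).inner ℂ
          ((contDiffOn_fderiv_wave hΩ hC _).mono nonNodal_subset))
    · exact (EuclideanSpace.proj (𝕜 := ℝ) j).contDiff.comp_contDiffOn
        (hAC.comp contDiff_snd.contDiffOn fun p hp => ⟨hp.1, p.1, hp.2⟩)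
  refine h1.congr fun p hp => ?_
  rw [← density_smul_velocity hΩ hC hp, smul_smul, inv_mul_cancel₀ (density_pos hp).ne', one_smul]
  rfl

variable {b : Fin n → Fin 3 → Cfg d} {c : Fin n → Cfg d}

lemma contDiffOn_confiner (hC : ContDiffOn ℝ 2 (wave ψ) (univ ×ˢ Ω))
    (hr : ∀ l, ∀ x ∈ Ω, distSq (b l) (c l) x ≠ 0) (i : Option (Option (Fin n))) :
    ContDiffOn ℝ 1 (confiner ψ b c i) (nonNodal ψ Ω) := by
  rcases i with _ | _ | l
  · exact (contDiffOn_density hC).log fun p hp => (density_pos hp).ne'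
  · refine ContDiffOn.log (contDiff_const.add (contDiff_snd.norm_sq ℝ)).contDiffOn fun p _ => ?_
    positivity
  · exact ContDiffOn.log ((contDiff_distSq _ _).comp contDiff_snd).contDiffOn
      fun p hp => hr l p.2 hp.1

/-- Bounds on the logarithms bound `|q|` from above and the density and the distances from below.
The distance bounds give a compact `K` inside `univ ×ˢ Ω`; there the density is continuous, so its
lower bound cuts out a closed set. -/
lemma exists_isCompact_of_confiner_lt (hC : ContinuousOn (wave ψ) (univ ×ˢ Ω))
    (hr : ∀ l, ∀ x ∈ Ω, distSq (b l) (c l) x ≠ 0)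
    (hΩ : ∀ x, (∀ l, distSq (b l) (c l) x ≠ 0) → x ∈ Ω) (T R : ℝ) :
    ∃ Z ⊆ nonNodal ψ Ω, IsCompact Z ∧ ∀ p ∈ nonNodal ψ Ω, |p.1| < T →
      (∀ i, |confiner ψ b c i p| < R) → p ∈ Z := by
  have hlog : ∀ y : ℝ, 0 < y → |Real.log y| < R → Real.exp (-R) ≤ y ∧ y ≤ Real.exp R := by
    intro y hy h
    rw [abs_lt] at h
    exact ⟨by rw [← Real.le_log_iff_exp_le hy]; exact h.1.le,
      by rw [← Real.log_le_iff_le_exp hy]; exact h.2.le⟩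
  set K : Set (ℝ × Cfg d) := Icc (-T) T ×ˢ (Metric.closedBall 0 (Real.exp R) ∩
    {x | ∀ l, Real.exp (-R) ≤ distSq (b l) (c l) x}) with hK
  have hclosed : IsClosed {x : Cfg d | ∀ l, Real.exp (-R) ≤ distSq (b l) (c l) x} := by
    rw [ofPred_forall]
    exact isClosed_iInter fun l =>
      isClosed_le continuous_const (contDiff_distSq (b l) (c l) (n := 0)).continuous
  have hKc : IsCompact K := isCompact_Icc.prod ((isCompact_closedBall _ _).inter_right hclosed)
  have hKΩ : K ⊆ univ ×ˢ Ω := fun p hp =>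
    ⟨mem_univ _, hΩ _ fun l => ((Real.exp_pos _).trans_le (hp.2.2 l)).ne'⟩
  have hρ : ContinuousOn (density ψ) K := (hC.mono hKΩ).norm.pow 2
  refine ⟨K ∩ density ψ ⁻¹' Ici (Real.exp (-R)), fun p hp => ⟨(hKΩ hp.1).2, fun h0 => ?_⟩,
    hKc.of_isClosed_subset (hρ.preimage_isClosed_of_isClosed hKc.isClosed isClosed_Ici)
      inter_subset_left, fun p hp hT hR => ⟨⟨abs_le.1 hT.le, ?_, fun l => ?_⟩, ?_⟩⟩
  · have h1 := (Real.exp_pos (-R)).trans_le hp.2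
    simp [density, h0] at h1
  · have h1 := (hlog (1 + ‖p.2‖ ^ 2) (by positivity) (hR (some none))).2
    rw [mem_closedBall_zero_iff]
    nlinarith [sq_nonneg (‖p.2‖ - 1)]
  · exact (hlog _ ((distSq_nonneg _ _ _).lt_of_ne' (hr l p.2 hp.1)) (hR (some (some l)))).1
  · exact (hlog _ (density_pos hp) (hR none)).1

end Confiners

section Estimates

/-- The quantity that controls the variation of `confiner` along trajectories. -/
noncomputable def energy (A : Cfg d → Cfg d) (ψ : ℝ → Cfg d → Spin k) (p : ℝ × Cfg d) : ℝ :=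
  ‖wave ψ p‖ ^ 2 + ‖fderiv ℝ (wave ψ) p (1, 0)‖ ^ 2 + ∑ j, ‖pd j (ψ p.1) p.2‖ ^ 2
    + (‖A p.2‖ * ‖wave ψ p‖) ^ 2

/-- Cauchy-Schwarz in the numerator; one factor `‖ψ‖` is enough to remove the singularity of the
velocity at the nodes. -/
lemma abs_velocity_le (hm : ∀ j, 0 < m j) {t : ℝ} {q : Cfg d} (h : ψ t q ≠ 0) (j : Fin d) :
    ‖ψ t q‖ * |velocity m A ψ t q j| ≤
      (∑ l, (m l)⁻¹) * (‖pd j (ψ t) q‖ + ‖A q‖ * ‖ψ t q‖) := by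
  have h0 : 0 < ‖ψ t q‖ := norm_pos_iff.2 h
  have hM : (m j)⁻¹ ≤ ∑ l, (m l)⁻¹ :=
    Finset.single_le_sum (f := fun l => (m l)⁻¹) (fun l _ => (inv_pos.2 (hm l)).le)
      (Finset.mem_univ j)
  have hA : |A q j| ≤ ‖A q‖ := PiLp.norm_apply_le (A q) j
  have h1 : ‖pd j (ψ t) q - (Complex.I * (A q j : ℂ)) • ψ t q‖ ≤
      ‖pd j (ψ t) q‖ + ‖A q‖ * ‖ψ t q‖ := by
    refine (norm_sub_le _ _).trans ?_
    rw [norm_smul, norm_mul, Complex.norm_I, one_mul, Complex.norm_real, Real.norm_eq_abs]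
    gcongr
  have h2 := norm_inner_le_norm (𝕜 := ℂ) (ψ t q) (pd j (ψ t) q - (Complex.I * (A q j : ℂ)) • ψ t q)
  have h3 : ‖inner ℂ (ψ t q) (ψ t q)‖ = ‖ψ t q‖ * ‖ψ t q‖ := by
    rw [inner_self_eq_norm_sq_to_K]
    simp [sq]
  have h4 := Complex.abs_im_le_norm
    (inner ℂ (ψ t q) (pd j (ψ t) q - (Complex.I * (A q j : ℂ)) • ψ t q)
      / inner ℂ (ψ t q) (ψ t q))
  rw [norm_div, h3] at h4
  have h5 : ‖ψ t q‖ * |(inner ℂ (ψ t q) (pd j (ψ t) q - (Complex.I * (A q j : ℂ)) • ψ t q)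
      / inner ℂ (ψ t q) (ψ t q)).im| ≤ ‖pd j (ψ t) q‖ + ‖A q‖ * ‖ψ t q‖ := by
    calc _ ≤ ‖ψ t q‖ * (‖ψ t q‖ * (‖pd j (ψ t) q‖ + ‖A q‖ * ‖ψ t q‖) / (‖ψ t q‖ * ‖ψ t q‖)) := by
          gcongr
          refine h4.trans ?_
          gcongr
          exact h2.trans (by gcongr)
      _ = _ := by field_simp
  calc _ = (m j)⁻¹ * (‖ψ t q‖ * |(inner ℂ (ψ t q)
        (pd j (ψ t) q - (Complex.I * (A q j : ℂ)) • ψ t q) / inner ℂ (ψ t q) (ψ t q)).im|) := by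
        simp only [velocity, abs_mul, abs_of_pos (inv_pos.2 (hm j))]
        ring
    _ ≤ _ := mul_le_mul hM h5 (by positivity) (Finset.sum_nonneg fun l _ => (inv_pos.2 (hm l)).le)

lemma sq_norm_velocity_le (hm : ∀ j, 0 < m j) {t : ℝ} {q : Cfg d} (h : ψ t q ≠ 0) :
    (‖ψ t q‖ * ‖velocity m A ψ t q‖) ^ 2 ≤ (∑ l, (m l)⁻¹) ^ 2 * (2 * (d + 1) ^ 2)
      * ((∑ j, ‖pd j (ψ t) q‖ ^ 2) + (‖A q‖ * ‖ψ t q‖) ^ 2) := by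
  have h1 : ‖ψ t q‖ * ‖velocity m A ψ t q‖ ≤
      (∑ l, (m l)⁻¹) * ∑ j, (‖pd j (ψ t) q‖ + ‖A q‖ * ‖ψ t q‖) := by
    have h2 : ‖velocity m A ψ t q‖ ≤ ∑ j, |velocity m A ψ t q j| := by
      conv_lhs => rw [← sum_smul_unitVec (velocity m A ψ t q)]
      refine (norm_sum_le _ _).trans (Finset.sum_le_sum fun j _ => ?_)
      rw [norm_smul, Real.norm_eq_abs]
      simp
    calc _ ≤ ‖ψ t q‖ * ∑ j, |velocity m A ψ t q j| := by gcongr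
      _ = ∑ j, ‖ψ t q‖ * |velocity m A ψ t q j| := Finset.mul_sum _ _ _
      _ ≤ ∑ j, (∑ l, (m l)⁻¹) * (‖pd j (ψ t) q‖ + ‖A q‖ * ‖ψ t q‖) :=
          Finset.sum_le_sum fun j _ => abs_velocity_le hm h j
      _ = _ := (Finset.mul_sum _ _ _).symm
  have h3 : (∑ j, (‖pd j (ψ t) q‖ + ‖A q‖ * ‖ψ t q‖)) ^ 2 ≤
      -- Cauchy-Schwarz contributes a factor `d`, the constant summands another one; `(d + 1)²`
      -- dominates both `d` and `d²`.
      2 * (d + 1) ^ 2 * ((∑ j, ‖pd j (ψ t) q‖ ^ 2) + (‖A q‖ * ‖ψ t q‖) ^ 2) := by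
    have h4 := sq_sum_le_card_mul_sum_sq (s := Finset.univ)
      (f := fun j => ‖pd j (ψ t) q‖ + ‖A q‖ * ‖ψ t q‖)
    have h5 : ∑ j, (‖pd j (ψ t) q‖ + ‖A q‖ * ‖ψ t q‖) ^ 2 ≤
        ∑ j, (2 * ‖pd j (ψ t) q‖ ^ 2 + 2 * (‖A q‖ * ‖ψ t q‖) ^ 2) :=
      Finset.sum_le_sum fun j _ => by
        nlinarith [sq_nonneg (‖pd j (ψ t) q‖ - ‖A q‖ * ‖ψ t q‖)]
    rw [Finset.sum_add_distrib, ← Finset.mul_sum, Finset.sum_const] at h5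
    simp only [Finset.card_univ, Fintype.card_fin, nsmul_eq_mul] at h4 h5
    have hN : 0 ≤ ∑ j, ‖pd j (ψ t) q‖ ^ 2 := Finset.sum_nonneg fun _ _ => sq_nonneg _
    have hd : (0 : ℝ) ≤ d := Nat.cast_nonneg d
    have hα := sq_nonneg (‖A q‖ * ‖ψ t q‖)
    calc _ ≤ (d : ℝ) * _ := h4
      _ ≤ (d : ℝ) * (2 * ∑ j, ‖pd j (ψ t) q‖ ^ 2 + d * (2 * (‖A q‖ * ‖ψ t q‖) ^ 2)) := by gcongr
      _ ≤ _ := by nlinarith [mul_nonneg hd hN, mul_nonneg hd hα, mul_nonneg (mul_nonneg hd hd) hN]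
  calc _ ≤ ((∑ l, (m l)⁻¹) * ∑ j, (‖pd j (ψ t) q‖ + ‖A q‖ * ‖ψ t q‖)) ^ 2 := by gcongr
    _ = (∑ l, (m l)⁻¹) ^ 2 * (∑ j, (‖pd j (ψ t) q‖ + ‖A q‖ * ‖ψ t q‖)) ^ 2 := mul_pow _ _ _
    _ ≤ (∑ l, (m l)⁻¹) ^ 2 * (2 * (d + 1) ^ 2 *
        ((∑ j, ‖pd j (ψ t) q‖ ^ 2) + (‖A q‖ * ‖ψ t q‖) ^ 2)) := by gcongr
    _ = _ := by ring

lemma abs_inner_le_sqrt_distSq (b : Fin 3 → Cfg d) (c x : Cfg d) (i : Fin 3) :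
    |inner ℝ (b i) (x - c)| ≤ √(distSq b c x) := by
  refine Real.abs_le_sqrt (Finset.single_le_sum (f := fun i => (inner ℝ (b i) (x - c)) ^ 2)
    (fun i _ => sq_nonneg _) (Finset.mem_univ i))

lemma abs_fderiv_distSq_le {b : Fin 3 → Cfg d} (hb : Orthonormal ℝ b) (c x v : Cfg d) :
    |fderiv ℝ (distSq b c) x v| ≤ 6 * √(distSq b c x) * ‖v‖ := by
  have h1 : ∀ i, HasFDerivAt (fun y : Cfg d => inner ℝ (b i) (y - c)) (innerSL ℝ (b i)) x :=
    fun i => by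
      have := (innerSL ℝ (b i)).hasFDerivAt.comp x ((hasFDerivAt_id x).sub_const c)
      simpa [Function.comp_def] using this
  have h2 : HasFDerivAt (distSq b c) _ x := HasFDerivAt.fun_sum fun i _ => (h1 i).pow 2
  rw [h2.fderiv]
  simp only [sum_apply, smul_apply, innerSL_apply_apply, smul_eq_mul]
  refine (Finset.abs_sum_le_sum_abs _ _).trans ?_
  have h3 : ∀ i, |inner ℝ (b i) v| ≤ ‖v‖ := fun i => by
    have := abs_real_inner_le_norm (b i) v
    rwa [hb.1 i, one_mul] at this
  calc _ ≤ ∑ i : Fin 3, 2 * √(distSq b c x) * ‖v‖ := Finset.sum_le_sum fun i _ => by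
        have := abs_inner_le_sqrt_distSq b c x i
        simp only [abs_mul]
        norm_num
        gcongr
        exact h3 i
    _ = _ := by simp; ring

end Estimates

variable {d k n : ℕ} {ψ : ℝ → Cfg d → Spin k} {Ω : Set (Cfg d)} {m : Fin d → ℝ} {A : Cfg d → Cfg d}

section Variation

lemma energy_nonneg (p : ℝ × Cfg d) : 0 ≤ energy A ψ p := by
  unfold energy
  positivity

/-- A bound on the constant relating the variation of `confiner` to `energy`. -/
noncomputable def variationConst (m : Fin d → ℝ) : ℝ :=
  3 * (1 + (∑ l, (m l)⁻¹) ^ 2 * (2 * (d + 1) ^ 2) + d)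

lemma variationConst_nonneg (m : Fin d → ℝ) : 0 ≤ variationConst m := by
  unfold variationConst
  positivity

lemma density_mul_fderiv_log {f : ℝ × Cfg d → ℝ} {p w : ℝ × Cfg d} (hf : DifferentiableAt ℝ f p)
    (h0 : 0 < f p) : ‖fderiv ℝ (fun p => Real.log (f p)) p w‖ = |fderiv ℝ f p w| / f p := by
  rw [(hf.hasFDerivAt.log h0.ne').fderiv, smul_apply, smul_eq_mul, Real.norm_eq_abs, abs_mul,
    abs_inv, abs_of_pos h0, div_eq_inv_mul]

/-- The arithmetic behind `variation_log_density_le`: `a = |ψ|`, `x = |∂_t ψ|`, `v` is the speed and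
`s` the sum of the `|∂_j ψ|`. The products `a x` and `(a v) s` are split into squares. -/
lemma two_mul_le_of_le_mul_add {a x v s N B C δ r : ℝ} (hN : 0 ≤ N) (hB : 0 ≤ B) (hC : 0 ≤ C)
    (hδ : 0 ≤ δ) (h1 : (a * v) ^ 2 ≤ C * (N + B)) (h2 : s ^ 2 ≤ δ * N) (h : r ≤ a * (x + v * s)) :
    2 * r ≤ 3 * (1 + C + δ) * (a ^ 2 + x ^ 2 + N + B) := by
  have h3 := two_mul_le_add_sq a x
  have h4 := two_mul_le_add_sq (a * v) s
  have h5 : 0 ≤ C * (a ^ 2 + x ^ 2) := by positivity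
  have h6 : 0 ≤ C * (N + B) := by positivity
  have h7 : 0 ≤ δ * (a ^ 2 + x ^ 2 + B) := by positivity
  have h8 : 0 ≤ δ * N := by positivity
  have h9 : 0 ≤ a ^ 2 + x ^ 2 := by positivity
  linarith

/-- The factor `|ψ|²` cancels the denominator of the logarithmic derivative, leaving at most `2 |ψ|
(|∂_t ψ| + |v| ∑ |∂_j ψ|)`. -/
lemma variation_log_density_le (hΩ : IsOpen Ω) (hm : ∀ j, 0 < m j)
    (hC : ContDiffOn ℝ 2 (wave ψ) (univ ×ˢ Ω)) {p : ℝ × Cfg d} (hp : p ∈ nonNodal ψ Ω) :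
    density ψ p * ‖fderiv ℝ (fun p => Real.log (density ψ p)) p (1, velocityField m A ψ p)‖ ≤
      variationConst m * energy A ψ p := by
  obtain ⟨t, q⟩ := p
  have hu := differentiableAt_wave (t := t) hΩ hC hp.1
  rw [density_mul_fderiv_log (f := density ψ) (hu.norm_sq ℂ) (density_pos hp),
    mul_div_cancel₀ _ (density_pos hp).ne', fderiv_density hu]
  set v := velocityField m A ψ (t, q) with hv
  set a := ‖ψ t q‖ with ha
  set X := fderiv ℝ (wave ψ) (t, q) (1, 0) with hX
  have e1 : fderiv ℝ (wave ψ) (t, q) (1, v) = X + ∑ j, v j • pd j (ψ t) q := by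
    have e2 : ((1 : ℝ), v) = (1, 0) + ∑ j, v j • ((0 : ℝ), unitVec j) := by
      have := sum_smul_unitVec v
      refine Prod.ext ?_ ?_
      · simp [Prod.fst_sum]
      · simp [Prod.snd_sum, this]
    rw [e2, map_add, map_sum]
    congr 1
    refine Finset.sum_congr rfl fun j _ => ?_
    rw [map_smul, ← pd_slice hu j]
    rfl
  have h1 : ‖fderiv ℝ (wave ψ) (t, q) (1, v)‖ ≤ ‖X‖ + ‖v‖ * ∑ j, ‖pd j (ψ t) q‖ := by
    rw [e1]
    refine (norm_add_le _ _).trans ?_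
    gcongr
    refine (norm_sum_le _ _).trans ?_
    rw [Finset.mul_sum]
    refine Finset.sum_le_sum fun j _ => ?_
    rw [norm_smul]
    gcongr
    exact PiLp.norm_apply_le v j
  have h2 := sq_norm_velocity_le (A := A) hm hp.2
  change (a * ‖v‖) ^ 2 ≤ _ at h2
  have h3 := sq_sum_le_card_mul_sum_sq (s := Finset.univ) (f := fun j => ‖pd j (ψ t) q‖)
  simp only [Finset.card_univ, Fintype.card_fin] at h3
  have h4 := (Complex.abs_re_le_norm (inner ℂ (ψ t q) (fderiv ℝ (wave ψ) (t, q) (1, v)))).trans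
    (norm_inner_le_norm _ _)
  rw [abs_mul, abs_two]
  have h5 : a * ‖fderiv ℝ (wave ψ) (t, q) (1, v)‖ ≤ a * (‖X‖ + ‖v‖ * ∑ j, ‖pd j (ψ t) q‖) := by
    gcongr
  exact two_mul_le_of_le_mul_add (Finset.sum_nonneg fun _ _ => sq_nonneg _) (sq_nonneg _)
    (by positivity) (Nat.cast_nonneg d) h2 h3 (h4.trans h5)

lemma sq_norm_velocityField_le (hm : ∀ j, 0 < m j) {p : ℝ × Cfg d} (hp : p ∈ nonNodal ψ Ω) :
    ‖wave ψ p‖ ^ 2 + (‖wave ψ p‖ * ‖velocityField m A ψ p‖) ^ 2 ≤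
      variationConst m / 3 * energy A ψ p := by
  have h2 := sq_norm_velocity_le (A := A) hm hp.2
  change (‖wave ψ p‖ * ‖velocityField m A ψ p‖) ^ 2 ≤ _ at h2
  rw [energy, variationConst]
  set N := ∑ j, ‖pd j (ψ p.1) p.2‖ ^ 2 with hN
  set C0 := (∑ l, (m l)⁻¹) ^ 2 * (2 * ((d : ℝ) + 1) ^ 2) with hC0
  have hN0 : 0 ≤ N := Finset.sum_nonneg fun _ _ => sq_nonneg _
  have hC00 : 0 ≤ C0 := by positivity
  set E := ‖wave ψ p‖ ^ 2 + ‖fderiv ℝ (wave ψ) p (1, 0)‖ ^ 2 + N + (‖A p.2‖ * ‖wave ψ p‖) ^ 2 with hE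
  have h3 : ‖wave ψ p‖ ^ 2 ≤ E := by
    have : 0 ≤ ‖fderiv ℝ (wave ψ) p (1, 0)‖ ^ 2 + N + (‖A p.2‖ * ‖wave ψ p‖) ^ 2 := by positivity
    linarith
  have h4 : N + (‖A p.2‖ * ‖wave ψ p‖) ^ 2 ≤ E := by
    have : 0 ≤ ‖wave ψ p‖ ^ 2 + ‖fderiv ℝ (wave ψ) p (1, 0)‖ ^ 2 := by positivity
    linarith
  have h5 : (0 : ℝ) ≤ d * E := mul_nonneg (Nat.cast_nonneg d) (by positivity)
  calc _ ≤ E + C0 * E := add_le_add h3 (h2.trans (mul_le_mul_of_nonneg_left h4 hC00))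
    _ ≤ _ := by linarith

lemma variation_log_one_add_norm_sq_le (hm : ∀ j, 0 < m j) {p : ℝ × Cfg d}
    (hp : p ∈ nonNodal ψ Ω) :
    density ψ p *
      ‖fderiv ℝ (fun p : ℝ × Cfg d => Real.log (1 + ‖p.2‖ ^ 2)) p (1, velocityField m A ψ p)‖ ≤
      variationConst m * energy A ψ p := by
  set v := velocityField m A ψ p with hv
  have h1 : HasFDerivAt (fun p : ℝ × Cfg d => 1 + ‖p.2‖ ^ 2) _ p :=
    (HasFDerivAt.norm_sq (f := Prod.snd) hasFDerivAt_snd).const_add 1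
  rw [density_mul_fderiv_log h1.differentiableAt (by positivity), h1.fderiv]
  have h2 : |(2 • (innerSL ℝ p.2).comp (ContinuousLinearMap.snd ℝ ℝ (Cfg d))) (1, v)| ≤
      (1 + ‖p.2‖ ^ 2) * ‖v‖ := by
    have h3 := abs_real_inner_le_norm p.2 v
    simp only [smul_apply, ContinuousLinearMap.comp_apply, ContinuousLinearMap.coe_snd',
      innerSL_apply_apply, nsmul_eq_mul, abs_mul]
    norm_num
    nlinarith [mul_nonneg (sq_nonneg (‖p.2‖ - 1)) (norm_nonneg v)]
  have h4 : |(2 • (innerSL ℝ p.2).comp (ContinuousLinearMap.snd ℝ ℝ (Cfg d))) (1, v)| /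
      (1 + ‖p.2‖ ^ 2) ≤ ‖v‖ := by
    rw [div_le_iff₀ (by positivity)]
    linarith
  have h5 := sq_norm_velocityField_le (A := A) hm hp
  rw [← hv] at h5
  have h6 := mul_nonneg (variationConst_nonneg m) (energy_nonneg (A := A) (ψ := ψ) p)
  calc _ ≤ density ψ p * ‖v‖ := by
        have := (density_pos hp).le
        gcongr
    -- This is `‖v‖ ≤ 1 + ‖v‖²` multiplied by `|ψ|²`.
    _ ≤ ‖wave ψ p‖ ^ 2 + (‖wave ψ p‖ * ‖v‖) ^ 2 := by
        rw [density]
        nlinarith [sq_nonneg (‖wave ψ p‖ * (1 - ‖v‖)), sq_nonneg (‖wave ψ p‖ * ‖v‖)]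
    _ ≤ _ := by linarith

lemma variation_log_distSq_le (hm : ∀ j, 0 < m j) {b : Fin 3 → Cfg d} (hb : Orthonormal ℝ b)
    {c : Cfg d} {p : ℝ × Cfg d} (hp : p ∈ nonNodal ψ Ω) (hr : distSq b c p.2 ≠ 0) :
    density ψ p *
      ‖fderiv ℝ (fun p : ℝ × Cfg d => Real.log (distSq b c p.2)) p (1, velocityField m A ψ p)‖ ≤
      variationConst m * energy A ψ p + 3 * (‖wave ψ p‖ ^ 2 / distSq b c p.2) := by
  set v := velocityField m A ψ p with hv
  have hr0 := (distSq_nonneg b c p.2).lt_of_ne' hr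
  have h1 : HasFDerivAt (fun p : ℝ × Cfg d => distSq b c p.2) _ p :=
    HasFDerivAt.comp (g := distSq b c) (f := Prod.snd) p
      (((contDiff_distSq b c (n := 1)).differentiable one_ne_zero) p.2).hasFDerivAt hasFDerivAt_snd
  rw [density_mul_fderiv_log h1.differentiableAt hr0, h1.fderiv]
  have h2 := abs_fderiv_distSq_le hb c p.2 v
  have h3 := Real.sq_sqrt hr0.le
  have hs := Real.sqrt_pos.2 hr0
  set s := √(distSq b c p.2) with hsdef
  have h5 := sq_norm_velocityField_le (A := A) hm hp
  rw [← hv] at h5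
  have h4 : density ψ p * (|fderiv ℝ (distSq b c) p.2 v| / distSq b c p.2) ≤
      6 * ((‖wave ψ p‖ * ‖v‖) * (‖wave ψ p‖ / s)) := by
    calc _ ≤ density ψ p * (6 * s * ‖v‖ / distSq b c p.2) := by
          have := (density_pos hp).le
          gcongr
      _ = _ := by
          rw [density, ← h3]
          field_simp
  have h6 : ‖wave ψ p‖ ^ 2 / distSq b c p.2 = (‖wave ψ p‖ / s) ^ 2 := by rw [div_pow, h3]
  refine le_trans h4 ?_
  rw [h6]
  -- `6xy ≤ 3x² + 3y²` separates the speed from `|ψ|/dist`, which is left to Hardy's inequality;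
  -- this uses the factor `3` in `variationConst`.
  nlinarith [sq_nonneg (‖wave ψ p‖ * ‖v‖ - ‖wave ψ p‖ / s), sq_nonneg ‖wave ψ p‖]

end Variation

section Integrals

lemma lintegral_enorm_sq (f : L2 d k) : ∫⁻ q, ‖f q‖ₑ ^ 2 = ‖f‖ₑ ^ 2 := by
  have h := eLpNorm_nnreal_pow_eq_lintegral (μ := (volume : Measure (Cfg d))) (f := f) (p := 2)
    two_ne_zero
  simp only [NNReal.coe_ofNat, ENNReal.rpow_ofNat, ENNReal.coe_ofNat] at h
  rw [← h, Lp.enorm_def]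

lemma ofReal_norm_sq {F : Type*} [SeminormedAddCommGroup F] (x : F) :
    ENNReal.ofReal (‖x‖ ^ 2) = ‖x‖ₑ ^ 2 := by
  rw [ENNReal.ofReal_pow (norm_nonneg _), ofReal_norm]

/-- `g` stands for the L² time derivative `-iHψ(t)`, so the first two norms become constants of the
motion. -/
lemma lintegral_energy_le (hΩ : IsOpen Ω) (hC : ContDiffOn ℝ 2 (wave ψ) (univ ×ˢ Ω)) {f g : L2 d k}
    {t : ℝ} (hψ : ψ t =ᵐ[volume] f)
    (hg : ∀ᵐ q, q ∈ Ω → ‖fderiv ℝ (wave ψ) (t, q) (1, 0)‖ = ‖g q‖) :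
    ∫⁻ q in Ω, ENNReal.ofReal (energy A ψ (t, q)) ≤
      ‖f‖ₑ ^ 2 + ‖g‖ₑ ^ 2 + (∫⁻ q in Ω, ∑ j, ‖pd j (ψ t) q‖ₑ ^ 2)
        + ∫⁻ q in Ω, (‖A q‖ₑ * ‖ψ t q‖ₑ) ^ 2 := by
  have e : ∀ q, ENNReal.ofReal (energy A ψ (t, q)) = ‖ψ t q‖ₑ ^ 2
      + (‖fderiv ℝ (wave ψ) (t, q) (1, 0)‖ₑ ^ 2 + ((∑ j, ‖pd j (ψ t) q‖ₑ ^ 2)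
      + (‖A q‖ₑ * ‖ψ t q‖ₑ) ^ 2)) := fun q => by
    have hN : 0 ≤ ∑ j, ‖pd j (ψ t) q‖ ^ 2 := Finset.sum_nonneg fun _ _ => sq_nonneg _
    rw [energy, ENNReal.ofReal_add (by positivity) (by positivity),
      ENNReal.ofReal_add (by positivity) (by positivity),
      ENNReal.ofReal_add (by positivity) (by positivity),
      ENNReal.ofReal_sum_of_nonneg fun _ _ => sq_nonneg _,
      ENNReal.ofReal_pow (p := ‖A (t, q).2‖ * ‖wave ψ (t, q)‖) (by positivity),
      ENNReal.ofReal_mul (norm_nonneg _), ofReal_norm, ofReal_norm]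
    simp only [ofReal_norm_sq, wave, add_assoc]
  have c0 : ContinuousOn (ψ t) Ω := (contDiffOn_slice hC t).continuousOn
  have c1 : ContinuousOn (fun q => fderiv ℝ (wave ψ) (t, q) (1, 0)) Ω :=
    (contDiffOn_fderiv_wave hΩ hC (1, 0)).continuousOn.comp
      (Continuous.prodMk_right t).continuousOn fun q hq => ⟨mem_univ _, hq⟩
  have c2 : ∀ j, ContinuousOn (pd j (ψ t)) Ω := fun j =>
    (contDiffOn_pd hΩ (contDiffOn_slice hC t) (m := 1) (by norm_num) j).continuousOn
  simp_rw [e]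
  rw [lintegral_add_left' ((c0.aestronglyMeasurable hΩ.measurableSet).enorm.pow_const 2),
    lintegral_add_left' ((c1.aestronglyMeasurable hΩ.measurableSet).enorm.pow_const 2),
    lintegral_add_left' (Finset.aemeasurable_fun_sum _ fun j _ =>
      (((c2 j).aestronglyMeasurable hΩ.measurableSet).enorm.pow_const 2)), ← add_assoc, ← add_assoc]
  gcongr
  · rw [← lintegral_enorm_sq f]
    refine (setLIntegral_le_lintegral _ _).trans (lintegral_mono_ae ?_)
    filter_upwards [hψ] with q hq
    rw [hq]
  · rw [← lintegral_enorm_sq g]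
    refine le_trans (lintegral_mono_ae ?_) (setLIntegral_le_lintegral Ω _)
    refine (ae_restrict_iff' hΩ.measurableSet).2 ?_
    filter_upwards [hg] with q hq hqΩ
    rw [← ofReal_norm, hq hqΩ, ofReal_norm]

end Integrals

/-! ### Assembly of the main theorem -/

variable {d k n : ℕ} {ψ : ℝ → Cfg d → Spin k} {Ω : Set (Cfg d)} {m : Fin d → ℝ} {A : Cfg d → Cfg d}

lemma densityMeasure_eq_sliceMeasure (hΩ : IsOpen Ω) (t : ℝ) :
    densityMeasure ψ Ω t = sliceMeasure (nonNodal ψ Ω) (density ψ) t := by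
  rw [densityMeasure, sliceMeasure, ← withDensity_indicator hΩ.measurableSet]
  congr 1
  ext q
  by_cases hq : q ∈ Ω
  · by_cases h0 : ψ t q = 0
    · simp [hq, h0, nonNodal, wave]
    · have : (t, q) ∈ nonNodal ψ Ω := ⟨hq, h0⟩
      rw [indicator_of_mem hq, indicator_of_mem this, density, ofReal_norm_sq, wave]
  · simp [hq, nonNodal]

lemma densityMeasure_univ (hΩ : ∀ᵐ x : Cfg d, x ∈ Ω) {f : L2 d k} {t : ℝ}
    (hψ : ψ t =ᵐ[volume] f) : densityMeasure ψ Ω t univ = ‖f‖ₑ ^ 2 := by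
  rw [densityMeasure, withDensity_apply _ MeasurableSet.univ, Measure.restrict_univ,
    Measure.restrict_eq_self_of_ae_mem hΩ, ← lintegral_enorm_sq f]
  refine lintegral_congr_ae ?_
  filter_upwards [hψ] with q hq
  rw [hq]

lemma isTrajectoryOn_iff {I : Set ℝ} {Q : ℝ → Cfg d} :
    IsTrajectoryOn m A ψ Ω I Q ↔ IsSolutionOn (nonNodal ψ Ω) (velocityField m A ψ) I Q := by
  simp only [IsTrajectoryOn, IsSolutionOn, nonNodal, mem_ofPred_eq, and_assoc, wave, velocityField]

lemma reaches_iff {t : ℝ} {q x : Cfg d} :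
    Reaches m A ψ Ω t q x ↔ SolutionJoins (nonNodal ψ Ω) (velocityField m A ψ) t q x := by
  simp only [Reaches, SolutionJoins, isTrajectoryOn_iff]

/-- Uniqueness of solutions shows that the end point chosen in `flow` does not depend on the choice.
-/
lemma flow_eq_some (hD : IsOpen (nonNodal ψ Ω))
    (hv : ContDiffOn ℝ 1 (velocityField m A ψ) (nonNodal ψ Ω)) {t : ℝ} {q x : Cfg d}
    (h : SolutionJoins (nonNodal ψ Ω) (velocityField m A ψ) t q x) :
    flow m A ψ Ω t q = some x := by
  by_cases ht : t = 0
  · obtain ⟨I, γ, -, -, -, -, -, h0, h1⟩ := h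
    rw [flow, if_pos ht, ← h0, ← h1, ht]
  · have hex : ∃ x, Reaches m A ψ Ω t q x := ⟨x, reaches_iff.2 h⟩
    rw [flow, if_neg ht, dif_pos hex, (reaches_iff.1 hex.choose_spec).unique hD hv h]

/-- The variation of `confiner` along trajectories on a time slice is bounded in terms of the
norms of the wave function and its derivatives. -/
lemma lintegral_variation_le (hΩ : IsOpen Ω) (hm : ∀ j, 0 < m j)
    (hC : ContDiffOn ℝ 2 (wave ψ) (univ ×ˢ Ω))
    (hN : ∀ v : Cfg d, ∀ᵐ x : Cfg d, ∀ s : ℝ, x + s • v ∉ Ωᶜ)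
    {b : Fin n → Fin 3 → Cfg d} {c : Fin n → Cfg d} (hb : ∀ l, Orthonormal ℝ (b l))
    (hr : ∀ l, ∀ x ∈ Ω, distSq (b l) (c l) x ≠ 0) {f g : L2 d k} {t : ℝ} (hψ : ψ t =ᵐ[volume] f)
    (hg : ∀ᵐ q, q ∈ Ω → ‖fderiv ℝ (wave ψ) (t, q) (1, 0)‖ = ‖g q‖)
    (i : Option (Option (Fin n))) :
    ∫⁻ x, (nonNodal ψ Ω).indicator (fun p => ENNReal.ofReal (density ψ p) *
        ‖fderiv ℝ (confiner ψ b c i) p (1, velocityField m A ψ p)‖ₑ) (t, x) ≤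
      (ENNReal.ofReal (variationConst m) + 36) * (‖f‖ₑ ^ 2 + ‖g‖ₑ ^ 2 +
        (∫⁻ q in Ω, ∑ j, ‖pd j (ψ t) q‖ₑ ^ 2) + ∫⁻ q in Ω, (‖A q‖ₑ * ‖ψ t q‖ₑ) ^ 2) := by
  set E := ‖f‖ₑ ^ 2 + ‖g‖ₑ ^ 2 + (∫⁻ q in Ω, ∑ j, ‖pd j (ψ t) q‖ₑ ^ 2)
    + ∫⁻ q in Ω, (‖A q‖ₑ * ‖ψ t q‖ₑ) ^ 2 with hE
  have hle : ∀ F : Cfg d → ℝ≥0∞, (∀ x, (t, x) ∈ nonNodal ψ Ω → ENNReal.ofReal (density ψ (t, x) *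
        ‖fderiv ℝ (confiner ψ b c i) (t, x) (1, velocityField m A ψ (t, x))‖) ≤ F x) →
      ∫⁻ x, (nonNodal ψ Ω).indicator (fun p => ENNReal.ofReal (density ψ p) *
        ‖fderiv ℝ (confiner ψ b c i) p (1, velocityField m A ψ p)‖ₑ) (t, x) ≤
        ∫⁻ x in Ω, F x := fun F hF => by
    rw [← lintegral_indicator hΩ.measurableSet]
    refine lintegral_mono fun x => indicator_apply_le' (fun hx => ?_) fun _ => zero_le
    rw [indicator_of_mem hx.1, ← ofReal_norm, ← ENNReal.ofReal_mul (density_pos hx).le]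
    exact hF x hx
  have hEn : ∫⁻ x in Ω, ENNReal.ofReal (variationConst m * energy A ψ (t, x)) ≤
      ENNReal.ofReal (variationConst m) * E := by
    simp_rw [ENNReal.ofReal_mul (variationConst_nonneg m)]
    rw [lintegral_const_mul' _ _ ENNReal.ofReal_ne_top]
    gcongr
    exact lintegral_energy_le hΩ hC hψ hg
  rcases i with _ | _ | l
  · refine (hle _ fun x hx => ENNReal.ofReal_le_ofReal
      (variation_log_density_le hΩ hm hC hx)).trans (hEn.trans ?_)
    gcongr
    exact le_self_add
  · refine (hle _ fun x hx => ENNReal.ofReal_le_ofReal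
      (variation_log_one_add_norm_sq_le hm hx)).trans (hEn.trans ?_)
    gcongr
    exact le_self_add
  · have c0 : ContinuousOn (ψ t) Ω := (contDiffOn_slice hC t).continuousOn
    have hH := lintegral_div_distSq_le (c := c l) hΩ hN (hb l) (hr l)
      ((contDiffOn_slice hC t).of_le (by norm_num)) ((memLp_congr_ae hψ).2 (Lp.memLp f))
    refine (hle (fun x => ENNReal.ofReal (variationConst m * energy A ψ (t, x))
      + 3 * ENNReal.ofReal (‖ψ t x‖ ^ 2 / distSq (b l) (c l) x)) fun x hx => ?_).trans ?_
    · refine (ENNReal.ofReal_le_ofReal (variation_log_distSq_le (A := A) hm (hb l) hx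
        (hr l x hx.1))).trans (ENNReal.ofReal_add_le.trans ?_)
      rw [ENNReal.ofReal_mul (p := 3) (by norm_num)]
      simp [wave]
    · rw [lintegral_add_right', lintegral_const_mul' _ _ (by simp), add_mul]
      · refine add_le_add hEn ?_
        -- The constant `36` is Hardy's `12` times the weight `3` in `variation_log_distSq_le`.
        calc _ ≤ 3 * (12 * ∫⁻ q in Ω, ∑ j, ‖pd j (ψ t) q‖ₑ ^ 2) := by gcongr
          _ ≤ 3 * (12 * E) := by
            gcongr
            rw [hE, add_right_comm]
            exact le_add_self
          _ = _ := by
            rw [← mul_assoc]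
            norm_num
      · exact (((c0.norm.pow 2).div (contDiff_distSq _ _ (n := 0)).continuous.continuousOn
          (hr l)).aemeasurable hΩ.measurableSet).ennreal_ofReal.const_mul 3

end Bohm

theorem mainTheorem6 {d k n : ℕ}
    (m : Fin d → ℝ) (hm : ∀ j, 0 < m j)
    (S : Fin n → AffineSubspace ℝ (Bohm.Cfg d))
    (hS_ne : ∀ l, (S l : Set (Bohm.Cfg d)).Nonempty)
    (hS_dim : ∀ l, Module.finrank ℝ (S l).direction + 3 = d)
    (A : Bohm.Cfg d → Bohm.Cfg d) (hA : Bohm.MemH1loc A)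
    (V : Bohm.Cfg d → Matrix (Fin k) (Fin k) ℂ)
    (hV_herm : ∀ q ∈ Bohm.conf S, (V q).IsHermitian)
    (hV : ∀ a b, Bohm.MemL2loc (Bohm.conf S) (fun q => V q a b))
    (H : Bohm.L2 d k →ₗ.[ℂ] Bohm.L2 d k) (hH : IsSelfAdjoint H)
    (hH_ext : Bohm.ExtendsSchrodinger m A V (Bohm.conf S) H)
    (U : ℝ → Bohm.L2 d k ≃ₗᵢ[ℂ] Bohm.L2 d k) (hU : Bohm.IsUnitaryGroupOf H U)
    (ψ₀ : Bohm.L2 d k) (hψ₀ : ψ₀ ∈ H.domain) (hψ₀_norm : ‖ψ₀‖ = 1)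
    (ψ : ℝ → Bohm.Cfg d → Bohm.Spin k)
    (hψ : ∀ t, ψ t =ᵐ[MeasureTheory.volume] U t ψ₀)
    (hψ_C2 : ContDiffOn ℝ 2 (fun p : ℝ × Bohm.Cfg d => ψ p.1 p.2) (Set.univ ×ˢ Bohm.conf S))
    (hA_C1 : ContDiffOn ℝ 1 A {q ∈ Bohm.conf S | ∃ t, ψ t q ≠ 0})
    (hfin : ∀ T : ℝ, 0 < T →
      ∫⁻ t in Set.Icc (-T) T,
        ((∫⁻ q in Bohm.conf S, ∑ j, ‖Bohm.pd j (ψ t) q‖ₑ ^ 2)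
          + (∫⁻ q in Bohm.conf S, (‖A q‖ₑ * ‖ψ t q‖ₑ) ^ 2)
          + ∫⁻ q in Bohm.conf S, ‖∑ j, A q j • Bohm.pd j (ψ t) q‖ₑ ^ 2) < ⊤) :
    (∀ᵐ q ∂(Bohm.densityMeasure ψ (Bohm.conf S) 0),
      ∃! Q : ℝ → Bohm.Cfg d,
        Q 0 = q ∧ Bohm.IsTrajectoryOn m A ψ (Bohm.conf S) Set.univ Q) ∧
    Bohm.IsEquivariantOn m A ψ (Bohm.conf S) Set.univ := by
  set Ω := Bohm.conf S with hΩdef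
  have hΩ : IsOpen Ω := Bohm.isOpen_conf S
  have hC : ContDiffOn ℝ 2 (Bohm.wave ψ) (univ ×ˢ Ω) := hψ_C2
  have hN : ∀ v : Bohm.Cfg d, ∀ᵐ x : Bohm.Cfg d, ∀ s : ℝ, x + s • v ∉ Ωᶜ :=
    Bohm.ae_forall_add_smul_notMem hS_dim
  have hΩae : ∀ᵐ x : Bohm.Cfg d, x ∈ Ω := by
    filter_upwards [hN 0] with x hx
    simpa using hx 0
  choose c hc using hS_ne
  choose b hb hdist using fun l => Bohm.exists_orthonormal_distSq (hS_dim l) (hc l)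
  have hr : ∀ l, ∀ x ∈ Ω, Bohm.distSq (b l) (c l) x ≠ 0 := fun l x hx h0 =>
    hx (mem_iUnion.2 ⟨l, (hdist l x).1 h0⟩)
  have hmem : ∀ x, (∀ l, Bohm.distSq (b l) (c l) x ≠ 0) → x ∈ Ω := fun x hx h => by
    obtain ⟨l, hl⟩ := mem_iUnion.1 h
    exact hx l ((hdist l x).2 hl)
  obtain ⟨g, hg⟩ : ∃ g, (ψ₀, g) ∈ H.graph := ⟨H ⟨ψ₀, hψ₀⟩, H.mem_graph ⟨ψ₀, hψ₀⟩⟩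
  have hder : ∀ t, ∀ᵐ q, q ∈ Ω → ‖fderiv ℝ (Bohm.wave ψ) (t, q) (1, 0)‖ =
      ‖(-(Complex.I • U t g) : Bohm.L2 d k) q‖ := fun t => by
    filter_upwards [Bohm.ae_eq_of_hasDerivAt_L2 (hU.hasDerivAt hg t) hψ
      (fun q hq => Bohm.hasDerivAt_wave (t := t) hΩ hC hq)] with q h hq
    rw [h hq]
  have hS := Bohm.schrodinger_eq_ae hΩ m hA hV_herm hV hH hH_ext hU hg hψ hC hA_C1
  -- Unitarity preserves the norm, and neither the nodes nor the null set outside `Ω` carry mass.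
  have hmass : ∀ t, Bohm.sliceMeasure (Bohm.nonNodal ψ Ω) (Bohm.density ψ) t univ = 1 := fun t => by
    rw [← Bohm.densityMeasure_eq_sliceMeasure hΩ, Bohm.densityMeasure_univ hΩae (hψ t),
      ← ofReal_norm, LinearIsometryEquiv.norm_map, hψ₀_norm]
    simp
  have hF : Bohm.ConfinedFlow (Bohm.nonNodal ψ Ω) (Bohm.velocityField m A ψ) (Bohm.density ψ)
      (Bohm.confiner ψ b c) :=
    { isOpen := Bohm.isOpen_nonNodal hΩ hC.continuousOn
      contDiffOn_velocity := Bohm.contDiffOn_velocityField hΩ hC hA_C1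
      contDiffOn_density := Bohm.contDiffOn_density hC
      density_nonneg := fun p _ => sq_nonneg _
      continuityEq := fun p hp =>
        Bohm.continuityEqAt_velocityField hΩ hV_herm hC hA_C1 hS hp
      contDiffOn := Bohm.contDiffOn_confiner hC hr
      confine := Bohm.exists_isCompact_of_confiner_lt hC.continuousOn hr hmem
      variation := fun T hT i => by
        refine ne_top_of_le_ne_top ?_ (lintegral_mono fun t =>
          Bohm.lintegral_variation_le (A := A) hΩ hm hC hN hb hr (hψ t) (hder t) i)
        rw [lintegral_const_mul' _ _ (by simp)]
        refine ENNReal.mul_ne_top (by simp) ?_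
        -- The first two norms do not depend on `t`, and the remaining terms are among the integrals
        -- assumed finite.
        have hle : ∀ t, ‖U t ψ₀‖ₑ ^ 2 + ‖(-(Complex.I • U t g) : Bohm.L2 d k)‖ₑ ^ 2 +
            (∫⁻ q in Ω, ∑ j, ‖Bohm.pd j (ψ t) q‖ₑ ^ 2) + (∫⁻ q in Ω, (‖A q‖ₑ * ‖ψ t q‖ₑ) ^ 2) ≤
            (‖ψ₀‖ₑ ^ 2 + ‖g‖ₑ ^ 2) + ((∫⁻ q in Ω, ∑ j, ‖Bohm.pd j (ψ t) q‖ₑ ^ 2)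
              + (∫⁻ q in Ω, (‖A q‖ₑ * ‖ψ t q‖ₑ) ^ 2)
              + ∫⁻ q in Ω, ‖∑ j, A q j • Bohm.pd j (ψ t) q‖ₑ ^ 2) := fun t => by
          have e1 : ‖U t ψ₀‖ₑ = ‖ψ₀‖ₑ := by
            rw [← ofReal_norm, LinearIsometryEquiv.norm_map, ofReal_norm]
          have e2 : ‖(-(Complex.I • U t g) : Bohm.L2 d k)‖ₑ = ‖g‖ₑ := by
            rw [← ofReal_norm, norm_neg, norm_smul, Complex.norm_I, one_mul,
              LinearIsometryEquiv.norm_map, ofReal_norm]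
          rw [e1, e2, add_assoc (_ + _)]
          exact add_le_add le_rfl le_self_add
        refine ne_top_of_le_ne_top ?_ (lintegral_mono hle)
        rw [lintegral_add_left measurable_const]
        refine ENNReal.add_ne_top.2 ⟨?_, (hfin T hT).ne⟩
        rw [setLIntegral_const]
        exact ENNReal.mul_ne_top (by simp) (by simp)
      mass := by rw [hmass]; simp }
  refine ⟨?_, fun t _ B hB => ?_⟩
  · rw [Bohm.densityMeasure_eq_sliceMeasure hΩ]
    simp only [Bohm.isTrajectoryOn_iff]
    exact hF.ae_existsUnique
  · rw [Bohm.densityMeasure_eq_sliceMeasure hΩ, Bohm.densityMeasure_eq_sliceMeasure hΩ]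
    exact hF.equivariant (by rw [hmass, hmass])
      (fun q x h => Bohm.flow_eq_some hF.isOpen hF.contDiffOn_velocity h) hB
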